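/- **Setting.** Let $\mathfrak g$ be a compact simple real Lie algebra with normalised Killing metric $g_{\mathfrak g}$ (the positive definite invariant form for which the highest root has squared length $2$) and dual Coxeter number $v^{\mathfrak g}$ (so minus the Killing form equals $2v^{\mathfrak g}g_{\mathfrak g}$). Let $T^a$ be hermitian generators, $[T^a,T^b]=i f^{ab}{}_c T^c$. Let $j^a$ be the currents of the current algebra of $\mathfrak g$ of level $k\in\{1,2,3,\dots\}$ in its unitary positive-energy vacuum representation, $$[j^a(x),j^b(y)]=i f^{ab}{}_c\, j^c(x)\,\delta(x-y)+k\,g_{\mathfrak g}^{ab}\,\tfrac{i}{2\pi}\,\delta'(x-y),$$ with Sugawara stress-energy tensor $\Theta^{\mathfrak g}=\frac{\pi}{k+v^{\mathfrak g}}\,g^{\mathfrak g}_{ab}:\!j^aj^b\!:$. Let $\iota:\mathfrak h\hookrightarrow\mathfrak g$ be an injective homomorphism from a reductive Lie algebra $\mathfrak h=\bigoplus_\alpha\mathfrak h_\alpha$, where the $\mathfrak h_\alpha$ are the simple ideals of $\mathfrak h$ and its centre. For a simple ideal let $g_\alpha$ be its normalised Killing metric, $v^\alpha$ its dual Coxeter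 number and $I_\alpha$ the Dynkin index of $\iota|_{\mathfrak h_\alpha}$, i.e. $g_{\mathfrak g}(\iota X,\iota Y)=I_\alpha\, g_\alpha(X,Y)$ on $\mathfrak h_\alpha$; for the centre let $I_\alpha=1$, $v^\alpha=0$ and let $g_\alpha$ be the pullback of $g_{\mathfrak g}$. Put $$\Theta^{\mathfrak h}=\sum_\alpha\Theta^\alpha,\qquad \Theta^\alpha=\frac{\pi}{I_\alpha k+v^\alpha}\,g^\alpha_{ab}:\!j^{\iota(a)}j^{\iota(b)}\!:,$$ let $C_2^\alpha=g^\alpha_{ab}\,\mathrm{Ad}_{T^{\iota(b)}}\mathrm{Ad}_{T^{\iota(a)}}$ be the second Casimir element of $\mathfrak h_\alpha$ acting on $\mathfrak g$, let $P_\alpha$ be the orthogonal projection of $\mathfrak g$ onto $\iota(\mathfrak h_\alpha)$, and let $$\widetilde C_2^{\iota(\mathfrak h)}=\sum_\alpha\frac{2I_\alpha k P_\alpha+C_2^\alpha}{2(I_\alpha k+v^\alpha)}$$ be the weighted Casimir element. A current $j^c$ of colour $T^c\in\mathfrak g$ is said to transform covariantly with respect to $\Theta^{\mathfrak h}$ if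 $[\Theta^{\mathfrak g}(f),j^c(g)]=[\Theta^{\mathfrak h}(f),j^c(g)]$ for all test functions $f,g$, where commutators are understood through their matrix elements between finite-energy vectors. **Statement.** 1. A current $j^c$ transforms covariantly with respect to $\Theta^{\mathfrak h}$ if and only if its colour satisfies $\widetilde C_2^{\iota(\mathfrak h)}T^c=T^c$. 2. The covariant colours form a reductive Lie subalgebra $\mathfrak k$ of $\mathfrak g$ with $\iota(\mathfrak h)\subseteq\mathfrak k\subseteq\mathfrak g$. 3. If $\mathfrak k\neq\iota(\mathfrak h)$, then the level of the current algebra of $\mathfrak g$ is $k=1$. -/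

import Mathlib

open scoped TensorProduct ContDiff InnerProductSpace

noncomputable section

/-! ## Lie algebra data: normalised metric, dual Coxeter number, Dynkin index, Casimir element -/

/-- The set of all squared lengths `(α, α)` of roots `α` of the complexified Lie algebra
`ℂ ⊗ 𝔰` (for any Cartan subalgebra `H`), with respect to the form induced on the dual of `H` by
the Killing form `κ`: if `t ∈ H` represents `α`, that is `κ(t, x) = α(x)` on `H`, then
`(α, α) = κ(t, t)`. -/
def killingRootLengthSq (𝔰 : Type*) [LieRing 𝔰] [LieAlgebra ℝ 𝔰] : Set ℝ :=
  {r | ∃ (H : LieSubalgebra ℂ (ℂ ⊗[ℝ] 𝔰)) (_ : H.IsCartanSubalgebra)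
      (α : LieModule.Weight ℂ H (ℂ ⊗[ℝ] 𝔰)) (t : H), α.IsNonZero ∧
      (∀ x : H, killingForm ℂ (ℂ ⊗[ℝ] 𝔰) (t : ℂ ⊗[ℝ] 𝔰) (x : ℂ ⊗[ℝ] 𝔰) = α x) ∧
      killingForm ℂ (ℂ ⊗[ℝ] 𝔰) (t : ℂ ⊗[ℝ] 𝔰) (t : ℂ ⊗[ℝ] 𝔰) = (r : ℂ)}

/-- The squared length, with respect to the Killing form, of the highest (i.e. a longest) root. -/
def killingHighestRootSq (𝔰 : Type*) [LieRing 𝔰] [LieAlgebra ℝ 𝔰] : ℝ :=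
  sSup (killingRootLengthSq 𝔰)

/-- The (normalised) Killing metric `g_𝔰` of a compact simple real Lie algebra: the positive
multiple of minus the Killing form for which the highest root has squared length `2`.
(Multiplying a form by `c` divides the squared lengths of the roots by `c`; the minus sign makes
the metric positive definite on the compact real form.) -/
def normalizedForm (𝔰 : Type*) [LieRing 𝔰] [LieAlgebra ℝ 𝔰] : LinearMap.BilinForm ℝ 𝔰 :=
  (-(killingHighestRootSq 𝔰 / 2)) • killingForm ℝ 𝔰

/-- The dual Coxeter number `v^𝔰` of a compact simple real Lie algebra: the number with
`-κ = 2 v^𝔰 g_𝔰`, i.e. half of the eigenvalue of the quadratic Casimir element of `g_𝔰` in the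
adjoint representation. -/
def dualCoxeter (𝔰 : Type*) [LieRing 𝔰] [LieAlgebra ℝ 𝔰] : ℝ :=
  (killingHighestRootSq 𝔰)⁻¹

/-- The pullback `(X, Y) ↦ g_𝔤(ι X, ι Y)` of the normalised Killing metric of `𝔤`. -/
def pullbackForm {𝔰 𝔤 : Type*} [LieRing 𝔰] [LieAlgebra ℝ 𝔰] [LieRing 𝔤] [LieAlgebra ℝ 𝔤]
    (ι : 𝔰 →ₗ⁅ℝ⁆ 𝔤) : LinearMap.BilinForm ℝ 𝔰 :=
  (normalizedForm 𝔤).compl₁₂ (ι : 𝔰 →ₗ[ℝ] 𝔤) (ι : 𝔰 →ₗ[ℝ] 𝔤)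

/-- The Dynkin index of an embedding of simple Lie algebras: the number `I` with
`g_𝔤(ι X, ι Y) = I g_𝔰(X, Y)`. -/
def dynkinIndex {𝔰 𝔤 : Type*} [LieRing 𝔰] [LieAlgebra ℝ 𝔰] [LieRing 𝔤] [LieAlgebra ℝ 𝔤]
    (ι : 𝔰 →ₗ⁅ℝ⁆ 𝔤) : ℝ :=
  Classical.epsilon fun I : ℝ => ∀ X Y : 𝔰, pullbackForm ι X Y = I * normalizedForm 𝔰 X Y

/-- The inverse `g_{ab}` of the matrix `g^{ab} = B(T^a, T^b)` in a fixed basis of `𝔰`. -/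
def inverseGram {𝔰 : Type*} [LieRing 𝔰] [LieAlgebra ℝ 𝔰] [FiniteDimensional ℝ 𝔰]
    (B : LinearMap.BilinForm ℝ 𝔰) :
    Matrix (Fin (Module.finrank ℝ 𝔰)) (Fin (Module.finrank ℝ 𝔰)) ℝ :=
  (Matrix.of fun a b => B (Module.finBasis ℝ 𝔰 a) (Module.finBasis ℝ 𝔰 b))⁻¹

/-- The second Casimir element of `(𝔰, B)` acting on `𝔤` by `Ad ∘ ι`:
`C₂ = - ∑ g_{ab} ad(ι X^b) ad(ι X^a)`. The sign comes from using the real basis `X^a = -i T^a` in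
place of the hermitian generators `T^a`. -/
def casimir {𝔰 𝔤 : Type*} [LieRing 𝔰] [LieAlgebra ℝ 𝔰] [FiniteDimensional ℝ 𝔰]
    [LieRing 𝔤] [LieAlgebra ℝ 𝔤] (ι : 𝔰 →ₗ⁅ℝ⁆ 𝔤) (B : LinearMap.BilinForm ℝ 𝔰) :
    𝔤 →ₗ[ℝ] 𝔤 :=
  -∑ a, ∑ b, inverseGram B a b •
    (LieAlgebra.ad ℝ 𝔤 (ι (Module.finBasis ℝ 𝔰 b)) ∘ₗ LieAlgebra.ad ℝ 𝔤 (ι (Module.finBasis ℝ 𝔰 a)))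

/-- The orthogonal projection (for `g_𝔤`) of `𝔤` onto `ι(𝔰)`. -/
def colourProjection {𝔰 𝔤 : Type*} [LieRing 𝔰] [LieAlgebra ℝ 𝔰] [FiniteDimensional ℝ 𝔰]
    [LieRing 𝔤] [LieAlgebra ℝ 𝔤] (ι : 𝔰 →ₗ⁅ℝ⁆ 𝔤) : 𝔤 →ₗ[ℝ] 𝔤 :=
  ∑ a, ∑ b, inverseGram (pullbackForm ι) a b •
    ((normalizedForm 𝔤 (ι (Module.finBasis ℝ 𝔰 b))).smulRight (ι (Module.finBasis ℝ 𝔰 a)))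

/-- `𝔥` is the direct sum of its centre and of the simple ideals `𝔰 0, …, 𝔰 (n-1)`. -/
def IsReductiveDecomposition {𝔥 : Type*} [LieRing 𝔥] [LieAlgebra ℝ 𝔥] {n : ℕ}
    (𝔰 : Fin n → LieIdeal ℝ 𝔥) : Prop :=
  (∀ α, LieAlgebra.IsSimple ℝ (𝔰 α)) ∧
    DirectSum.IsInternal fun o : Option (Fin n) =>
      (o.elim (LieAlgebra.center ℝ 𝔥) 𝔰 : LieIdeal ℝ 𝔥).toSubmodule

/-- A reductive Lie algebra: a direct sum of finitely many simple ideals and an abelian ideal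
(which then is the centre). -/
def IsReductiveLie (𝔥 : Type*) [LieRing 𝔥] [LieAlgebra ℝ 𝔥] : Prop :=
  ∃ (n : ℕ) (𝔰 : Fin n → LieIdeal ℝ 𝔥), IsReductiveDecomposition 𝔰

/-- The restriction of `ι : 𝔥 → 𝔤` to an ideal of `𝔥`. -/
def restrictHom {𝔥 𝔤 : Type*} [LieRing 𝔥] [LieAlgebra ℝ 𝔥] [LieRing 𝔤] [LieAlgebra ℝ 𝔤]
    (ι : 𝔥 →ₗ⁅ℝ⁆ 𝔤) (I : LieIdeal ℝ 𝔥) : I →ₗ⁅ℝ⁆ 𝔤 :=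
  ι.comp I.incl

/-- The weighted Casimir element `∑_α (2 I_α k P_α + C₂^α) / (2 (I_α k + v^α))` of `ι(𝔥)`, the sum
being over the simple ideals `𝔰 α` of `𝔥` and the centre of `𝔥`. By convention the centre has index
`1`, dual Coxeter number `0`, and carries the metric pulled back from `𝔤`. -/
def weightedCasimir {𝔥 𝔤 : Type*} [LieRing 𝔥] [LieAlgebra ℝ 𝔥] [FiniteDimensional ℝ 𝔥]
    [LieRing 𝔤] [LieAlgebra ℝ 𝔤] (k : ℕ) (ι : 𝔥 →ₗ⁅ℝ⁆ 𝔤) {n : ℕ} (𝔰 : Fin n → LieIdeal ℝ 𝔥) :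
    𝔤 →ₗ[ℝ] 𝔤 :=
  (∑ α, (1 / (2 * (dynkinIndex (restrictHom ι (𝔰 α)) * k + dualCoxeter (𝔰 α)))) •
      ((2 * dynkinIndex (restrictHom ι (𝔰 α)) * k) • colourProjection (restrictHom ι (𝔰 α)) +
        casimir (restrictHom ι (𝔰 α)) (normalizedForm (𝔰 α)))) +
    (1 / (2 * (1 * (k : ℝ) + 0))) •
      ((2 * 1 * (k : ℝ)) • colourProjection (restrictHom ι (LieAlgebra.center ℝ 𝔥)) +
        casimir (restrictHom ι (LieAlgebra.center ℝ 𝔥))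
          (pullbackForm (restrictHom ι (LieAlgebra.center ℝ 𝔥))))

/-! ## The current algebra in its vacuum representation -/

/-- The current algebra of level `k` associated with `𝔤`, in its unitary vacuum representation.

`V` is the space of finite energy vectors, dense in the Hilbert space `UniformSpace.Completion V`.
`J X n` is the `n`-th Fourier mode of the current of colour `X`, i.e. the current smeared with
`x ↦ ((1 + i x) / (1 - i x)) ^ n`. The colour space is the real Lie algebra `𝔤` itself: `X ∈ 𝔤`
stands for the hermitian generator `T = i X`, so that `[T^a, T^b] = i f^{ab}_c T^c` reads
`⁅X^a, X^b⁆ = f^{ab}_c X^c`, and the currents are hermitian and real linear in the colour.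
The field `commutator` is, mode by mode, the relation
`[j^a(x), j^b(y)] = i f^{ab}_c j^c(x) δ(x - y) + k g^{ab} (i / 2π) δ'(x - y)`. -/
structure CurrentAlgebra (𝔤 : Type*) [LieRing 𝔤] [LieAlgebra ℝ 𝔤] (k : ℕ)
    (V : Type*) [NormedAddCommGroup V] [InnerProductSpace ℂ V] where
  /-- the modes of the currents -/
  J : 𝔤 →ₗ[ℝ] (ℤ → (V →ₗ[ℂ] V))
  /-- the vacuum vector -/
  vac : V
  norm_vac : ‖vac‖ = 1
  symmetric : ∀ (X : 𝔤) (n : ℤ) (φ ψ : V), ⟪J X n φ, ψ⟫_ℂ = ⟪φ, J X (-n) ψ⟫_ℂ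
  commutator : ∀ (X Y : 𝔤) (m n : ℤ) (φ : V),
    J X m (J Y n φ) - J Y n (J X m φ) =
      Complex.I • J ⁅X, Y⁆ (m + n) φ +
        (if m + n = 0 then (((k : ℝ) * m * normalizedForm 𝔤 X Y : ℝ) : ℂ) else 0) • φ
  /-- positivity of energy -/
  annihilates_vac : ∀ (X : 𝔤) (n : ℤ), 0 ≤ n → J X n vac = 0
  /-- the vacuum is cyclic -/
  cyclic : ∀ W : Submodule ℂ V, vac ∈ W → (∀ X n, ∀ φ ∈ W, J X n φ ∈ W) → W = ⊤

/-- Test functions on the light ray for a current (a field of dimension one): under the Cayley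
transform `x = tan(θ/2)` they become smooth functions on the circle. Schwartz functions and
constants are examples. -/
def IsCurrentTest (g : ℝ → ℂ) : Prop :=
  ∃ G : ℝ → ℂ, ContDiff ℝ ∞ G ∧ Function.Periodic G (2 * Real.pi) ∧
    ∀ θ ∈ Set.Ioo (-Real.pi) Real.pi, G θ = g (Real.tan (θ / 2))

/-- The component, in the angular coordinate `θ` with `x = tan(θ/2)`, of the vector field
`f(x) d/dx` on the light ray: `dθ/dx = 2 / (1 + x²) = 2 cos²(θ/2)`. -/
def angularComponent (f : ℝ → ℂ) (x : ℝ) : ℂ := (2 / (1 + x ^ 2) : ℝ) * f x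

/-- Test functions on the light ray for a stress-energy tensor: under the Cayley transform the
vector field `f(x) d/dx` becomes a smooth vector field on the circle. Schwartz functions,
constants and `x ↦ (x² + 1)/2` are examples. -/
def IsStressTest (f : ℝ → ℂ) : Prop := IsCurrentTest (angularComponent f)

/-- The `n`-th Fourier coefficient of the function `θ ↦ g(tan(θ/2))` on the circle. -/
def circleCoeff (g : ℝ → ℂ) (n : ℤ) : ℂ :=
  (1 / (2 * Real.pi) : ℂ) *
    ∫ θ in (-Real.pi)..Real.pi, Complex.exp (-(Complex.I * n * θ)) * g (Real.tan (θ / 2))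

/-- The operator `∑ₙ cₙ Aₙ` from the finite energy vectors to the Hilbert space. -/
def smear {V : Type*} [NormedAddCommGroup V] [InnerProductSpace ℂ V]
    (c : ℤ → ℂ) (A : ℤ → V → V) (φ : V) : UniformSpace.Completion V :=
  ∑' n : ℤ, c n • ((A n φ : V) : UniformSpace.Completion V)

/-- Pointwise complex conjugate of a test function. -/
def conjTest (f : ℝ → ℂ) (x : ℝ) : ℂ := (starRingEnd ℂ) (f x)

namespace CurrentAlgebra

variable {𝔤 : Type*} [LieRing 𝔤] [LieAlgebra ℝ 𝔤] {k : ℕ}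
  {V : Type*} [NormedAddCommGroup V] [InnerProductSpace ℂ V]

/-- The smeared current `j^X(g)`. -/
def current (A : CurrentAlgebra 𝔤 k V) (X : 𝔤) (g : ℝ → ℂ) : V → UniformSpace.Completion V :=
  smear (circleCoeff g) fun n φ => A.J X n φ

/-- The `n`-th mode `∑ₘ :J^X_m J^Y_{n-m}:` of the normal ordered product: creation modes (`m < 0`)
stand to the left of annihilation modes. On a finite energy vector only finitely many terms are
non-zero. -/
def normalOrdered (A : CurrentAlgebra 𝔤 k V) (X Y : 𝔤) (n : ℤ) (φ : V) : V :=
  ∑ᶠ m : ℤ, if m < 0 then A.J X m (A.J Y (n - m) φ) else A.J Y (n - m) (A.J X m φ)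

/-- The modes `(1 / 2c) ∑ g_{ab} :J^{ι(a)} J^{ι(b)}:ₙ` of the Sugawara field
`(π / c) g_{ab} :j^{ι(a)} j^{ι(b)}:(x)` of `(𝔰, B)`. The modes of a current are `2π` times, those
of a stress-energy tensor again `2π` times, the Fourier coefficients of the field, whence the
prefactor `(2π) (π / c) (2π)⁻² = 1 / 2c`. -/
def sugawaraMode (A : CurrentAlgebra 𝔤 k V) {𝔰 : Type*} [LieRing 𝔰] [LieAlgebra ℝ 𝔰]
    [FiniteDimensional ℝ 𝔰] (ι : 𝔰 →ₗ⁅ℝ⁆ 𝔤) (B : LinearMap.BilinForm ℝ 𝔰) (c : ℝ)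
    (n : ℤ) (φ : V) : V :=
  ((1 / (2 * c) : ℝ) : ℂ) • ∑ a, ∑ b, ((inverseGram B a b : ℝ) : ℂ) •
    A.normalOrdered (ι (Module.finBasis ℝ 𝔰 a)) (ι (Module.finBasis ℝ 𝔰 b)) n φ

/-- The smeared Sugawara field of `(𝔰, B)` with prefactor `π / c`. -/
def sugawara (A : CurrentAlgebra 𝔤 k V) {𝔰 : Type*} [LieRing 𝔰] [LieAlgebra ℝ 𝔰]
    [FiniteDimensional ℝ 𝔰] (ι : 𝔰 →ₗ⁅ℝ⁆ 𝔤) (B : LinearMap.BilinForm ℝ 𝔰) (c : ℝ)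
    (f : ℝ → ℂ) : V → UniformSpace.Completion V :=
  smear (circleCoeff (angularComponent f)) fun n φ => A.sugawaraMode ι B c n φ

/-- The stress-energy tensor `Θ^𝔤(f)`, with prefactor `π / (k + v^𝔤)`. -/
def theta (A : CurrentAlgebra 𝔤 k V) [FiniteDimensional ℝ 𝔤] (f : ℝ → ℂ) :
    V → UniformSpace.Completion V :=
  A.sugawara (LieHom.id : 𝔤 →ₗ⁅ℝ⁆ 𝔤) (normalizedForm 𝔤) (k + dualCoxeter 𝔤) f

/-- The stress-energy tensor `Θ^𝔥(f) = ∑_α Θ^α(f)` of the subalgebra `ι(𝔥)`, the sum being over the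
simple ideals `𝔰 α` and the centre of `𝔥`; `Θ^α` has the prefactor `π / (I_α k + v^α)`. -/
def thetaSub (A : CurrentAlgebra 𝔤 k V) {𝔥 : Type*} [LieRing 𝔥] [LieAlgebra ℝ 𝔥]
    [FiniteDimensional ℝ 𝔥] (ι : 𝔥 →ₗ⁅ℝ⁆ 𝔤) {n : ℕ} (𝔰 : Fin n → LieIdeal ℝ 𝔥)
    (f : ℝ → ℂ) (φ : V) : UniformSpace.Completion V :=
  (∑ α, A.sugawara (restrictHom ι (𝔰 α)) (normalizedForm (𝔰 α))
      (dynkinIndex (restrictHom ι (𝔰 α)) * k + dualCoxeter (𝔰 α)) f φ) +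
    A.sugawara (restrictHom ι (LieAlgebra.center ℝ 𝔥))
      (pullbackForm (restrictHom ι (LieAlgebra.center ℝ 𝔥))) (1 * (k : ℝ) + 0) f φ

/-- The matrix element `⟨φ, [Θ(f), j^X(g)] ψ⟩` between finite energy vectors, `Θ(f)` being given
for all `f` as an operator on finite energy vectors. The smeared fields are moved to the left
vector as the formal adjoints `Θ(f)^* = Θ(f̄)`, `j(g)^* = j(ḡ)`, because `j(g) ψ` and `Θ(f) ψ` are
in general no longer of finite energy. -/
def commutatorElement (A : CurrentAlgebra 𝔤 k V)
    (Θ : (ℝ → ℂ) → V → UniformSpace.Completion V) (X : 𝔤) (f g : ℝ → ℂ) (φ ψ : V) : ℂ :=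
  ⟪Θ (conjTest f) φ, A.current X g ψ⟫_ℂ - ⟪A.current X (conjTest g) φ, Θ f ψ⟫_ℂ

/-- The current of colour `X` transforms covariantly with respect to `Θ^𝔥`:
`[Θ^𝔤(f), j^X(g)] = [Θ^𝔥(f), j^X(g)]` for all test functions `f`, `g`. -/
def IsCovariant (A : CurrentAlgebra 𝔤 k V) [FiniteDimensional ℝ 𝔤] {𝔥 : Type*} [LieRing 𝔥]
    [LieAlgebra ℝ 𝔥] [FiniteDimensional ℝ 𝔥] (ι : 𝔥 →ₗ⁅ℝ⁆ 𝔤) {n : ℕ}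
    (𝔰 : Fin n → LieIdeal ℝ 𝔥) (X : 𝔤) : Prop :=
  ∀ f g : ℝ → ℂ, IsStressTest f → IsCurrentTest g → ∀ φ ψ : V,
    A.commutatorElement A.theta X f g φ ψ = A.commutatorElement (A.thetaSub ι 𝔰) X f g φ ψ

end CurrentAlgebra

end

/-! Let $D_n$ be the modes of the coset field $\Theta^{\mathfrak g}-\Theta^{\mathfrak h}$
(`cosetMap`), and $\Omega$ the vacuum. Characters of the circle are test functions that isolate
single modes, and conversely rapidly decreasing Fourier coefficients beat polynomially growing mode
norms. So covariance of $j^X$ means $[D_n,J^X_m]=0$ for all $n,m$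
(`isCovariant_iff_commutesWithCoset`).

The commutator of a quadratic field with $J^X_m$ is $iW^X_{n+m}-mJ^{CX}_{n+m}$, where $W^X$ is a
normal ordered bilinear and $C$ a Casimir-type map (`quadMap_J`). For $\Theta^{\mathfrak g}$ one has
$C=1$ and $W=0$. With $C$ (now the weighted Casimir) and $W$ taken for $\Theta^{\mathfrak h}$, this
gives $[D_n,J^X_m]=-iW^X_{n+m}-mJ^{X-CX}_{n+m}$.

Since $W^X_{-1}\Omega=0$, applying $[D_0,J^X_{-1}]=0$ to $\Omega$ forces $CX=X$. Conversely, if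
$CX=X$, unitarity removes $W^X$: an induction shows $D_1D_{-1}J^X_{-q-1}\Omega=0$, whence
$D_{-1}J^X_{-q-1}\Omega=0$ because $D_{-1}^*=D_1$, and this vector is $-iW^X_{-q-2}\Omega$
(`quadDefect_vac_eq_zero`). A field of this form that kills the vacuum vanishes
(`quadDefect_eq_zero`).

Covariant currents thus form a commutant, and their colours are closed under brackets. The invariant
inner product of $\mathfrak g$ restricts to $\mathfrak k$, which makes it reductive
(`IsInvariantInner.isReductiveLie`).

For the level, take a covariant $X\neq0$ orthogonal to $\iota(\mathfrak h)$. Let $S$ be the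
symmetric operator on $\mathfrak g$ with tensor $\sum_i w_i(E_i\otimes[E_i,X]+[E_i,X]\otimes E_i)$.
It is not zero, since otherwise $[E_i,X]=0$ for all $i$ and $X=CX=0$. Applying $J^Y_1$ to
$W^X_{-2}\Omega=0$ shows that $S$ is an eigenvector, with eigenvalue $k(\theta,\theta)$, of
$S\mapsto\sum_a\mathrm{ad}_{e_a}S\,\mathrm{ad}_{e_a}$, where the $e_a$ are orthonormal for minus the
Killing form and $\theta$ is a longest root. Eigenvalues of this operator are at most
$(\theta,\theta)$ (`casimir_eigenvalue_le`), so $k\le1$. -/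

open scoped ComplexConjugate

/-! ### Invariant inner products and orthonormal bases. -/

/-- A positive definite symmetric invariant bilinear form on a real Lie algebra. -/
structure IsInvariantInner {L : Type*} [LieRing L] [LieAlgebra ℝ L]
    (B : LinearMap.BilinForm ℝ L) : Prop where
  symm : ∀ x y : L, B x y = B y x
  pos : ∀ x : L, x ≠ 0 → 0 < B x x
  inv : ∀ x y z : L, B ⁅x, y⁆ z = -B y ⁅x, z⁆

/-- A basis is orthonormal with respect to a bilinear form. -/
def IsOrthonormalBasis {ι V : Type*} [DecidableEq ι] [AddCommGroup V] [Module ℝ V]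
    (B : LinearMap.BilinForm ℝ V) (e : Module.Basis ι ℝ V) : Prop :=
  ∀ i j, B (e i) (e j) = if i = j then 1 else 0

theorem exists_isOrthonormalBasis {V : Type*} [AddCommGroup V] [Module ℝ V]
    [FiniteDimensional ℝ V] (B : LinearMap.BilinForm ℝ V) (hs : ∀ x y, B x y = B y x)
    (hp : ∀ x, x ≠ 0 → 0 < B x x) :
    ∃ e : Module.Basis (Fin (Module.finrank ℝ V)) ℝ V, IsOrthonormalBasis B e := by
  let core : InnerProductSpace.Core ℝ V :=
    { inner := fun x y => B x y
      conj_inner_symm := fun x y => by simp [hs x y]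
      re_inner_nonneg := fun x => by
        by_cases hx : x = 0
        · simp [hx]
        · simpa using (hp x hx).le
      add_left := fun x y z => by simp
      smul_left := fun x y r => by simp
      definite := fun x hx => by
        by_contra h
        exact (hp x h).ne' hx }
  let _ : NormedAddCommGroup V := core.toNormedAddCommGroup
  let _ : InnerProductSpace ℝ V := InnerProductSpace.ofCore core.toCore
  let e := stdOrthonormalBasis ℝ V
  refine ⟨e.toBasis, fun i j => ?_⟩
  have h := orthonormal_iff_ite.mp e.orthonormal i j
  rw [← h]
  simp only [OrthonormalBasis.coe_toBasis]
  rfl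

section Orthonormal

variable {V M : Type*} [AddCommGroup V] [Module ℝ V] [AddCommGroup M] [Module ℝ M]
  {κ : Type*} [Fintype κ] [DecidableEq κ] {B : LinearMap.BilinForm ℝ V}
  {e : Module.Basis κ ℝ V}

theorem IsOrthonormalBasis.repr_eq (he : IsOrthonormalBasis B e) (x : V) (i : κ) :
    e.repr x i = B (e i) x := by
  conv_rhs => rw [← e.sum_repr x]
  simp only [map_sum, map_smul, he i, smul_eq_mul, mul_ite, mul_one, mul_zero,
    Finset.sum_ite_eq, Finset.mem_univ, if_true]

theorem IsOrthonormalBasis.sum_eq (he : IsOrthonormalBasis B e) (x : V) :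
    ∑ i, B (e i) x • e i = x := by
  conv_rhs => rw [← e.sum_repr x]
  simp [he.repr_eq]

end Orthonormal

/-- The inverse Gram matrix is the coordinate expression of the tensor inverse to $B$, which in an
orthonormal basis is $\sum_i e_i\otimes e_i$. This removes all inverse Gram matrices from the
Casimir elements, projections and Sugawara modes. -/
theorem sum_inverseGram_smul {𝔰 M : Type*} [LieRing 𝔰] [LieAlgebra ℝ 𝔰] [FiniteDimensional ℝ 𝔰]
    [AddCommGroup M] [Module ℝ M] {B : LinearMap.BilinForm ℝ 𝔰}
    {e : Module.Basis (Fin (Module.finrank ℝ 𝔰)) ℝ 𝔰} (he : IsOrthonormalBasis B e)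
    (Φ : 𝔰 →ₗ[ℝ] 𝔰 →ₗ[ℝ] M) :
    ∑ a, ∑ b, inverseGram B a b • Φ (Module.finBasis ℝ 𝔰 a) (Module.finBasis ℝ 𝔰 b) =
      ∑ i, Φ (e i) (e i) := by
  set b := Module.finBasis ℝ 𝔰 with hb
  let Q : Matrix (Fin (Module.finrank ℝ 𝔰)) (Fin (Module.finrank ℝ 𝔰)) ℝ :=
    Matrix.of fun i a => b.repr (e i) a
  let G : Matrix (Fin (Module.finrank ℝ 𝔰)) (Fin (Module.finrank ℝ 𝔰)) ℝ :=
    Matrix.of fun a c => B (b a) (b c)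
  have hQ : ∀ i, e i = ∑ a, Q i a • b a := fun i => (b.sum_repr (e i)).symm
  have h1 : Q * G * Q.transpose = 1 := by
    ext i j
    rw [Matrix.one_apply, ← he i j]
    conv_rhs => rw [hQ i, hQ j]
    simp only [Matrix.mul_apply, Matrix.transpose_apply, map_sum, map_smul, LinearMap.sum_apply,
      LinearMap.smul_apply, smul_eq_mul, G, Matrix.of_apply, Finset.sum_mul, Finset.mul_sum]
    refine Finset.sum_congr rfl fun a _ => Finset.sum_congr rfl fun c _ => by ring
  have h2 : G⁻¹ = Q.transpose * Q := by
    refine Matrix.inv_eq_left_inv ?_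
    rw [Matrix.mul_assoc]
    exact mul_eq_one_comm.mp h1
  have h3 : ∀ a c, inverseGram B a c = ∑ i, Q i a * Q i c := fun a c => by
    change G⁻¹ a c = _
    rw [h2, Matrix.mul_apply]
    rfl
  have h4 : ∀ i, Φ (e i) (e i) = ∑ a, ∑ c, (Q i a * Q i c) • Φ (b a) (b c) := fun i => by
    conv_lhs => rw [hQ i]
    simp only [map_sum, map_smul, LinearMap.sum_apply, LinearMap.smul_apply, Finset.smul_sum,
      smul_smul]
    rw [Finset.sum_comm]
    refine Finset.sum_congr rfl fun a _ => Finset.sum_congr rfl fun c _ => by rw [mul_comm]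
  simp only [h3, h4, Finset.sum_smul]
  rw [Finset.sum_comm' (t' := Finset.univ) (s' := fun _ => Finset.univ) (by simp)]
  rw [Finset.sum_congr rfl fun c _ => Finset.sum_congr rfl fun a _ => rfl]
  conv_rhs => rw [Finset.sum_comm]
  rw [Finset.sum_comm]
  exact Finset.sum_congr rfl fun a _ => Finset.sum_comm

theorem sum_inverseGram_complex_smul {𝔰 M : Type*} [LieRing 𝔰] [LieAlgebra ℝ 𝔰]
    [FiniteDimensional ℝ 𝔰] [AddCommGroup M] [Module ℂ M] {B : LinearMap.BilinForm ℝ 𝔰}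
    {e : Module.Basis (Fin (Module.finrank ℝ 𝔰)) ℝ 𝔰} (he : IsOrthonormalBasis B e)
    (Φ : 𝔰 →ₗ[ℝ] 𝔰 →ₗ[ℝ] M) :
    ∑ a, ∑ b, ((inverseGram B a b : ℝ) : ℂ) •
      Φ (Module.finBasis ℝ 𝔰 a) (Module.finBasis ℝ 𝔰 b) = ∑ i, Φ (e i) (e i) := by
  rw [← sum_inverseGram_smul he]
  simp only [Complex.coe_smul]

section Invariant

variable {L : Type*} [LieRing L] [LieAlgebra ℝ L] {κ : Type*} [Fintype κ] [DecidableEq κ]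
  {B : LinearMap.BilinForm ℝ L} {e : Module.Basis κ ℝ L}

/-- The tensor $\sum_i e_i\otimes e_i$ is invariant, because the matrix $B(e_j,[e_i,x])$ is
antisymmetric. -/
theorem IsInvariantInner.sum_lie_eq_zero {M : Type*} [AddCommGroup M] [Module ℝ M]
    (hB : IsInvariantInner B) (he : IsOrthonormalBasis B e) (Φ : L →ₗ[ℝ] L →ₗ[ℝ] M) (x : L) :
    ∑ i, (Φ (e i) ⁅e i, x⁆ + Φ ⁅e i, x⁆ (e i)) = 0 := by
  have h : ∀ i, ⁅e i, x⁆ = ∑ j, B (e j) ⁅e i, x⁆ • e j := fun i => (he.sum_eq _).symm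
  have ha : ∀ i j, B (e j) ⁅e i, x⁆ = -B (e i) ⁅e j, x⁆ := fun i j => by
    rw [← lie_skew, ← lie_skew (e j) x, map_neg, map_neg, hB.symm (e j), hB.inv]
  have h1 : ∑ i, Φ (e i) ⁅e i, x⁆ = ∑ i, ∑ j, B (e j) ⁅e i, x⁆ • Φ (e i) (e j) :=
    Finset.sum_congr rfl fun i _ => by
      conv_lhs => rw [h i]
      simp only [map_sum, map_smul]
  have h2 : ∑ i, Φ ⁅e i, x⁆ (e i) = ∑ i, ∑ j, B (e j) ⁅e i, x⁆ • Φ (e j) (e i) :=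
    Finset.sum_congr rfl fun i _ => by
      conv_lhs => rw [h i]
      simp only [map_sum, map_smul, LinearMap.sum_apply, LinearMap.smul_apply]
  rw [Finset.sum_add_distrib, h1, h2]
  conv_lhs => arg 2; rw [Finset.sum_comm]
  rw [← Finset.sum_add_distrib]
  refine Finset.sum_eq_zero fun i _ => ?_
  rw [← Finset.sum_add_distrib]
  refine Finset.sum_eq_zero fun j _ => ?_
  rw [ha i j, neg_smul, neg_add_cancel]

theorem IsInvariantInner.killingForm_eq [FiniteDimensional ℝ L]
    (hB : IsInvariantInner B) (he : IsOrthonormalBasis B e)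
    (x y : L) : killingForm ℝ L x y = -∑ i, B ⁅x, e i⁆ ⁅y, e i⁆ := by
  rw [killingForm_apply_apply, LinearMap.trace_eq_matrix_trace ℝ e, Matrix.trace,
    ← Finset.sum_neg_distrib]
  refine Finset.sum_congr rfl fun i _ => ?_
  rw [Matrix.diag_apply, LinearMap.toMatrix_apply, he.repr_eq, hB.inv, neg_neg]
  rfl

theorem IsInvariantInner.form_sum_lie_lie [FiniteDimensional ℝ L]
    (hB : IsInvariantInner B) (he : IsOrthonormalBasis B e)
    (x y : L) : B y (∑ i, ⁅e i, ⁅e i, x⁆⁆) = killingForm ℝ L y x := by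
  rw [hB.killingForm_eq he, map_sum, ← Finset.sum_neg_distrib]
  refine Finset.sum_congr rfl fun i _ => ?_
  rw [← neg_neg (B y _), ← hB.inv, ← lie_skew y, ← lie_skew x]
  simp only [map_neg, LinearMap.neg_apply, neg_neg]

/-- $-\kappa(x,x)=\sum_i B([x,e_i],[x,e_i])$ vanishes only for central $x$. In this way compactness
passes from $\mathfrak g$ to the simple ideals of $\mathfrak h$. -/
theorem IsInvariantInner.killingForm_neg [FiniteDimensional ℝ L] (hB : IsInvariantInner B)
    (hc : LieAlgebra.center ℝ L = ⊥) (x : L) (hx : x ≠ 0) : killingForm ℝ L x x < 0 := by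
  obtain ⟨e, he⟩ := exists_isOrthonormalBasis B hB.symm hB.pos
  rw [hB.killingForm_eq he, neg_lt_zero]
  have hnn : ∀ y, 0 ≤ B y y := fun y => by
    by_cases hy : y = 0
    · simp [hy]
    · exact (hB.pos y hy).le
  have : ∃ i, ⁅x, e i⁆ ≠ 0 := by
    by_contra! h
    apply hx
    have hx' : x ∈ LieAlgebra.center ℝ L := by
      rw [LieModule.mem_maxTrivSubmodule]
      intro y
      have : (LieAlgebra.ad ℝ L x : L →ₗ[ℝ] L) = 0 := e.ext fun i => by simpa using h i
      rw [← lie_skew]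
      have h2 := LinearMap.congr_fun this y
      simp only [LieAlgebra.ad_apply, LinearMap.zero_apply] at h2
      simp [h2]
    rw [hc] at hx'
    simpa using hx'
  obtain ⟨i, hi⟩ := this
  exact Finset.sum_pos' (fun j _ => hnn _) ⟨i, Finset.mem_univ _, hB.pos _ hi⟩

theorem isInvariantInner_neg_killingForm (h : ∀ X : L, X ≠ 0 → killingForm ℝ L X X < 0) :
    IsInvariantInner (-killingForm ℝ L) where
  symm x y := by simp [LieModule.traceForm_comm ℝ L L x y]
  pos x hx := by simpa using h x hx
  inv x y z := by
    have h1 := LieModule.traceForm_apply_lie_apply ℝ L L y x z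
    rw [← lie_skew, map_neg]
    simp only [LinearMap.neg_apply, neg_neg]
    rw [h1]

theorem IsInvariantInner.smul {r : ℝ} (hr : 0 < r) (hB : IsInvariantInner B) :
    IsInvariantInner (r • B) where
  symm x y := by simp [hB.symm x y]
  pos x hx := by simpa using mul_pos hr (hB.pos x hx)
  inv x y z := by simp [hB.inv x y z]

theorem IsInvariantInner.comp {L' : Type*} [LieRing L'] [LieAlgebra ℝ L'] (hB : IsInvariantInner B)
    (f : L' →ₗ⁅ℝ⁆ L) (hf : Function.Injective f) :
    IsInvariantInner (B.compl₁₂ (f : L' →ₗ[ℝ] L) (f : L' →ₗ[ℝ] L)) where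
  symm x y := by simp [hB.symm (f x)]
  pos x hx := by simpa using hB.pos (f x) (fun h => hx (hf (by simpa using h)))
  inv x y z := by simp [hB.inv (f x)]

/-- A Schur argument over $\mathbb R$: diagonalising $B'$ relative to $B$ gives a real eigenvalue
$r$. By invariance the kernel of $B'-rB$ is an ideal, and it contains the eigenvector, so it is
everything. This provides the Dynkin index. -/
theorem IsInvariantInner.exists_eq_smul [FiniteDimensional ℝ L] [LieAlgebra.IsSimple ℝ L]
    {B' : LinearMap.BilinForm ℝ L}
    (hB' : IsInvariantInner B') (hB : IsInvariantInner B) : ∃ r : ℝ, 0 < r ∧ B' = r • B := by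
  obtain ⟨e, he⟩ := exists_isOrthonormalBasis B hB.symm hB.pos
  let M : Matrix (Fin (Module.finrank ℝ L)) (Fin (Module.finrank ℝ L)) ℝ :=
    Matrix.of fun i j => B' (e i) (e j)
  have hM : M.IsHermitian := by
    ext i j
    simp [M, hB'.symm (e i)]
  have hnt : Nontrivial L := LieAlgebra.IsSimple.nontrivial ℝ L
  let i0 : Fin (Module.finrank ℝ L) := ⟨0, Module.finrank_pos⟩
  set r := hM.eigenvalues i0
  set c : Fin (Module.finrank ℝ L) → ℝ := (hM.eigenvectorBasis i0).ofLp
  have hc : M.mulVec c = r • c := hM.mulVec_eigenvectorBasis i0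
  have hc0 : c ≠ 0 := by
    intro h
    apply hM.eigenvectorBasis.toBasis.ne_zero i0
    ext j
    exact congrFun h j
  set v := ∑ i, c i • e i with hv
  have hv0 : v ≠ 0 := by
    intro h
    apply hc0
    ext i
    have := congrArg (fun x => e.repr x i) h
    simpa [hv, Module.Basis.repr_self, Finsupp.single_apply] using this
  have hBv : ∀ x, B' v x = r * B v x := by
    have hlin : B' v = r • B v := e.ext fun j => by
      have h1 := congrFun hc j
      have h2 : B' v (e j) = M.mulVec c j := by
        simp only [hv, map_sum, map_smul, LinearMap.sum_apply, LinearMap.smul_apply, smul_eq_mul,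
          Matrix.mulVec, dotProduct, M, Matrix.of_apply]
        exact Finset.sum_congr rfl fun i _ => by rw [hB'.symm, mul_comm]
      rw [h2, h1]
      simp [hv, he _ j]
    intro x
    rw [hlin]
    rfl
  let I : LieIdeal ℝ L :=
    { LinearMap.ker (B' - r • B) with
      lie_mem := by
        intro x y hy
        have hy' : (B' - r • B) y = 0 := hy
        change (B' - r • B) ⁅x, y⁆ = 0
        ext z
        have := LinearMap.congr_fun hy' ⁅x, z⁆
        simp only [LinearMap.sub_apply, LinearMap.smul_apply, LinearMap.zero_apply,
          smul_eq_mul] at this ⊢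
        rw [hB'.inv, hB.inv]
        linarith }
  have hI : I = ⊤ := by
    refine (LieAlgebra.IsSimple.eq_bot_or_eq_top I).resolve_left fun h => hv0 ?_
    have : v ∈ I := by
      change (B' - r • B) v = 0
      ext z
      simp [hBv z]
    rw [h] at this
    simpa using this
  have hall : B' = r • B := by
    ext y z
    have hy : y ∈ I := by rw [hI]; trivial
    have hy' : (B' - r • B) y = 0 := hy
    have := LinearMap.congr_fun hy' z
    simpa [sub_eq_zero] using this
  refine ⟨r, ?_, hall⟩
  have h1 := hB'.pos v hv0
  rw [hall] at h1
  exact pos_of_mul_pos_left (by simpa using h1) (hB.pos v hv0).le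

end Invariant

/-! ### Hermitian forms and the complexification. -/

section Sesquilinear

variable {W : Type*} [AddCommGroup W] [Module ℂ W]

theorem exists_orthonormal_eigenbasis [FiniteDimensional ℂ W] (s : W →ₗ⋆[ℂ] W →ₗ[ℂ] ℂ)
    (hs : ∀ x y, conj (s y x) = s x y) (hp : ∀ x, x ≠ 0 → 0 < (s x x).re)
    (D : W →ₗ[ℂ] W) (hD : ∀ x y, s (D x) y = s x (D y)) :
    ∃ (b : Module.Basis (Fin (Module.finrank ℂ W)) ℂ W) (l : Fin (Module.finrank ℂ W) → ℝ),
      (∀ i j, s (b i) (b j) = if i = j then 1 else 0) ∧ ∀ i, D (b i) = (l i : ℂ) • b i := by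
  let core : InnerProductSpace.Core ℂ W :=
    { inner := fun x y => s x y
      conj_inner_symm := fun x y => hs x y
      re_inner_nonneg := fun x => by
        by_cases hx : x = 0
        · simp [hx]
        · simpa using (hp x hx).le
      add_left := fun x y z => by simp
      smul_left := fun x y r => by simp
      definite := fun x hx => by
        by_contra h
        have := hp x h
        rw [hx] at this
        simp at this }
  let _ : NormedAddCommGroup W := core.toNormedAddCommGroup
  let _ : InnerProductSpace ℂ W := InnerProductSpace.ofCore core.toCore
  have hsym : D.IsSymmetric := fun x y => hD x y
  refine ⟨(hsym.eigenvectorBasis rfl).toBasis, hsym.eigenvalues rfl, fun i j => ?_, fun i => ?_⟩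
  · have h := orthonormal_iff_ite.mp (hsym.eigenvectorBasis rfl).orthonormal i j
    rw [← h]
    simp only [OrthonormalBasis.coe_toBasis]
    rfl
  · simp only [OrthonormalBasis.coe_toBasis]
    exact hsym.apply_eigenvectorBasis rfl i

theorem sum_smul_eq_of_orthonormal {κ : Type*} [Fintype κ] [DecidableEq κ]
    (s : W →ₗ⋆[ℂ] W →ₗ[ℂ] ℂ) (b : Module.Basis κ ℂ W)
    (hb : ∀ i j, s (b i) (b j) = if i = j then 1 else 0) (x : W) :
    ∑ i, s (b i) x • b i = x := by
  have h : ∀ i, s (b i) x = b.repr x i := fun i => by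
    conv_lhs => rw [← b.sum_repr x]
    simp only [map_sum, map_smul, hb, smul_eq_mul, mul_ite, mul_one, mul_zero,
      Finset.sum_ite_eq, Finset.mem_univ, if_true]
  simp only [h, b.sum_repr]

/-- The trace of a sesquilinear form does not depend on the orthonormal basis. A Casimir sum can
therefore be evaluated both in a real basis and in an eigenbasis of $\mathrm{ad}_t$. -/
theorem sum_apply_eq_of_orthonormal {κ κ' : Type*} [Fintype κ] [DecidableEq κ]
    [Fintype κ'] [DecidableEq κ'] (s : W →ₗ⋆[ℂ] W →ₗ[ℂ] ℂ)
    (hs : ∀ x y, conj (s y x) = s x y) (b : Module.Basis κ ℂ W)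
    (hb : ∀ i j, s (b i) (b j) = if i = j then 1 else 0) (b' : Module.Basis κ' ℂ W)
    (hb' : ∀ i j, s (b' i) (b' j) = if i = j then 1 else 0) (Ψ : W →ₗ⋆[ℂ] W →ₗ[ℂ] ℂ) :
    ∑ i, Ψ (b i) (b i) = ∑ j, Ψ (b' j) (b' j) := by
  calc ∑ i, Ψ (b i) (b i) = ∑ i, ∑ j, s (b' j) (b i) * Ψ (b i) (b' j) := by
        refine Finset.sum_congr rfl fun i _ => ?_
        have h := congrArg (Ψ (b i)) (sum_smul_eq_of_orthonormal s b' hb' (b i))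
        simp only [map_sum, map_smul, smul_eq_mul] at h
        exact h.symm
    _ = ∑ j, ∑ i, s (b' j) (b i) * Ψ (b i) (b' j) := Finset.sum_comm
    _ = ∑ j, Ψ (b' j) (b' j) := by
        refine Finset.sum_congr rfl fun j _ => ?_
        have h := congrArg (fun z => Ψ z (b' j)) (sum_smul_eq_of_orthonormal s b hb (b' j))
        simp only [map_sum, map_smulₛₗ, LinearMap.sum_apply, LinearMap.smul_apply, smul_eq_mul,
          hs] at h
        exact h

end Sesquilinear

noncomputable section Complexification

variable {𝔤 : Type*} [LieRing 𝔤] [LieAlgebra ℝ 𝔤]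

/-- Complex conjugation of the complexification of a real vector space. -/
def tensorConj (𝔤 : Type*) [AddCommGroup 𝔤] [Module ℝ 𝔤] : (ℂ ⊗[ℝ] 𝔤) →ₗ⋆[ℂ] (ℂ ⊗[ℝ] 𝔤) :=
  { (Complex.conjAe.toLinearMap).rTensor 𝔤 with
    map_smul' := fun z x => by
      induction x with
      | zero => simp
      | tmul w y => simp [TensorProduct.smul_tmul']
      | add x y hx hy =>
        simp only [AddHom.toFun_eq_coe, LinearMap.coe_toAddHom, smul_add, map_add] at *
        rw [hx, hy] }

@[simp]
theorem tensorConj_tmul (z : ℂ) (x : 𝔤) : tensorConj 𝔤 (z ⊗ₜ x) = conj z ⊗ₜ[ℝ] x := rfl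

@[simp]
theorem tensorConj_tensorConj (x : ℂ ⊗[ℝ] 𝔤) : tensorConj 𝔤 (tensorConj 𝔤 x) = x := by
  induction x with
  | zero => simp
  | tmul w y => simp
  | add x y hx hy => rw [map_add, map_add, hx, hy]

theorem tensor_lie_add (x y z : ℂ ⊗[ℝ] 𝔤) : ⁅x, y + z⁆ = ⁅x, y⁆ + ⁅x, z⁆ := lie_add x y z

theorem tensor_lie_zero (x : ℂ ⊗[ℝ] 𝔤) : ⁅x, (0 : ℂ ⊗[ℝ] 𝔤)⁆ = 0 := lie_zero x

theorem tensorConj_lie (x y : ℂ ⊗[ℝ] 𝔤) :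
    tensorConj 𝔤 ⁅x, y⁆ = ⁅tensorConj 𝔤 x, tensorConj 𝔤 y⁆ := by
  induction x with
  | zero => simp
  | add x x' hx hx' => simp only [add_lie, map_add, hx, hx']
  | tmul w a =>
    induction y with
    | zero => simp [tensor_lie_zero]
    | add y y' hy hy' => simp only [tensor_lie_add, map_add, hy, hy']
    | tmul v b => simp [LieAlgebra.ExtendScalars.bracket_tmul]

theorem exists_eq_tmul_add_tmul (x : ℂ ⊗[ℝ] 𝔤) :
    ∃ a b : 𝔤, x = (1 : ℂ) ⊗ₜ a + Complex.I ⊗ₜ b := by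
  induction x with
  | zero => exact ⟨0, 0, by simp⟩
  | add x y hx hy =>
    obtain ⟨a, b, rfl⟩ := hx
    obtain ⟨c, d, rfl⟩ := hy
    exact ⟨a + c, b + d, by simp only [TensorProduct.tmul_add]; abel⟩
  | tmul z a =>
    refine ⟨z.re • a, z.im • a, ?_⟩
    rw [← TensorProduct.smul_tmul, ← TensorProduct.smul_tmul, ← TensorProduct.add_tmul]
    congr 1
    apply Complex.ext <;> simp

theorem tmul_add_tmul_eq_zero {a b : 𝔤} (h : (1 : ℂ) ⊗ₜ[ℝ] a + Complex.I ⊗ₜ[ℝ] b = 0) :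
    a = 0 ∧ b = 0 := by
  have h1 := congrArg (fun x => TensorProduct.lid ℝ 𝔤 (Complex.reLm.rTensor 𝔤 x)) h
  have h2 := congrArg (fun x => TensorProduct.lid ℝ 𝔤 (Complex.imLm.rTensor 𝔤 x)) h
  exact ⟨by simpa using h1, by simpa using h2⟩

/-- The hermitian form on the complexification extending a real bilinear form. -/
def hermitianForm (B : LinearMap.BilinForm ℝ 𝔤) :
    (ℂ ⊗[ℝ] 𝔤) →ₗ⋆[ℂ] (ℂ ⊗[ℝ] 𝔤) →ₗ[ℂ] ℂ :=
  LinearMap.comp (LinearMap.BilinForm.baseChange ℂ B) (tensorConj 𝔤)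

theorem hermitianForm_apply (B : LinearMap.BilinForm ℝ 𝔤) (x y : ℂ ⊗[ℝ] 𝔤) :
    hermitianForm B x y = LinearMap.BilinForm.baseChange ℂ B (tensorConj 𝔤 x) y := rfl

@[simp]
theorem hermitianForm_tmul (B : LinearMap.BilinForm ℝ 𝔤) (z w : ℂ) (x y : 𝔤) :
    hermitianForm B (z ⊗ₜ x) (w ⊗ₜ y) = conj z * w * B x y := by
  rw [hermitianForm_apply, tensorConj_tmul, LinearMap.BilinForm.baseChange_tmul]
  rw [Algebra.smul_def]
  simp
  ring

theorem conj_hermitianForm {B : LinearMap.BilinForm ℝ 𝔤} (hB : IsInvariantInner B)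
    (x y : ℂ ⊗[ℝ] 𝔤) : conj (hermitianForm B y x) = hermitianForm B x y := by
  induction x with
  | zero => simp
  | add x x' hx hx' => simp only [map_add, LinearMap.add_apply, hx, hx']
  | tmul w a =>
    induction y with
    | zero => simp
    | add y y' hy hy' => simp only [map_add, LinearMap.add_apply, hy, hy']
    | tmul v b =>
      simp only [hermitianForm_tmul, map_mul, Complex.conj_conj, Complex.conj_ofReal, hB.symm b a]
      ring

theorem hermitianForm_pos {B : LinearMap.BilinForm ℝ 𝔤} (hB : IsInvariantInner B)
    (x : ℂ ⊗[ℝ] 𝔤) (hx : x ≠ 0) : 0 < (hermitianForm B x x).re := by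
  obtain ⟨a, b, rfl⟩ := exists_eq_tmul_add_tmul x
  have h : (hermitianForm B ((1 : ℂ) ⊗ₜ a + Complex.I ⊗ₜ b)
      ((1 : ℂ) ⊗ₜ a + Complex.I ⊗ₜ b)).re = B a a + B b b := by
    simp [hB.symm b a]
  rw [h]
  have hnn : ∀ y, 0 ≤ B y y := fun y => by
    by_cases hy : y = 0
    · simp [hy]
    · exact (hB.pos y hy).le
  by_cases ha : a = 0
  · have hb : b ≠ 0 := by
      rintro rfl
      simp [ha] at hx
    linarith [hnn a, hB.pos b hb]
  · linarith [hnn b, hB.pos a ha]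

theorem hermitianForm_baseChange_basis {κ : Type*} [DecidableEq κ]
    {B : LinearMap.BilinForm ℝ 𝔤} {e : Module.Basis κ ℝ 𝔤} (he : IsOrthonormalBasis B e) (i j : κ) :
    hermitianForm B (e.baseChange ℂ i) (e.baseChange ℂ j) = if i = j then 1 else 0 := by
  rw [Module.Basis.baseChange_apply, Module.Basis.baseChange_apply, hermitianForm_tmul, he i j]
  split_ifs <;> simp

end Complexification

/-! ### Longest roots of compact Lie algebras. -/

section CompactConjugation

variable {L : Type*} [LieRing L] [LieAlgebra ℂ L]

/-- A conjugation `σ` of a complex Lie algebra for which `-κ(σ x, y)` is a positive definite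
hermitian form `s`. -/
structure IsCompactConjugation (σ : L →ₗ⋆[ℂ] L) (s : L →ₗ⋆[ℂ] L →ₗ[ℂ] ℂ) : Prop where
  invol : ∀ x : L, σ (σ x) = x
  lie : ∀ x y : L, σ ⁅x, y⁆ = ⁅σ x, σ y⁆
  eq : ∀ x y : L, s x y = -killingForm ℂ L (σ x) y
  symm : ∀ x y : L, conj (s y x) = s x y
  pos : ∀ x : L, x ≠ 0 → 0 < (s x x).re

variable {σ : L →ₗ⋆[ℂ] L} {s : L →ₗ⋆[ℂ] L →ₗ[ℂ] ℂ}

namespace IsCompactConjugation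

theorem eq_zero (h : IsCompactConjugation σ s) {x : L} (hx : s x x = 0) : x = 0 := by
  by_contra hne
  have := h.pos x hne
  rw [hx] at this
  simp at this

theorem form_lie (h : IsCompactConjugation σ s) (x y z : L) : s ⁅x, y⁆ z = -s y ⁅σ x, z⁆ := by
  rw [h.eq, h.eq, h.lie, ← lie_skew, map_neg, LinearMap.neg_apply,
    LieModule.traceForm_apply_lie_apply]

/-- A real element acts by a skew-hermitian operator, whose generalised kernel is its kernel:
$s([x,y],[x,y])=-s(y,[x,[x,y]])$. -/
theorem lie_eq_zero_of_pow (h : IsCompactConjugation σ s) {x y : L} (hx : σ x = x) {n : ℕ}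
    (hn : ((LieAlgebra.ad ℂ L x) ^ n) y = 0) : ⁅x, y⁆ = 0 := by
  induction n generalizing y with
  | zero =>
    have : y = 0 := by simpa using hn
    rw [this, lie_zero]
  | succ n ih =>
    have h1 : ⁅x, ⁅x, y⁆⁆ = 0 := ih (by simpa [pow_succ] using hn)
    refine h.eq_zero ?_
    rw [h.form_lie, hx, h1, map_zero, neg_zero]

theorem mem_engel_iff (h : IsCompactConjugation σ s) {x y : L} (hx : σ x = x) :
    y ∈ LieSubalgebra.engel ℂ x ↔ ⁅x, y⁆ = 0 := by
  rw [LieSubalgebra.mem_engel_iff]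
  exact ⟨fun ⟨n, hn⟩ => h.lie_eq_zero_of_pow hx hn, fun hy => ⟨1, by simpa using hy⟩⟩

theorem conj_mem_engel (h : IsCompactConjugation σ s) {x y : L} (hx : σ x = x)
    (hy : y ∈ LieSubalgebra.engel ℂ x) : σ y ∈ LieSubalgebra.engel ℂ x := by
  rw [h.mem_engel_iff hx] at hy ⊢
  have := h.lie x y
  rw [hy, map_zero, hx] at this
  exact this.symm

theorem isKilling (h : IsCompactConjugation σ s) : LieAlgebra.IsKilling ℂ L where
  killingCompl_top_eq_bot := by
    rw [eq_bot_iff]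
    intro x hx
    rw [LieIdeal.mem_killingCompl] at hx
    have h1 := hx (σ x) trivial
    have : s x x = 0 := by rw [h.eq, h1, neg_zero]
    simpa using h.eq_zero this

/-- Let $t=T_\alpha$ represent a root of maximal length. By Cauchy–Schwarz every weight takes a
value in $[-r,r]$ on $t$, and $-r$ is attained only by $-\alpha$, whose root space is a line. Taking
the Cartan subalgebra to be the Engel subalgebra of a real element makes it stable under $\sigma$,
so weights are real on the vectors $T_\beta$. -/
theorem exists_longest_root [FiniteDimensional ℂ L] [Nontrivial L]
    (h : IsCompactConjugation σ s) {x : L}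
    (hx : σ x = x) (hH : (LieSubalgebra.engel ℂ x).IsCartanSubalgebra) :
    ∃ (α : LieModule.Weight ℂ (LieSubalgebra.engel ℂ x) L) (t : LieSubalgebra.engel ℂ x)
      (f : L) (r : ℝ), α.IsNonZero ∧
      (∀ y : LieSubalgebra.engel ℂ x, killingForm ℂ L (t : L) (y : L) = α y) ∧
      killingForm ℂ L (t : L) (t : L) = (r : ℂ) ∧ 0 < r ∧ σ (t : L) = -(t : L) ∧ f ≠ 0 ∧
      ⁅(t : L), f⁆ = (-r : ℂ) • f ∧ ⁅σ f, f⁆ = -(s f f) • (t : L) ∧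
      (∀ (v : L) (l : ℝ), v ≠ 0 → ⁅(t : L), v⁆ = (l : ℂ) • v → -r ≤ l ∧ l ≤ r) ∧
      (∀ v : L, ⁅(t : L), v⁆ = (-r : ℂ) • v → ∃ c : ℂ, v = c • f) := by
  have := h.isKilling
  set H := LieSubalgebra.engel ℂ x with hHdef
  let T : LieModule.Weight ℂ H L → H := fun β => (LieAlgebra.IsKilling.cartanEquivDual H).symm β
  have hT : ∀ (β : LieModule.Weight ℂ H L) (y : H), killingForm ℂ L (T β : L) (y : L) = β y := by
    intro β y
    have h1 := LieAlgebra.IsKilling.cartanEquivDual_apply_apply (K := ℂ) (L := L) (H := H) (T β) y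
    have h2 : LieAlgebra.IsKilling.cartanEquivDual H (T β) = β.toLinear :=
      LinearEquiv.apply_symm_apply _ _
    rw [h2] at h1
    exact h1.symm
  have hvec : ∀ β : LieModule.Weight ℂ H L, ∃ v ∈ LieAlgebra.rootSpace H β, v ≠ 0 :=
    fun β => β.exists_ne_zero
  have hlie : ∀ (β : LieModule.Weight ℂ H L) (v : L), v ∈ LieAlgebra.rootSpace H β →
      ∀ y : H, ⁅(y : L), v⁆ = β y • v := fun β v hv y =>
    LieAlgebra.IsKilling.lie_eq_smul_of_mem_rootSpace hv y
  let σH : H → H := fun y => ⟨σ y, h.conj_mem_engel hx y.2⟩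
  -- Compares the eigenvalues of $y$ and $\sigma y$ on one weight vector $v$, through
  -- $s([y,v],v)=-s(v,[\sigma y,v])$.
  have hσ : ∀ (β : LieModule.Weight ℂ H L) (y : H), β (σH y) = -conj (β y) := by
    intro β y
    obtain ⟨v, hv, hv0⟩ := hvec β
    have h1 := h.form_lie y v v
    rw [hlie β v hv y] at h1
    have h2 := hlie β v hv (σH y)
    change ⁅σ y, v⁆ = _ at h2
    rw [h2] at h1
    simp only [map_smulₛₗ, LinearMap.smul_apply, smul_eq_mul, RingHom.id_apply] at h1
    have h3 : s v v ≠ 0 := fun h0 => hv0 (h.eq_zero h0)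
    have h4 : (β (σH y) + conj (β y)) * s v v = 0 := by rw [add_mul, h1]; ring
    rcases mul_eq_zero.mp h4 with h5 | h5
    · exact eq_neg_of_add_eq_zero_left h5
    · exact absurd h5 h3
  have hσT : ∀ β : LieModule.Weight ℂ H L, σ (T β : L) = -(T β : L) := by
    intro β
    have : σH (T β) = -T β := by
      apply (LieAlgebra.IsKilling.cartanEquivDual H).injective
      ext y
      rw [map_neg, LinearMap.neg_apply, LieAlgebra.IsKilling.cartanEquivDual_apply_apply,
        LieAlgebra.IsKilling.cartanEquivDual_apply_apply]
      change killingForm ℂ L (σ (T β : L)) (y : L) = -killingForm ℂ L (T β : L) (y : L)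
      rw [hT, ← neg_eq_iff_eq_neg, ← h.eq, ← h.symm, h.eq, LieModule.traceForm_comm]
      have h1 := hT β (σH y)
      change killingForm ℂ L (T β : L) (σ (y : L)) = _ at h1
      rw [h1, hσ]
      simp
    exact congrArg Subtype.val this
  have hform : ∀ β γ : LieModule.Weight ℂ H L, s (T β) (T γ) = β (T γ) := by
    intro β γ
    rw [h.eq, hσT, map_neg, LinearMap.neg_apply, neg_neg, hT]
  have hTne : ∀ β : LieModule.Weight ℂ H L, β.IsNonZero → (T β : L) ≠ 0 := by
    intro β hβ h0
    apply hβ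
    funext y
    rw [← hT, h0]
    simp
  have hnz : ∃ β : LieModule.Weight ℂ H L, β.IsNonZero := by
    by_contra! hcon
    have hspan := LieAlgebra.IsKilling.span_weight_isNonZero_eq_top ℂ L H
    have hempty : {α : LieModule.Weight ℂ H L | α.IsNonZero} = ∅ := by
      ext β
      simpa using hcon β
    rw [hempty] at hspan
    simp only [Set.image_empty, Submodule.span_empty] at hspan
    have hH0 : ∀ y : H, y = 0 := by
      intro y
      apply (LieAlgebra.IsKilling.cartanEquivDual H).injective
      have h1 : LieAlgebra.IsKilling.cartanEquivDual H y ∈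
        (⊥ : Submodule ℂ (Module.Dual ℂ H)) := by rw [hspan]; trivial
      rw [Submodule.mem_bot] at h1
      rw [h1, map_zero]
    have hx0 : x = 0 := congrArg Subtype.val (hH0 ⟨x, LieSubalgebra.self_mem_engel ℂ x⟩)
    obtain ⟨z, hz⟩ := exists_ne (0 : L)
    apply hz
    have hzm : z ∈ H := by
      rw [hHdef, h.mem_engel_iff hx, hx0, zero_lie]
    exact congrArg Subtype.val (hH0 ⟨z, hzm⟩)
  let R : LieModule.Weight ℂ H L → ℝ := fun β => (s (T β) (T β)).re
  obtain ⟨α, hα, hmax⟩ := Set.exists_max_image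
    {β : LieModule.Weight ℂ H L | β.IsNonZero} R (Set.toFinite _) hnz
  have hαpos : 0 < R α := h.pos _ (hTne α hα)
  have hle : ∀ β, R β ≤ R α := by
    intro β
    by_cases hβ : β.IsNonZero
    · exact hmax β hβ
    · have hz : β.IsZero := not_not.mp hβ
      have : R β = 0 := by
        simp only [R, hform]
        have := congrFun hz (T β)
        simp [this]
      rw [this]
      exact hαpos.le
  have hreal : ∀ β γ : LieModule.Weight ℂ H L, (β (T γ)) = ((β (T γ)).re : ℂ) := by
    intro β γ
    refine (Complex.conj_eq_iff_re.mp ?_).symm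
    have h1 := hσ β (T γ)
    have h2 : σH (T γ) = -T γ := Subtype.ext (hσT γ)
    rw [h2] at h1
    have h3 : β (-T γ) = -β (T γ) := map_neg β.toLinear _
    rw [h3] at h1
    exact (neg_injective h1).symm
  have hcross : ∀ β : LieModule.Weight ℂ H L, (s (T β) (T α)).re = (β (T α)).re := fun β => by
    rw [hform]
  have hcross' : ∀ β : LieModule.Weight ℂ H L, (s (T α) (T β)).re = (β (T α)).re := fun β => by
    rw [← h.symm, Complex.conj_re, hform]
  have hplus : ∀ β : LieModule.Weight ℂ H L,
      (s (T β + T α : L) (T β + T α : L)).re = R β + 2 * (β (T α)).re + R α := by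
    intro β
    simp only [map_add, LinearMap.add_apply, Complex.add_re, hcross, hcross', R]
    ring
  have hminus : ∀ β : LieModule.Weight ℂ H L,
      (s (T β - T α : L) (T β - T α : L)).re = R β - 2 * (β (T α)).re + R α := by
    intro β
    simp only [map_sub, LinearMap.sub_apply, Complex.sub_re, hcross, hcross', R]
    ring
  have hnn : ∀ v, 0 ≤ (s v v).re := fun v => by
    by_cases hv : v = 0
    · simp [hv]
    · exact (h.pos v hv).le
  have hbound : ∀ β : LieModule.Weight ℂ H L, -R α ≤ (β (T α)).re ∧ (β (T α)).re ≤ R α := by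
    intro β
    have h1 := hnn (T β + T α : L)
    have h2 := hnn (T β - T α : L)
    rw [hplus] at h1
    rw [hminus] at h2
    constructor <;> linarith [hle β]
  have hneg : ∀ β : LieModule.Weight ℂ H L, (β (T α)).re = -R α → β = -α := by
    intro β hβ
    -- Equality in Cauchy–Schwarz: here $|T_\beta+T_\alpha|^2=R_\beta-R_\alpha\le0$.
    have h1 : (T β + T α : L) = 0 := by
      by_contra hne
      have h2 := h.pos _ hne
      rw [hplus, hβ] at h2
      linarith [hle β]
    ext y
    rw [LieModule.Weight.coe_neg, Pi.neg_apply, ← hT, ← hT, eq_neg_of_add_eq_zero_left h1]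
    simp
  obtain ⟨f, hf, hf0⟩ := hvec (-α)
  have hαα : α (T α) = (R α : ℂ) := by
    rw [hreal, ← hform]
  have htop : ∀ (v : L) (w : L), (∀ (β : LieModule.Weight ℂ H L), ∀ u ∈ LieAlgebra.rootSpace H β,
      s v u = s w u) → v = w := by
    intro v w hvw
    have h1 : (⊤ : Submodule ℂ L) ≤ LinearMap.ker (s (v - w)) := by
      have h2 := LieModule.iSup_genWeightSpace_eq_top' ℂ H L
      rw [← LieSubmodule.toSubmodule_inj, LieSubmodule.iSup_toSubmodule,
        LieSubmodule.top_toSubmodule] at h2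
      rw [← h2]
      refine iSup_le fun β u hu => ?_
      rw [LinearMap.mem_ker, map_sub, LinearMap.sub_apply, hvw β u hu, sub_self]
    have h3 : v - w ∈ LinearMap.ker (s (v - w)) := h1 trivial
    exact sub_eq_zero.mp (h.eq_zero h3)
  have horth : ∀ (v : L) (l : ℝ), ⁅(T α : L), v⁆ = (l : ℂ) • v →
      ∀ (β : LieModule.Weight ℂ H L), (β (T α)).re ≠ l → ∀ u ∈ LieAlgebra.rootSpace H β,
      s v u = 0 := by
    intro v l hv β hβ u hu
    have h1 := h.form_lie (T α) v u
    rw [hσT, neg_lie, hlie β u hu, hv] at h1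
    simp only [map_smulₛₗ, LinearMap.smul_apply, smul_eq_mul, RingHom.id_apply, map_neg,
      neg_neg, Complex.conj_ofReal] at h1
    rw [hreal β α] at h1
    have h2 : (((l - (β (T α)).re : ℝ)) : ℂ) * s v u = 0 := by
      push_cast
      rw [sub_mul, h1, sub_self]
    rcases mul_eq_zero.mp h2 with h3 | h3
    · exact absurd (sub_eq_zero.mp (Complex.ofReal_eq_zero.mp h3)).symm hβ
    · exact h3
  refine ⟨α, T α, f, R α, hα, hT α, ?_, hαpos, hσT α, hf0, ?_, ?_, ?_, ?_⟩
  · rw [hT, hαα]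
  · rw [hlie _ f hf, LieModule.Weight.coe_neg, Pi.neg_apply, hαα]
  · have hσf : σ f ∈ LieAlgebra.rootSpace H α := by
      have h1 : ∀ y : H, ⁅y, σ f⁆ = α y • σ f := by
        intro y
        have h2 := hlie _ f hf (σH y)
        have h3 := h.lie (σ (y : L)) f
        rw [h.invol] at h3
        change ⁅(y : L), σ f⁆ = _
        rw [← h3]
        change ⁅σ (y : L), f⁆ = _ at h2
        rw [h2, map_smulₛₗ, LieModule.Weight.coe_neg, Pi.neg_apply, hσ]
        simp
      exact LieModule.weightSpace_le_genWeightSpace L (α : H → ℂ)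
        ((LieModule.mem_weightSpace _ _).mpr h1)
    rw [LieAlgebra.IsKilling.lie_eq_killingForm_smul_of_mem_rootSpace_of_mem_rootSpace_neg hσf hf,
      h.eq, neg_neg]
  · intro v l hv hvl
    by_contra hcon
    apply hv
    refine htop v 0 fun β u hu => ?_
    rw [horth v l hvl β (fun hβ => hcon (hβ ▸ hbound β)) u hu]
    simp
  · intro v hv
    have hff : s f f ≠ 0 := fun h0 => hf0 (h.eq_zero h0)
    have hfe : ⁅(T α : L), f⁆ = ((-R α : ℝ) : ℂ) • f := by
      rw [hlie _ f hf, LieModule.Weight.coe_neg, Pi.neg_apply, hαα]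
      push_cast
      rfl
    have hve : ⁅(T α : L), v⁆ = ((-R α : ℝ) : ℂ) • v := by rw [hv]; push_cast; rfl
    -- The coefficient of the orthogonal projection of $v$ to the line of $f$. It suffices to
    -- compare pairings with weight vectors, as these span.
    refine ⟨s f v / s f f, htop _ _ fun β u hu => ?_⟩
    by_cases hβ : (β (T α)).re = -R α
    · obtain rfl := hneg β hβ
      have h1 : Module.finrank ℂ (LieAlgebra.rootSpace H (-α : LieModule.Weight ℂ H L)) = 1 :=
        LieAlgebra.IsKilling.finrank_rootSpace_eq_one _ hα.neg
      obtain ⟨c, hc⟩ := (finrank_eq_one_iff_of_nonzero' (⟨f, hf⟩ :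
        LieAlgebra.rootSpace H (-α : LieModule.Weight ℂ H L))
        (by simpa [Subtype.ext_iff] using hf0)).mp h1 ⟨u, hu⟩
      have hc' : c • f = u := congrArg Subtype.val hc
      rw [← hc']
      simp only [map_smulₛₗ, LinearMap.smul_apply, smul_eq_mul, RingHom.id_apply, map_div₀]
      rw [h.symm, h.symm]
      field_simp
    · rw [horth v _ hve β hβ u hu, map_smulₛₗ, LinearMap.smul_apply, horth f _ hfe β hβ u hu]
      simp

end IsCompactConjugation

end CompactConjugation

/-- $(\alpha,\alpha)=\kappa(t,t)=\sum_\beta\beta(t)^2\ge\alpha(t)^2=(\alpha,\alpha)^2$. Integrality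
of the Cartan numbers serves to show that each $\beta(t)$ is real, so that its square is
nonnegative. The bound makes the supremum in `killingHighestRootSq` a genuine one instead of the
default value $0$. -/
theorem root_length_le_one {L : Type*} [LieRing L] [LieAlgebra ℂ L] [FiniteDimensional ℂ L]
    [LieAlgebra.IsKilling ℂ L] (H : LieSubalgebra ℂ L) [H.IsCartanSubalgebra]
    (α : LieModule.Weight ℂ H L) (hα : α.IsNonZero) (t : H) (r : ℝ)
    (ht : ∀ x : H, killingForm ℂ L (t : L) (x : L) = α x)
    (hr : killingForm ℂ L (t : L) (t : L) = (r : ℂ)) : r ≤ 1 := by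
  have hrα : α t = (r : ℂ) := by rw [← ht, hr]
  have ht' : t = (LieAlgebra.IsKilling.cartanEquivDual H).symm α := by
    rw [LinearEquiv.eq_symm_apply]
    ext x
    rw [LieAlgebra.IsKilling.cartanEquivDual_apply_apply]
    exact ht x
  have hr0 : (r : ℂ) ≠ 0 := by
    rw [← hrα, ht']
    exact LieAlgebra.IsKilling.root_apply_cartanEquivDual_symm_ne_zero hα
  have hint : ∀ β : LieModule.Weight ℂ H L, ∃ m : ℤ, β t = ((r * m / 2 : ℝ) : ℂ) := by
    intro β
    obtain ⟨m, h1⟩ : ∃ m : ℤ, β (LieAlgebra.IsKilling.coroot α) = m :=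
      ⟨_, LieAlgebra.IsKilling.apply_coroot_eq_cast α β⟩
    refine ⟨m, ?_⟩
    have h2 : LieAlgebra.IsKilling.coroot α = (2 * (r : ℂ)⁻¹) • t := by
      rw [LieAlgebra.IsKilling.coroot, ← ht', hrα, mul_smul, two_smul, two_smul]
    rw [h2] at h1
    have h3 : β ((2 * (r : ℂ)⁻¹) • t) = (2 * (r : ℂ)⁻¹) * β t := map_smul β.toLinear _ _
    rw [h3] at h1
    have h4 : β t = r * (2 * (r : ℂ)⁻¹ * β t) / 2 := by field_simp
    rw [h4, h1]
    push_cast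
    rfl
  choose m hm using hint
  have hsum : (r : ℂ) = ∑ β ∈ LieSubalgebra.root (H := H) (K := ℂ) (L := L), β t * β t := by
    have h1 := congrArg (fun B : LinearMap.BilinForm ℂ H => B t t)
      (LieAlgebra.IsKilling.restrict_killingForm_eq_sum (K := ℂ) (L := L) (H := H))
    simp only [LinearMap.sum_apply, LinearMap.smulRight_apply, LinearMap.smul_apply,
      smul_eq_mul] at h1
    rw [← hr]
    exact h1
  have hsum' : r = ∑ β ∈ LieSubalgebra.root (H := H) (K := ℂ) (L := L),
      (r * m β / 2) * (r * m β / 2) := by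
    have : (r : ℂ) = ((∑ β ∈ LieSubalgebra.root (H := H) (K := ℂ) (L := L),
      (r * m β / 2) * (r * m β / 2) : ℝ) : ℂ) := by
      rw [Complex.ofReal_sum, hsum]
      refine Finset.sum_congr rfl fun β _ => ?_
      rw [hm]
      push_cast
      rfl
    exact_mod_cast this
  have hmem : α ∈ LieSubalgebra.root (H := H) (K := ℂ) (L := L) := by
    simpa [LieSubalgebra.root] using hα
  have hαm : r * m α / 2 = r := by
    have := hm α
    rw [hrα] at this
    exact_mod_cast this.symm
  have h2 : r * r ≤ r := by
    conv_rhs => rw [hsum']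
    conv_lhs => rw [← hαm]
    exact Finset.single_le_sum (f := fun β => (r * m β / 2) * (r * m β / 2))
      (fun β _ => mul_self_nonneg _) hmem
  by_contra hcon
  nlinarith

section RealForm

variable {𝔤 : Type*} [LieRing 𝔤] [LieAlgebra ℝ 𝔤] [FiniteDimensional ℝ 𝔤]

theorem baseChange_neg_killingForm :
    LinearMap.BilinForm.baseChange ℂ (-killingForm ℝ 𝔤) = -killingForm ℂ (ℂ ⊗[ℝ] 𝔤) := by
  have h : killingForm ℂ (ℂ ⊗[ℝ] 𝔤) = LinearMap.BilinForm.baseChange ℂ (killingForm ℝ 𝔤) :=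
    LieModule.traceForm_baseChange ℝ 𝔤 𝔤 ℂ
  rw [h]
  ext
  simp

theorem isCompactConjugation_tensorConj (hc : ∀ X : 𝔤, X ≠ 0 → killingForm ℝ 𝔤 X X < 0) :
    IsCompactConjugation (tensorConj 𝔤) (hermitianForm (-killingForm ℝ 𝔤)) where
  invol := tensorConj_tensorConj
  lie := tensorConj_lie
  eq x y := by
    rw [hermitianForm_apply, baseChange_neg_killingForm]
    rfl
  symm := conj_hermitianForm (isInvariantInner_neg_killingForm hc)
  pos := hermitianForm_pos (isInvariantInner_neg_killingForm hc)

/-- Since inner derivations are skew, a nilpotent Engel subalgebra of the real form is the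
centraliser of $x$ and is abelian. Its complexification is again an Engel subalgebra, abelian and
self-normalising, and $1\otimes x$ is fixed by conjugation. -/
theorem exists_isCartanSubalgebra_engel_conj (hc : ∀ X : 𝔤, X ≠ 0 → killingForm ℝ 𝔤 X X < 0) :
    ∃ x : ℂ ⊗[ℝ] 𝔤, tensorConj 𝔤 x = x ∧ (LieSubalgebra.engel ℂ x).IsCartanSubalgebra := by
  have hB := isInvariantInner_neg_killingForm hc
  have hconj := isCompactConjugation_tensorConj hc
  obtain ⟨x, hx⟩ := LieAlgebra.exists_isCartanSubalgebra_engel (K := ℝ) (L := 𝔤)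
  have hskew : ∀ (a b : 𝔤) (n : ℕ), ((LieAlgebra.ad ℝ 𝔤 a) ^ n) b = 0 → ⁅a, b⁆ = 0 := by
    intro a b n hn
    induction n generalizing b with
    | zero =>
      have : b = 0 := by simpa using hn
      rw [this, lie_zero]
    | succ n ih =>
      have h1 : ⁅a, ⁅a, b⁆⁆ = 0 := ih _ (by simpa [pow_succ] using hn)
      by_contra hne
      have h2 := hB.pos _ hne
      rw [hB.inv, h1, map_zero, neg_zero] at h2
      exact lt_irrefl _ h2
  have hab : ∀ a b : 𝔤, ⁅x, a⁆ = 0 → ⁅x, b⁆ = 0 → ⁅a, b⁆ = 0 := by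
    intro a b ha hb
    have hmem : ∀ a : 𝔤, ⁅x, a⁆ = 0 → a ∈ LieSubalgebra.engel ℝ x := fun a ha => by
      rw [LieSubalgebra.mem_engel_iff]
      exact ⟨1, by simpa using ha⟩
    have := hx.nilpotent
    obtain ⟨n, hn⟩ := LieModule.exists_forall_pow_toEnd_eq_zero ℝ (LieSubalgebra.engel ℝ x)
      (LieSubalgebra.engel ℝ x)
    have h1 := LinearMap.congr_fun (hn ⟨a, hmem a ha⟩) ⟨b, hmem b hb⟩
    apply hskew a b n
    have h2 : ∀ (m : ℕ) (c : LieSubalgebra.engel ℝ x),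
        ((((LieModule.toEnd ℝ (LieSubalgebra.engel ℝ x) (LieSubalgebra.engel ℝ x))
          ⟨a, hmem a ha⟩ ^ m) c : LieSubalgebra.engel ℝ x) : 𝔤) =
        ((LieAlgebra.ad ℝ 𝔤 a) ^ m) (c : 𝔤) := by
      intro m
      induction m with
      | zero => intro c; simp
      | succ m ih => intro c; simp [pow_succ, ih]
    rw [← h2 n ⟨b, hmem b hb⟩, h1]
    simp
  refine ⟨(1 : ℂ) ⊗ₜ x, by simp, ?_⟩
  have hxx : tensorConj 𝔤 ((1 : ℂ) ⊗ₜ x) = (1 : ℂ) ⊗ₜ x := by simp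
  have hcomp : ∀ y : ℂ ⊗[ℝ] 𝔤, y ∈ LieSubalgebra.engel ℂ ((1 : ℂ) ⊗ₜ x) →
      ∃ a b : 𝔤, y = (1 : ℂ) ⊗ₜ a + Complex.I ⊗ₜ b ∧ ⁅x, a⁆ = 0 ∧ ⁅x, b⁆ = 0 := by
    intro y hy
    rw [hconj.mem_engel_iff hxx] at hy
    obtain ⟨a, b, rfl⟩ := exists_eq_tmul_add_tmul y
    refine ⟨a, b, rfl, ?_⟩
    have h1 : (1 : ℂ) ⊗ₜ[ℝ] ⁅x, a⁆ + Complex.I ⊗ₜ[ℝ] ⁅x, b⁆ = 0 := by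
      rw [← hy]
      have := tensor_lie_add ((1 : ℂ) ⊗ₜ[ℝ] x) ((1 : ℂ) ⊗ₜ a) (Complex.I ⊗ₜ b)
      simp only [LieAlgebra.ExtendScalars.bracket_tmul, one_mul] at this
      exact this.symm
    exact tmul_add_tmul_eq_zero h1
  have habel : IsLieAbelian (LieSubalgebra.engel ℂ ((1 : ℂ) ⊗ₜ[ℝ] x)) := by
    refine ⟨fun y z => Subtype.ext ?_⟩
    obtain ⟨a, b, hy, ha, hb⟩ := hcomp y y.2
    obtain ⟨c, d, hz, hc, hd⟩ := hcomp z z.2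
    rw [LieSubalgebra.coe_bracket, hy, hz]
    have h1 := tensor_lie_add ((1 : ℂ) ⊗ₜ[ℝ] a + Complex.I ⊗ₜ b) ((1 : ℂ) ⊗ₜ c) (Complex.I ⊗ₜ d)
    refine h1.trans ?_
    have h2 : ∀ (z : ℂ) (c : 𝔤), ⁅x, c⁆ = 0 →
        ⁅(1 : ℂ) ⊗ₜ[ℝ] a + Complex.I ⊗ₜ b, z ⊗ₜ[ℝ] c⁆ = 0 := by
      intro z c hc
      refine (add_lie ((1 : ℂ) ⊗ₜ[ℝ] a) (Complex.I ⊗ₜ[ℝ] b) (z ⊗ₜ[ℝ] c)).trans ?_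
      rw [LieAlgebra.ExtendScalars.bracket_tmul, LieAlgebra.ExtendScalars.bracket_tmul,
        hab a c ha hc, hab b c hb hc]
      simp
    rw [h2 1 c hc, h2 _ d hd, add_zero]
    rfl
  exact ⟨inferInstance, LieSubalgebra.normalizer_engel ..⟩

theorem bddAbove_killingRootLengthSq (hc : ∀ X : 𝔤, X ≠ 0 → killingForm ℝ 𝔤 X X < 0) :
    BddAbove (killingRootLengthSq 𝔤) := by
  refine ⟨1, ?_⟩
  rintro r ⟨H, hH, α, t, hα, ht, hr⟩
  have := (isCompactConjugation_tensorConj hc).isKilling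
  exact root_length_le_one H α hα t r ht hr

/-- The root vector data of a longest root of a torus of a compact Lie algebra. -/
theorem exists_compact_root (hc : ∀ X : 𝔤, X ≠ 0 → killingForm ℝ 𝔤 X X < 0) [Nontrivial 𝔤] :
    ∃ (t f : ℂ ⊗[ℝ] 𝔤) (r : ℝ), 0 < r ∧ r ≤ killingHighestRootSq 𝔤 ∧ f ≠ 0 ∧
      tensorConj 𝔤 t = -t ∧ ⁅t, f⁆ = (-r : ℂ) • f ∧
      ⁅tensorConj 𝔤 f, f⁆ = -(hermitianForm (-killingForm ℝ 𝔤) f f) • t ∧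
      (∀ (v : ℂ ⊗[ℝ] 𝔤) (l : ℝ), v ≠ 0 → ⁅t, v⁆ = (l : ℂ) • v → -r ≤ l ∧ l ≤ r) ∧
      (∀ v : ℂ ⊗[ℝ] 𝔤, ⁅t, v⁆ = (-r : ℂ) • v → ∃ c : ℂ, v = c • f) := by
  obtain ⟨x, hx, hH⟩ := exists_isCartanSubalgebra_engel_conj hc
  have hconj := isCompactConjugation_tensorConj hc
  have hnt : Nontrivial (ℂ ⊗[ℝ] 𝔤) := by
    obtain ⟨a, ha⟩ := exists_ne (0 : 𝔤)
    refine ⟨(1 : ℂ) ⊗ₜ a, 0, fun h0 => ?_⟩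
    have h1 : hermitianForm (-killingForm ℝ 𝔤) ((1 : ℂ) ⊗ₜ a) ((1 : ℂ) ⊗ₜ a) = 0 := by
      rw [h0]; simp
    rw [hermitianForm_tmul] at h1
    have h2 := (isInvariantInner_neg_killingForm hc).pos a ha
    simp only [map_one, mul_one, one_mul, Complex.ofReal_eq_zero] at h1
    exact h2.ne' h1
  obtain ⟨α, t, f, r, hα, ht, htr, hr, hσ, hf, htf, hff, hA, hB⟩ :=
    hconj.exists_longest_root hx hH
  exact ⟨t, f, r, hr, le_csSup (bddAbove_killingRootLengthSq hc) ⟨_, hH, α, t, hα, ht, htr⟩,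
    hf, hσ, htf, hff, hA, hB⟩

theorem killingHighestRootSq_pos (hc : ∀ X : 𝔤, X ≠ 0 → killingForm ℝ 𝔤 X X < 0)
    [Nontrivial 𝔤] : 0 < killingHighestRootSq 𝔤 := by
  obtain ⟨t, f, r, hr, hle, -⟩ := exists_compact_root hc
  exact hr.trans_le hle

end RealForm

/-! ### The Casimir bound on endomorphisms of the adjoint representation. -/

/-- The commutator `[ad x, S]` of an endomorphism of a Lie algebra with an inner derivation. -/
def lieCommutator {R L : Type*} [CommRing R] [LieRing L] [LieAlgebra R L] (x : L) (S : L →ₗ[R] L) :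
    L →ₗ[R] L :=
  LieAlgebra.ad R L x ∘ₗ S - S ∘ₗ LieAlgebra.ad R L x

theorem lieCommutator_apply {R L : Type*} [CommRing R] [LieRing L] [LieAlgebra R L] (x : L)
    (S : L →ₗ[R] L) (y : L) : lieCommutator x S y = ⁅x, S y⁆ - S ⁅x, y⁆ := rfl

/-- The endomorphisms `S` with `∑ i, ad (e i) ∘ S ∘ ad (e i) = μ S`. -/
def casimirEigenspace {R L κ : Type*} [CommRing R] [LieRing L] [LieAlgebra R L] [Fintype κ]
    (e : κ → L) (μ : R) : Submodule R (L →ₗ[R] L) where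
  carrier := {S | ∀ y, ∑ i, ⁅e i, S ⁅e i, y⁆⁆ = μ • S y}
  zero_mem' := by simp
  add_mem' := by
    intro S S' hS hS' y
    simp only [LinearMap.add_apply, lie_add, Finset.sum_add_distrib, hS y, hS' y, smul_add]
  smul_mem' := by
    intro c S hS y
    simp only [LinearMap.smul_apply, lie_smul, ← Finset.smul_sum, hS y, smul_comm c]

/-- The hypothesis `he` is the invariance of $\sum_i e_i\otimes e_i$; hence
$S\mapsto\sum_i\mathrm{ad}_{e_i}S\,\mathrm{ad}_{e_i}$ commutes with the adjoint action on
endomorphisms. -/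
theorem lieCommutator_mem_casimirEigenspace {R L κ : Type*} [CommRing R] [LieRing L]
    [LieAlgebra R L] [Fintype κ] {e : κ → L} {μ : R}
    (he : ∀ (Φ : L →ₗ[R] L →ₗ[R] L) (x : L), ∑ i, (Φ (e i) ⁅e i, x⁆ + Φ ⁅e i, x⁆ (e i)) = 0)
    {S : L →ₗ[R] L} (hS : S ∈ casimirEigenspace e μ) (x : L) :
    lieCommutator x S ∈ casimirEigenspace e μ := by
  intro y
  let Φ : L →ₗ[R] L →ₗ[R] L :=
    LinearMap.mk₂ R (fun u v => ⁅u, S ⁅v, y⁆⁆) (by simp) (by simp) (by simp) (by simp)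
  have hΦ : ∀ u v, Φ u v = ⁅u, S ⁅v, y⁆⁆ := fun u v => rfl
  have h1 := he Φ x
  simp only [hΦ] at h1
  have h2 : ∀ i, ⁅e i, lieCommutator x S ⁅e i, y⁆⁆ =
      ⁅x, ⁅e i, S ⁅e i, y⁆⁆⁆ - ⁅e i, S ⁅e i, ⁅x, y⁆⁆⁆ +
      (⁅e i, S ⁅⁅e i, x⁆, y⁆⁆ + ⁅⁅e i, x⁆, S ⁅e i, y⁆⁆) := by
    intro i
    have h3 : ⁅x, ⁅e i, y⁆⁆ = ⁅e i, ⁅x, y⁆⁆ - ⁅⁅e i, x⁆, y⁆ := by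
      rw [leibniz_lie (e i) x y]; abel
    have h4 : ⁅x, ⁅e i, S ⁅e i, y⁆⁆⁆ = ⁅e i, ⁅x, S ⁅e i, y⁆⁆⁆ - ⁅⁅e i, x⁆, S ⁅e i, y⁆⁆ := by
      rw [leibniz_lie (e i) x]; abel
    rw [lieCommutator_apply, h4, h3, lie_sub, map_sub, lie_sub]
    abel
  rw [Finset.sum_congr rfl fun i _ => h2 i, Finset.sum_add_distrib, h1, add_zero,
    Finset.sum_sub_distrib, hS ⁅x, y⁆, ← lie_sum, hS y, lieCommutator_apply, lie_smul, smul_sub]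

/-- In representation theory this is the bound
$\frac12\bigl((2\theta,2\theta+2\rho)-2(\theta,\theta+2\rho)\bigr)=(\theta,\theta)$, attained on the
component of highest weight $2\theta$ in the tensor square. The proof avoids decomposing that
square. Evaluate the eigenspace $E$ at the bottom vector $f$, and choose $w=Sf$ in $Ef$ with the
largest $\mathrm{ad}_t$-eigenvalue $d$. The sum $\sum_i s([x_i,w],S[x_i,f])$ equals $-\mu$, as a
real orthonormal basis shows, and its real part is at least $-d$, as an eigenbasis of
$\mathrm{ad}_t$ shows. Thus $\mu\le d\le r$. -/
theorem IsCompactConjugation.eigenvalue_le {L : Type*} [LieRing L] [LieAlgebra ℂ L]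
    [FiniteDimensional ℂ L] {σ : L →ₗ⋆[ℂ] L} {s : L →ₗ⋆[ℂ] L →ₗ[ℂ] ℂ}
    (h : IsCompactConjugation σ s) {t f : L} {r : ℝ}
    (ht : σ t = -t) (hf0 : f ≠ 0) (htf : ⁅t, f⁆ = (-r : ℂ) • f) (hff : ⁅σ f, f⁆ = -(s f f) • t)
    (hA : ∀ (v : L) (l : ℝ), v ≠ 0 → ⁅t, v⁆ = (l : ℂ) • v → -r ≤ l ∧ l ≤ r)
    (hB : ∀ v : L, ⁅t, v⁆ = (-r : ℂ) • v → ∃ c : ℂ, v = c • f)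
    {κ : Type*} [Fintype κ] [DecidableEq κ] (e : Module.Basis κ ℂ L)
    (he : ∀ i j, s (e i) (e j) = if i = j then 1 else 0) (hσe : ∀ i, σ (e i) = e i) (μ : ℝ)
    (hinv : ∀ S ∈ casimirEigenspace e (μ : ℂ), ∀ x,
      lieCommutator x S ∈ casimirEigenspace e (μ : ℂ))
    (hSf : ∃ S ∈ casimirEigenspace e (μ : ℂ), S f ≠ 0) : μ ≤ r := by
  set E := casimirEigenspace e (μ : ℂ) with hE
  let Ef : Submodule ℂ L := E.map (LinearMap.applyₗ f)
  have hEf : ∀ v, v ∈ Ef ↔ ∃ S ∈ E, S f = v := fun v => Iff.rfl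
  let D : L →ₗ[ℂ] L := LieAlgebra.ad ℂ L t
  have hD : ∀ x y, s (D x) y = s x (D y) := by
    intro x y
    change s ⁅t, x⁆ y = s x ⁅t, y⁆
    rw [h.form_lie, ht, neg_lie, map_neg, neg_neg]
  have hDE : ∀ v ∈ Ef, D v ∈ Ef := by
    intro v hv
    obtain ⟨S, hS, rfl⟩ := (hEf v).mp hv
    have h1 : D (S f) = lieCommutator t S f + (-r : ℂ) • S f := by
      rw [lieCommutator_apply, htf, map_smul]
      change ⁅t, S f⁆ = _
      abel
    rw [h1]
    exact Ef.add_mem ((hEf _).mpr ⟨_, hinv S hS t, rfl⟩) (Ef.smul_mem _ hv)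
  let sE : Ef →ₗ⋆[ℂ] Ef →ₗ[ℂ] ℂ := LinearMap.comp Ef.subtype.dualMap (LinearMap.comp s Ef.subtype)
  have hsE : ∀ u v : Ef, sE u v = s u v := fun u v => rfl
  obtain ⟨b, l, hb, hl⟩ := exists_orthonormal_eigenbasis sE (fun x y => h.symm x y)
    (fun x hx => h.pos x (by simpa using hx)) (D.restrict hDE) (fun x y => hD x y)
  have hne : Nonempty (Fin (Module.finrank ℂ Ef)) := by
    obtain ⟨S, hS, hS0⟩ := hSf
    have : Nontrivial Ef := ⟨⟨S f, (hEf _).mpr ⟨S, hS, rfl⟩⟩, 0, fun h0 => hS0 (by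
      simpa using congrArg Subtype.val h0)⟩
    exact ⟨⟨0, Module.finrank_pos⟩⟩
  obtain ⟨i0, hi0⟩ := Finite.exists_max l
  set w : L := ((b i0 : Ef) : L) with hw
  set d := l i0 with hd
  have hDw : ⁅t, w⁆ = (d : ℂ) • w := congrArg Subtype.val (hl i0)
  have hww : s w w = 1 := by
    have := hb i0 i0
    rwa [if_pos rfl] at this
  have hw0 : w ≠ 0 := by
    intro h0
    rw [h0] at hww
    simp at hww
  obtain ⟨S, hS, hSw⟩ := (hEf w).mp (b i0).2
  -- By maximality of $d$, eigenvectors of the self-adjoint $\mathrm{ad}_t$ with eigenvalue above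
  -- $d$ are orthogonal to $Ef$.
  have horth : ∀ (u : L) (m : ℝ), D u = (m : ℂ) • u → d < m → ∀ v ∈ Ef, s u v = 0 := by
    intro u m hu hm v hv
    have h1 : ∀ j, s u (b j) = 0 := by
      intro j
      have h2 := hD u (b j)
      have h3 : D (b j) = (l j : ℂ) • (b j : L) := congrArg Subtype.val (hl j)
      rw [hu, h3] at h2
      simp only [map_smulₛₗ, LinearMap.smul_apply, Complex.conj_ofReal, smul_eq_mul,
        RingHom.id_apply] at h2
      have h4 : ((m - l j : ℝ) : ℂ) * s u (b j) = 0 := by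
        push_cast
        rw [sub_mul, h2, sub_self]
      rcases mul_eq_zero.mp h4 with h5 | h5
      · have := Complex.ofReal_eq_zero.mp h5
        linarith [hi0 j]
      · exact h5
    have h2 : (s u) ∘ₗ Ef.subtype = 0 := b.ext fun j => h1 j
    exact LinearMap.congr_fun h2 ⟨v, hv⟩
  obtain ⟨x, m, hx, hm⟩ := exists_orthonormal_eigenbasis s h.symm h.pos D hD
  let adj : L →ₗ[ℂ] Module.End ℂ L := LieAlgebra.ad ℂ L
  let Ψ : L →ₗ⋆[ℂ] L →ₗ[ℂ] ℂ :=
    LinearMap.comp (S ∘ₗ adj.flip f).dualMap (LinearMap.comp s (adj.flip w))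
  have hΨ : ∀ u v, Ψ u v = s ⁅u, w⁆ (S ⁅v, f⁆) := fun u v => rfl
  have hsum1 : ∑ i, Ψ (x i) (x i) = -(μ : ℂ) := by
    rw [sum_apply_eq_of_orthonormal s h.symm x hx e he Ψ]
    have h1 : ∀ i, Ψ (e i) (e i) = -s w ⁅e i, S ⁅e i, f⁆⁆ := fun i => by
      rw [hΨ, h.form_lie, hσe]
    rw [Finset.sum_congr rfl fun i _ => h1 i, Finset.sum_neg_distrib, ← map_sum, hS f, hSw,
      map_smul, hww, smul_eq_mul, mul_one]
  have hsum2 : ∑ i, s t (x i) * s ⁅x i, w⁆ w = (d : ℂ) := by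
    have h1 := congrArg (fun z => s ⁅z, w⁆ w) (sum_smul_eq_of_orthonormal s x hx t)
    simp only [sum_lie, smul_lie, map_sum, map_smulₛₗ, LinearMap.sum_apply,
      LinearMap.smul_apply, smul_eq_mul, h.symm, hDw, hww, mul_one, Complex.conj_ofReal] at h1
    exact h1
  -- For $m_i<0$ the vector $[x_i,f]$ would have an eigenvalue below $-r$, so it is zero. For
  -- $m_i=0$ it is $-s(t,x_i)f$; these terms add up to $-d$. For $m_i>0$ one has
  -- $S[x_i,f]=[x_i,w]-(x_i\cdot S)f$, whose last term lies in $Ef$ and is orthogonal to $[x_i,w]$;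
  -- a norm square remains.
  have hterm : ∀ i, -(s t (x i) * s ⁅x i, w⁆ w).re ≤ (Ψ (x i) (x i)).re := by
    intro i
    have hxi : ⁅t, x i⁆ = (m i : ℂ) • x i := hm i
    have hxf : ⁅t, ⁅x i, f⁆⁆ = ((m i - r : ℝ) : ℂ) • ⁅x i, f⁆ := by
      rw [leibniz_lie, hxi, htf, smul_lie, lie_smul, ← add_smul]
      push_cast
      rfl
    have hne0 : m i ≠ 0 → s t (x i) = 0 := by
      intro h0
      have h1 := hD t (x i)
      change s ⁅t, t⁆ (x i) = s t ⁅t, x i⁆ at h1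
      rw [lie_self, hxi, map_zero, LinearMap.zero_apply, map_smul, smul_eq_mul] at h1
      rcases mul_eq_zero.mp h1.symm with h2 | h2
      · exact absurd (Complex.ofReal_eq_zero.mp h2) h0
      · exact h2
    rcases lt_trichotomy (m i) 0 with hlt | heq | hgt
    · have h0 : ⁅x i, f⁆ = 0 := by
        by_contra hne0
        have := (hA _ _ hne0 hxf).1
        linarith
      rw [hne0 hlt.ne, hΨ, h0]
      simp
    · rw [heq, zero_sub] at hxf
      obtain ⟨c, hc⟩ := hB ⁅x i, f⁆ (by rw [hxf]; push_cast; rfl)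
      have hsff : s f f ≠ 0 := fun h0 => hf0 (h.eq_zero h0)
      have h1 : c * s f f = -(s t (x i)) * s f f := by
        have h2 := h.form_lie (σ f) f (x i)
        rw [h.invol, ← lie_skew f (x i), hc, map_neg, neg_neg, map_smul, hff, map_smulₛₗ,
          LinearMap.smul_apply, smul_eq_mul, smul_eq_mul, map_neg, h.symm] at h2
        rw [← h2]
        ring
      have h3 : c = -s t (x i) := mul_right_cancel₀ hsff h1
      rw [hΨ, hc, map_smul, map_smul, hSw, h3, smul_eq_mul, neg_mul, Complex.neg_re]
    · rw [hne0 hgt.ne', hΨ]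
      have h1 : S ⁅x i, f⁆ = ⁅x i, w⁆ - lieCommutator (x i) S f := by
        rw [lieCommutator_apply, hSw]; abel
      have h2 : D ⁅x i, w⁆ = ((m i + d : ℝ) : ℂ) • ⁅x i, w⁆ := by
        change ⁅t, ⁅x i, w⁆⁆ = _
        rw [leibniz_lie, hxi, hDw, smul_lie, lie_smul, ← add_smul]
        push_cast
        rfl
      rw [h1, map_sub, horth _ _ h2 (by linarith) _ ((hEf _).mpr ⟨_, hinv S hS (x i), rfl⟩),
        sub_zero, zero_mul, Complex.zero_re, neg_zero]
      by_cases h0 : ⁅x i, w⁆ = 0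
      · simp [h0]
      · exact (h.pos _ h0).le
  have h1 : -d ≤ -μ := by
    have h2 := Finset.sum_le_sum fun i (_ : i ∈ Finset.univ) => hterm i
    rw [Finset.sum_neg_distrib, ← Complex.re_sum, ← Complex.re_sum, hsum1, hsum2] at h2
    simpa using h2
  linarith [(hA w d hw0 hDw).2]

theorem casimir_eigenvalue_le {𝔤 : Type*} [LieRing 𝔤] [LieAlgebra ℝ 𝔤] [FiniteDimensional ℝ 𝔤]
    [LieAlgebra.IsSimple ℝ 𝔤] (hc : ∀ X : 𝔤, X ≠ 0 → killingForm ℝ 𝔤 X X < 0)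
    {κ : Type*} [Fintype κ] [DecidableEq κ] {e : Module.Basis κ ℝ 𝔤}
    (he : IsOrthonormalBasis (-killingForm ℝ 𝔤) e) {μ : ℝ} {S : 𝔤 →ₗ[ℝ] 𝔤}
    (hS : S ∈ casimirEigenspace e μ) (hS0 : S ≠ 0) : μ ≤ killingHighestRootSq 𝔤 := by
  have hB := isInvariantInner_neg_killingForm hc
  have hnt : Nontrivial 𝔤 := LieAlgebra.IsSimple.nontrivial ℝ 𝔤
  obtain ⟨t, f, r, -, hrle, hf0, ht, htf, hff, hA, hBf⟩ := exists_compact_root hc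
  refine le_trans ?_ hrle
  have happ : ∀ i, e.baseChange ℂ i = (1 : ℂ) ⊗ₜ[ℝ] e i := fun i => e.baseChange_apply ..
  refine (isCompactConjugation_tensorConj hc).eigenvalue_le ht hf0 htf hff hA hBf
    (e.baseChange ℂ) (hermitianForm_baseChange_basis he) (fun i => by rw [happ]; simp) μ
    (fun S hS x => lieCommutator_mem_casimirEigenspace (fun Φ x => ?_) hS x) ?_
  · induction x with
    | zero => simp
    | add x y hx hy =>
      refine Eq.trans ?_ ((congrArg₂ (· + ·) hx hy).trans (add_zero 0))
      rw [← Finset.sum_add_distrib]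
      refine Finset.sum_congr rfl fun i _ => ?_
      rw [tensor_lie_add, map_add, map_add, LinearMap.add_apply]
      abel
    | tmul z x =>
      let Φ' : 𝔤 →ₗ[ℝ] 𝔤 →ₗ[ℝ] (ℂ ⊗[ℝ] 𝔤) :=
        LinearMap.mk₂ ℝ (fun u v => Φ ((1 : ℂ) ⊗ₜ u) ((1 : ℂ) ⊗ₜ v))
          (fun u u' v => by simp [TensorProduct.tmul_add])
          (fun c u v => by simp)
          (fun u u' v => by simp [TensorProduct.tmul_add])
          (fun c u v => by simp)
      have h1 := hB.sum_lie_eq_zero he Φ' x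
      have h2 : ∀ i, ⁅(1 : ℂ) ⊗ₜ[ℝ] e i, z ⊗ₜ[ℝ] x⁆ = z • ((1 : ℂ) ⊗ₜ[ℝ] ⁅e i, x⁆) := fun i => by
        rw [LieAlgebra.ExtendScalars.bracket_tmul, TensorProduct.smul_tmul', one_mul, smul_eq_mul,
          mul_one]
      simp only [happ, h2, map_smul, LinearMap.smul_apply, ← smul_add, ← Finset.smul_sum]
      exact (congrArg (fun y => z • y) h1).trans (smul_zero z)
  -- The common kernel of the eigenspace is an ideal, because the eigenspace is stable under
  -- commutators with inner derivations. By simplicity it is zero, so some element of the eigenspace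
  -- does not kill the real or the imaginary part of $f$.
  · let K : LieIdeal ℝ 𝔤 :=
      { carrier := {y | ∀ S ∈ casimirEigenspace e μ, S y = 0}
        zero_mem' := fun S _ => map_zero S
        add_mem' := fun {a b} ha hb S hS => by rw [map_add, ha S hS, hb S hS, add_zero]
        smul_mem' := fun c a ha S hS => by rw [map_smul, ha S hS, smul_zero]
        lie_mem := fun {x a} ha S hS => by
          have h1 := ha _ (lieCommutator_mem_casimirEigenspace
            (fun Φ x => hB.sum_lie_eq_zero he Φ x) hS x)
          rw [lieCommutator_apply, ha S hS, lie_zero, zero_sub, neg_eq_zero] at h1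
          exact h1 }
    have hK : K = ⊥ := by
      refine (LieAlgebra.IsSimple.eq_bot_or_eq_top K).resolve_right fun h => hS0 ?_
      ext y
      have hy : y ∈ K := by rw [h]; trivial
      exact hy S hS
    have hex : ∀ y : 𝔤, y ≠ 0 → ∃ S ∈ casimirEigenspace e μ, S y ≠ 0 := by
      intro y hy
      by_contra! hcon
      have : y ∈ K := hcon
      rw [hK] at this
      exact hy (by simpa using this)
    have hbase : ∀ S ∈ casimirEigenspace e μ, S.baseChange ℂ ∈
        casimirEigenspace (e.baseChange ℂ) (μ : ℂ) := by
      intro S hS y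
      induction y with
      | zero => simp
      | add x y hx hy =>
        simp only [tensor_lie_add, map_add, Finset.sum_add_distrib, smul_add] at hx hy ⊢
        rw [hx, hy]
      | tmul z x =>
        have h1 : ∀ i, ⁅e.baseChange ℂ i, S.baseChange ℂ ⁅e.baseChange ℂ i, z ⊗ₜ[ℝ] x⁆⁆ =
            z ⊗ₜ[ℝ] ⁅e i, S ⁅e i, x⁆⁆ := fun i => by
          rw [happ, LieAlgebra.ExtendScalars.bracket_tmul, LinearMap.baseChange_tmul,
            LieAlgebra.ExtendScalars.bracket_tmul, one_mul, one_mul]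
        rw [Finset.sum_congr rfl fun i _ => h1 i, ← TensorProduct.tmul_sum, hS x,
          LinearMap.baseChange_tmul, ← TensorProduct.smul_tmul, TensorProduct.smul_tmul']
        congr 1
    obtain ⟨a, b, rfl⟩ := exists_eq_tmul_add_tmul f
    have hab : a ≠ 0 ∨ b ≠ 0 := by
      by_contra! hcon
      apply hf0
      rw [hcon.1, hcon.2]
      simp
    have hfin : ∀ S ∈ casimirEigenspace e μ,
        S.baseChange ℂ ((1 : ℂ) ⊗ₜ[ℝ] a + Complex.I ⊗ₜ[ℝ] b) = 0 → S a = 0 ∧ S b = 0 := by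
      intro S _ h0
      rw [map_add, LinearMap.baseChange_tmul, LinearMap.baseChange_tmul] at h0
      exact tmul_add_tmul_eq_zero h0
    rcases hab with ha | hb
    · obtain ⟨S, hS, hSa⟩ := hex a ha
      exact ⟨_, hbase S hS, fun h0 => hSa (hfin S hS h0).1⟩
    · obtain ⟨S, hS, hSb⟩ := hex b hb
      exact ⟨_, hbase S hS, fun h0 => hSb (hfin S hS h0).2⟩

/-! ### Normal ordered products and their commutators with currents. -/

noncomputable section

namespace CurrentAlgebra

variable {𝔤 : Type*} [LieRing 𝔤] [LieAlgebra ℝ 𝔤] {k : ℕ}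
  {V : Type*} [NormedAddCommGroup V] [InnerProductSpace ℂ V] (A : CurrentAlgebra 𝔤 k V)

theorem J_add (X Y : 𝔤) (n : ℤ) (φ : V) : A.J (X + Y) n φ = A.J X n φ + A.J Y n φ := by
  rw [map_add]; rfl

theorem J_smul (r : ℝ) (X : 𝔤) (n : ℤ) (φ : V) : A.J (r • X) n φ = (r : ℂ) • A.J X n φ := by
  rw [map_smul, Complex.coe_smul]; rfl

theorem J_neg (X : 𝔤) (n : ℤ) (φ : V) : A.J (-X) n φ = -A.J X n φ := by
  rw [map_neg]; rfl

theorem J_zero (n : ℤ) (φ : V) : A.J 0 n φ = 0 := by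
  rw [map_zero]; rfl

theorem J_sub (X Y : 𝔤) (n : ℤ) (φ : V) : A.J (X - Y) n φ = A.J X n φ - A.J Y n φ := by
  rw [map_sub]; rfl

theorem J_sum {κ : Type*} (s : Finset κ) (X : κ → 𝔤) (n : ℤ) (φ : V) :
    A.J (∑ i ∈ s, X i) n φ = ∑ i ∈ s, A.J (X i) n φ := by
  rw [map_sum, Finset.sum_apply, LinearMap.sum_apply]

/-- The central term of the commutator of `J X m` and `J Y n`. -/
def cocycle (_ : CurrentAlgebra 𝔤 k V) (X Y : 𝔤) (m n : ℤ) : ℂ :=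
  if m + n = 0 then (((k : ℝ) * m * normalizedForm 𝔤 X Y : ℝ) : ℂ) else 0

theorem J_comm (X Y : 𝔤) (m n : ℤ) (φ : V) :
    A.J X m (A.J Y n φ) = A.J Y n (A.J X m φ) + Complex.I • A.J ⁅X, Y⁆ (m + n) φ +
      A.cocycle X Y m n • φ := by
  rw [add_assoc, ← sub_eq_iff_eq_add']
  exact A.commutator X Y m n φ

theorem cyclic_induction {p : V → Prop} (zero : p 0) (add : ∀ φ ψ, p φ → p ψ → p (φ + ψ))
    (smul : ∀ (c : ℂ) φ, p φ → p (c • φ)) (vac : p A.vac)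
    (J : ∀ X n φ, p φ → p (A.J X n φ)) (φ : V) : p φ := by
  let W : Submodule ℂ V :=
    { carrier := {φ | p φ}
      zero_mem' := zero
      add_mem' := fun {a b} ha hb => add a b ha hb
      smul_mem' := fun c a ha => smul c a ha }
  have hW := A.cyclic W vac fun X n φ hφ => J X n φ hφ
  have : φ ∈ W := by rw [hW]; trivial
  exact this

/-- Moving $J_m$ past $J_n$ costs only $J_{m+n}$ once $m+n>0$ excludes the central term, so the
property spreads from the vacuum by cyclicity. It makes the normal ordered sums finite. -/
theorem exists_forall_ge_eq_zero (φ : V) (X : 𝔤) : ∃ M : ℤ, ∀ m, M ≤ m → A.J X m φ = 0 := by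
  revert X
  refine A.cyclic_induction (p := fun φ => ∀ X, ∃ M : ℤ, ∀ m, M ≤ m → A.J X m φ = 0)
    ?_ ?_ ?_ ?_ ?_ φ
  · exact fun X => ⟨0, fun m _ => by simp⟩
  · intro φ ψ hφ hψ X
    obtain ⟨M, hM⟩ := hφ X
    obtain ⟨M', hM'⟩ := hψ X
    refine ⟨max M M', fun m hm => ?_⟩
    rw [map_add, hM m (le_trans (le_max_left _ _) hm), hM' m (le_trans (le_max_right _ _) hm),
      add_zero]
  · intro c φ hφ X
    obtain ⟨M, hM⟩ := hφ X
    exact ⟨M, fun m hm => by rw [map_smul, hM m hm, smul_zero]⟩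
  · exact fun X => ⟨0, fun m hm => A.annihilates_vac X m hm⟩
  · intro Y n φ hφ X
    obtain ⟨M, hM⟩ := hφ X
    obtain ⟨M', hM'⟩ := hφ ⁅X, Y⁆
    refine ⟨max M (max (M' - n) (1 - n)), fun m hm => ?_⟩
    have h1 : M ≤ m := le_trans (le_max_left _ _) hm
    have h2 : M' - n ≤ m := le_trans (le_trans (le_max_left _ _) (le_max_right _ _)) hm
    have h3 : 1 - n ≤ m := le_trans (le_trans (le_max_right _ _) (le_max_right _ _)) hm
    rw [A.J_comm, hM m h1, hM' (m + n) (by omega), map_zero, smul_zero, cocycle,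
      if_neg (by omega), zero_smul, add_zero, add_zero]

/-- The summands of the normal ordered product. -/
def orderedTerm (Y Z : 𝔤) (n l : ℤ) : V →ₗ[ℂ] V :=
  if l < 0 then A.J Y l ∘ₗ A.J Z (n - l) else A.J Z (n - l) ∘ₗ A.J Y l

theorem normalOrdered_eq_finsum (Y Z : 𝔤) (n : ℤ) (φ : V) :
    A.normalOrdered Y Z n φ = ∑ᶠ l, A.orderedTerm Y Z n l φ := by
  refine finsum_congr fun l => ?_
  rw [orderedTerm]
  split_ifs <;> rfl

theorem finite_support_orderedTerm (Y Z : 𝔤) (n : ℤ) (φ : V) :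
    (Function.support fun l => A.orderedTerm Y Z n l φ).Finite := by
  obtain ⟨M, hM⟩ := A.exists_forall_ge_eq_zero φ Y
  obtain ⟨M', hM'⟩ := A.exists_forall_ge_eq_zero φ Z
  refine (Set.finite_Icc (min (n - M') 0) (max M 0)).subset fun l hl => ?_
  by_contra hcon
  apply hl
  simp only [orderedTerm]
  rw [Set.mem_Icc, not_and_or, not_le, not_le] at hcon
  split_ifs with h0
  · rw [LinearMap.comp_apply, hM' (n - l) (by omega), map_zero]
  · rw [LinearMap.comp_apply, hM l (by omega), map_zero]

/-- The modes of the normal ordered product as linear maps. -/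
def orderedMap (Y Z : 𝔤) (n : ℤ) : V →ₗ[ℂ] V where
  toFun φ := A.normalOrdered Y Z n φ
  map_add' φ ψ := by
    simp only [normalOrdered_eq_finsum, map_add]
    exact finsum_add_distrib (A.finite_support_orderedTerm Y Z n φ)
      (A.finite_support_orderedTerm Y Z n ψ)
  map_smul' c φ := by
    simp only [normalOrdered_eq_finsum, map_smul]
    exact (smul_finsum c _).symm

theorem orderedMap_apply (Y Z : 𝔤) (n : ℤ) (φ : V) :
    A.orderedMap Y Z n φ = ∑ᶠ l, A.orderedTerm Y Z n l φ := A.normalOrdered_eq_finsum Y Z n φ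

theorem orderedTerm_add_left (Y Y' Z : 𝔤) (n l : ℤ) (φ : V) :
    A.orderedTerm (Y + Y') Z n l φ = A.orderedTerm Y Z n l φ + A.orderedTerm Y' Z n l φ := by
  simp only [orderedTerm]
  split_ifs <;> simp only [LinearMap.comp_apply, map_add, Pi.add_apply, LinearMap.add_apply]

theorem orderedTerm_add_right (Y Z Z' : 𝔤) (n l : ℤ) (φ : V) :
    A.orderedTerm Y (Z + Z') n l φ = A.orderedTerm Y Z n l φ + A.orderedTerm Y Z' n l φ := by
  simp only [orderedTerm]
  split_ifs <;> simp only [LinearMap.comp_apply, map_add, Pi.add_apply, LinearMap.add_apply]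

theorem orderedTerm_smul_left (r : ℝ) (Y Z : 𝔤) (n l : ℤ) (φ : V) :
    A.orderedTerm (r • Y) Z n l φ = r • A.orderedTerm Y Z n l φ := by
  rw [← Complex.coe_smul]
  simp only [orderedTerm]
  split_ifs
  all_goals simp only [LinearMap.comp_apply, J_smul]
  rw [map_smul]

theorem orderedTerm_smul_right (r : ℝ) (Y Z : 𝔤) (n l : ℤ) (φ : V) :
    A.orderedTerm Y (r • Z) n l φ = r • A.orderedTerm Y Z n l φ := by
  rw [← Complex.coe_smul]
  simp only [orderedTerm]
  split_ifs
  all_goals simp only [LinearMap.comp_apply, J_smul]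
  rw [map_smul]

/-- The normal ordered product as a bilinear map of the colours. -/
def orderedBilin (n : ℤ) (φ : V) : 𝔤 →ₗ[ℝ] 𝔤 →ₗ[ℝ] V :=
  LinearMap.mk₂ ℝ (fun Y Z => A.orderedMap Y Z n φ)
    (fun Y Y' Z => by
      simp only [orderedMap_apply, orderedTerm_add_left]
      exact finsum_add_distrib (A.finite_support_orderedTerm ..)
        (A.finite_support_orderedTerm ..))
    (fun r Y Z => by
      simp only [orderedMap_apply, orderedTerm_smul_left]
      exact (smul_finsum r _).symm)
    (fun Y Z Z' => by
      simp only [orderedMap_apply, orderedTerm_add_right]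
      exact finsum_add_distrib (A.finite_support_orderedTerm ..)
        (A.finite_support_orderedTerm ..))
    (fun r Y Z => by
      simp only [orderedMap_apply, orderedTerm_smul_right]
      exact (smul_finsum r _).symm)

theorem orderedBilin_apply (n : ℤ) (φ : V) (Y Z : 𝔤) :
    A.orderedBilin n φ Y Z = A.orderedMap Y Z n φ := rfl

/-- The difference between reordered and shifted normal ordered summands. -/
def reorderSign (m l : ℤ) : ℤ :=
  (if l < 0 ∧ 0 ≤ l + m then 1 else 0) - (if 0 ≤ l ∧ l + m < 0 then 1 else 0)

theorem finite_support_reorderSign (m : ℤ) : (Function.support (reorderSign m)).Finite := by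
  refine (Set.finite_Icc (-|m|) |m|).subset fun l hl => ?_
  by_contra hcon
  apply hl
  rw [Set.mem_Icc] at hcon
  have h1 := le_abs_self m
  have h2 := neg_le_abs m
  simp only [reorderSign]
  split_ifs <;> omega

/-- Exactly $|m|$ indices cross the ordering threshold $0$ under $l\mapsto l+m$, all counted with
the sign of $m$. This produces the factor $m$ of the reordering part of the commutator. -/
theorem finsum_reorderSign (m : ℤ) : ∑ᶠ l, reorderSign m l = m := by
  have h : ∀ l, reorderSign m l = (if l ∈ Finset.Ico (-m) 0 then 1 else 0) -
      (if l ∈ Finset.Ico 0 (-m) then 1 else 0) := fun l => by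
    simp only [reorderSign, Finset.mem_Ico]
    congr 2 <;> simp <;> omega
  have hs : ∀ s : Finset ℤ, (Function.support fun l : ℤ => if l ∈ s then (1 : ℤ) else 0).Finite :=
    fun s => s.finite_toSet.subset fun l hl => by
      by_contra hcon
      exact hl (if_neg hcon)
  have hf : ∀ s : Finset ℤ, ∑ᶠ l : ℤ, (if l ∈ s then (1 : ℤ) else 0) = s.card := fun s => by
    rw [finsum_eq_sum_of_support_subset (s := s)]
    · simp
    · intro l hl
      by_contra hcon
      exact hl (if_neg hcon)
  rw [finsum_congr h, finsum_sub_distrib (hs _) (hs _), hf, hf, Int.card_Ico, Int.card_Ico]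
  omega

/-- Commuting with $J_m$ replaces the index $l$ of the first factor by $l+m$. The product so
obtained is normal ordered unless $l$ and $l+m$ lie on different sides of $0$; in that case a
further commutator appears, recorded by `reorderSign`. -/
theorem orderedTerm_J (X Y Z : 𝔤) (n m l : ℤ) (φ : V) :
    A.orderedTerm Y Z n l (A.J X m φ) = A.J X m (A.orderedTerm Y Z n l φ) +
      Complex.I • A.orderedTerm Y ⁅Z, X⁆ (n + m) l φ +
      Complex.I • A.orderedTerm ⁅Y, X⁆ Z (n + m) (l + m) φ +
      (A.cocycle Z X (n - l) m • A.J Y l φ + A.cocycle Y X l m • A.J Z (n - l) φ) +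
      (reorderSign m l : ℂ) • (Complex.I • Complex.I • A.J ⁅⁅Y, X⁆, Z⁆ (n + m) φ +
        (Complex.I * A.cocycle ⁅Y, X⁆ Z (l + m) (n - l)) • φ) := by
  have e1 : n - l + m = n + m - l := by ring
  have e2 : n + m - (l + m) = n - l := by ring
  have e3 : l + m + (n - l) = n + m := by ring
  simp only [orderedTerm, reorderSign, e2]
  by_cases h0 : l < 0 <;> by_cases h1 : l + m < 0
  · simp only [h0, h1, if_true, LinearMap.comp_apply, not_le.mpr h0, not_le.mpr h1, and_false,
      false_and, if_false, sub_zero, Int.cast_zero, zero_smul, add_zero]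
    rw [A.J_comm Z X (n - l) m, map_add, map_add, A.J_comm Y X l m, map_smul, map_smul, e1]
    module
  · simp only [h0, h1, if_true, LinearMap.comp_apply, not_le.mpr h0, not_lt.mp h1, and_true,
      and_false, if_false, sub_zero, Int.cast_one, one_smul]
    rw [A.J_comm Z X (n - l) m, map_add, map_add, A.J_comm Y X l m, map_smul, map_smul, e1,
      A.J_comm ⁅Y, X⁆ Z (l + m) (n - l), e3]
    module
  · simp only [h0, h1, if_false, if_true, LinearMap.comp_apply, not_lt.mp h0, and_true,
      false_and, zero_sub, Int.cast_neg, Int.cast_one]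
    rw [A.J_comm Y X l m, map_add, map_add, A.J_comm Z X (n - l) m, map_smul, map_smul, e1,
      A.J_comm ⁅Y, X⁆ Z (l + m) (n - l), e3]
    module
  · simp only [h0, h1, if_false, LinearMap.comp_apply, and_false,
      false_and, sub_zero, Int.cast_zero, zero_smul, add_zero]
    rw [A.J_comm Y X l m, map_add, map_add, A.J_comm Z X (n - l) m, map_smul, map_smul, e1]
    module

end CurrentAlgebra
end

noncomputable section

namespace CurrentAlgebra

variable {𝔤 : Type*} [LieRing 𝔤] [LieAlgebra ℝ 𝔤] {k : ℕ}
  {V : Type*} [NormedAddCommGroup V] [InnerProductSpace ℂ V] (A : CurrentAlgebra 𝔤 k V)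

/-- The coefficient of the central term that arises from reordering. -/
def reorderMoment (m : ℤ) : ℂ := ∑ᶠ l : ℤ, (reorderSign m l : ℂ) * (l + m)

theorem cocycle_of_add_ne {X Y : 𝔤} {m n : ℤ} (h : m + n ≠ 0) : A.cocycle X Y m n = 0 := if_neg h

theorem cocycle_neg_left (X Y : 𝔤) (m : ℤ) :
    A.cocycle X Y (-m) m = -((k : ℂ) * m * normalizedForm 𝔤 X Y) := by
  rw [cocycle, if_pos (neg_add_cancel m)]
  push_cast
  ring

theorem finsum_cocycle_smul_left (X Z : 𝔤) (n m : ℤ) (F : ℤ → V) :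
    ∑ᶠ l : ℤ, A.cocycle Z X (n - l) m • F l =
      -((k : ℂ) * m * normalizedForm 𝔤 Z X) • F (n + m) := by
  rw [finsum_eq_single _ (n + m) fun l hl => by
    rw [A.cocycle_of_add_ne (by omega), zero_smul], show n - (n + m) = -m by ring,
    cocycle_neg_left]

theorem finite_support_cocycle_smul_left (X Z : 𝔤) (n m : ℤ) (F : ℤ → V) :
    (Function.support fun l : ℤ => A.cocycle Z X (n - l) m • F l).Finite :=
  (Set.finite_singleton (n + m)).subset fun l hl => by
    by_contra hcon
    apply hl
    have : l ≠ n + m := hcon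
    simp only
    rw [A.cocycle_of_add_ne (by omega), zero_smul]

theorem finsum_cocycle_smul_right (X Y : 𝔤) (n m : ℤ) (F : ℤ → V) :
    ∑ᶠ l : ℤ, A.cocycle Y X l m • F (n - l) =
      -((k : ℂ) * m * normalizedForm 𝔤 Y X) • F (n + m) := by
  rw [finsum_eq_single _ (-m) fun l hl => by
    rw [A.cocycle_of_add_ne (by omega), zero_smul], show n - (-m) = n + m by ring,
    cocycle_neg_left]

theorem finite_support_cocycle_smul_right (X Y : 𝔤) (n m : ℤ) (F : ℤ → V) :
    (Function.support fun l : ℤ => A.cocycle Y X l m • F (n - l)).Finite :=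
  (Set.finite_singleton (-m)).subset fun l hl => by
    by_contra hcon
    apply hl
    have : l ≠ -m := hcon
    simp only
    rw [A.cocycle_of_add_ne (by omega), zero_smul]

theorem finite_support_reorderSign_smul (m : ℤ) (F : ℤ → V) :
    (Function.support fun l : ℤ => (reorderSign m l : ℂ) • F l).Finite :=
  (finite_support_reorderSign m).subset fun l hl h0 => by
    apply hl
    simp only
    rw [h0, Int.cast_zero, zero_smul]

theorem finsum_reorderSign_smul (m : ℤ) (v : V) :
    ∑ᶠ l : ℤ, (reorderSign m l : ℂ) • v = (m : ℂ) • v := by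
  have h1 : ∑ᶠ l : ℤ, (reorderSign m l : ℂ) = m := by
    have := (Int.castAddHom ℂ).map_finsum (finite_support_reorderSign m)
    rw [finsum_reorderSign] at this
    exact this.symm
  rw [← h1, finsum_smul]

theorem finsum_reorderSign_cocycle (m n : ℤ) (W Z : 𝔤) (φ : V) :
    ∑ᶠ l : ℤ, (reorderSign m l : ℂ) • (Complex.I * A.cocycle W Z (l + m) (n - l)) • φ =
      (if n + m = 0 then Complex.I * k * normalizedForm 𝔤 W Z * reorderMoment m else 0) • φ := by
  by_cases h : n + m = 0
  · have h1 : ∀ l : ℤ, (reorderSign m l : ℂ) • (Complex.I * A.cocycle W Z (l + m) (n - l)) • φ =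
        ((reorderSign m l : ℂ) * (l + m)) • (Complex.I * k * normalizedForm 𝔤 W Z) • φ := by
      intro l
      rw [cocycle, if_pos (by omega), smul_smul, smul_smul]
      congr 1
      push_cast
      ring
    rw [finsum_congr h1, ← finsum_smul, if_pos h, smul_smul, reorderMoment, mul_comm]
  · have h1 : ∀ l : ℤ, (reorderSign m l : ℂ) • (Complex.I * A.cocycle W Z (l + m) (n - l)) • φ =
        0 := by
      intro l
      rw [A.cocycle_of_add_ne (by omega)]
      simp
    rw [finsum_congr h1, finsum_zero, if_neg h, zero_smul]

theorem orderedMap_J (X Y Z : 𝔤) (n m : ℤ) (φ : V) :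
    A.orderedMap Y Z n (A.J X m φ) = A.J X m (A.orderedMap Y Z n φ) +
      Complex.I • A.orderedMap Y ⁅Z, X⁆ (n + m) φ +
      Complex.I • A.orderedMap ⁅Y, X⁆ Z (n + m) φ +
      (-((k : ℂ) * m * normalizedForm 𝔤 Z X) • A.J Y (n + m) φ +
        -((k : ℂ) * m * normalizedForm 𝔤 Y X) • A.J Z (n + m) φ) +
      (-((m : ℂ) • A.J ⁅⁅Y, X⁆, Z⁆ (n + m) φ) +
        (if n + m = 0 then Complex.I * k * normalizedForm 𝔤 ⁅Y, X⁆ Z * reorderMoment m else 0) •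
          φ) := by
  have hJ : A.J X m (A.orderedMap Y Z n φ) = ∑ᶠ l, A.J X m (A.orderedTerm Y Z n l φ) := by
    rw [orderedMap_apply]
    exact (A.J X m).toAddMonoidHom.map_finsum (A.finite_support_orderedTerm Y Z n φ)
  have hshift : A.orderedMap ⁅Y, X⁆ Z (n + m) φ =
      ∑ᶠ l, A.orderedTerm ⁅Y, X⁆ Z (n + m) (l + m) φ := by
    rw [orderedMap_apply]
    exact (finsum_comp_equiv (Equiv.addRight m)
      (f := fun l => A.orderedTerm ⁅Y, X⁆ Z (n + m) l φ)).symm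
  have hshift_supp :
      (Function.support fun l => A.orderedTerm ⁅Y, X⁆ Z (n + m) (l + m) φ).Finite := by
    have h1 := A.finite_support_orderedTerm ⁅Y, X⁆ Z (n + m) φ
    exact h1.preimage (f := fun l => l + m) (add_left_injective m).injOn
  have hJ_supp : (Function.support fun l => A.J X m (A.orderedTerm Y Z n l φ)).Finite :=
    (A.finite_support_orderedTerm Y Z n φ).subset fun l hl h0 =>
      hl ((congrArg (A.J X m) h0).trans (map_zero _))
  have hsmul : ∀ F : ℤ → V, (Function.support F).Finite →
      (Function.support fun l => Complex.I • F l).Finite := fun F hF =>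
    hF.subset fun l hl h0 => hl (by simp only; rw [h0, smul_zero])
  have s2 := hsmul _ (A.finite_support_orderedTerm Y ⁅Z, X⁆ (n + m) φ)
  have s3 := hsmul _ hshift_supp
  have s4 := A.finite_support_cocycle_smul_left X Z n m (fun l => A.J Y l φ)
  have s5 := A.finite_support_cocycle_smul_right X Y n m (fun l => A.J Z l φ)
  have s6 := finite_support_reorderSign_smul m
    (fun _ => Complex.I • Complex.I • A.J ⁅⁅Y, X⁆, Z⁆ (n + m) φ)
  have s7 := finite_support_reorderSign_smul m
    (fun l => (Complex.I * A.cocycle ⁅Y, X⁆ Z (l + m) (n - l)) • φ)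
  have sadd : ∀ F G : ℤ → V, (Function.support F).Finite → (Function.support G).Finite →
      (Function.support fun l => F l + G l).Finite := fun F G hF hG =>
    (hF.union hG).subset (Function.support_add F G)
  rw [orderedMap_apply, finsum_congr fun l => A.orderedTerm_J X Y Z n m l φ]
  simp only [smul_add]
  rw [finsum_add_distrib (sadd _ _ (sadd _ _ (sadd _ _ hJ_supp s2) s3) (sadd _ _ s4 s5))
      (sadd _ _ s6 s7),
    finsum_add_distrib (sadd _ _ (sadd _ _ hJ_supp s2) s3) (sadd _ _ s4 s5),
    finsum_add_distrib (sadd _ _ hJ_supp s2) s3, finsum_add_distrib hJ_supp s2,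
    finsum_add_distrib s4 s5, finsum_add_distrib s6 s7, ← hJ, ← smul_finsum, ← smul_finsum,
    ← hshift, ← orderedMap_apply, finsum_cocycle_smul_left A X Z n m (fun l => A.J Y l φ),
    finsum_cocycle_smul_right A X Y n m (fun l => A.J Z l φ), finsum_reorderSign_smul,
    finsum_reorderSign_cocycle]
  congr 2
  rw [smul_smul Complex.I, Complex.I_mul_I, neg_one_smul, smul_neg]

/-- The symmetrised normal ordered product. -/
def symMap (Y Z : 𝔤) (n : ℤ) : V →ₗ[ℂ] V := A.orderedMap Y Z n + A.orderedMap Z Y n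

theorem symMap_apply (Y Z : 𝔤) (n : ℤ) (φ : V) :
    A.symMap Y Z n φ = A.orderedMap Y Z n φ + A.orderedMap Z Y n φ := rfl

theorem symMap_comm (Y Z : 𝔤) (n : ℤ) : A.symMap Y Z n = A.symMap Z Y n := add_comm _ _

/-- Symmetrising cancels the central term with `reorderMoment`, because $g([Y,X],Z)$ is
antisymmetric in $Y$ and $Z$. -/
theorem symMap_J (hg : IsInvariantInner (normalizedForm 𝔤)) (X Y Z : 𝔤) (n m : ℤ) (φ : V) :
    A.symMap Y Z n (A.J X m φ) = A.J X m (A.symMap Y Z n φ) +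
      Complex.I • (A.symMap Y ⁅Z, X⁆ (n + m) φ + A.symMap ⁅Y, X⁆ Z (n + m) φ) -
      (m : ℂ) • A.J (⁅⁅Y, X⁆, Z⁆ + ⁅⁅Z, X⁆, Y⁆ + (2 * k * normalizedForm 𝔤 Z X) • Y +
        (2 * k * normalizedForm 𝔤 Y X) • Z) (n + m) φ := by
  have h1 : normalizedForm 𝔤 ⁅Z, X⁆ Y = -normalizedForm 𝔤 ⁅Y, X⁆ Z := by
    rw [← lie_skew, ← lie_skew Y, map_neg, map_neg, LinearMap.neg_apply, LinearMap.neg_apply,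
      hg.inv, hg.symm Z]
  simp only [symMap_apply, orderedMap_J, h1]
  have h2 : (if n + m = 0 then Complex.I * k * ((-normalizedForm 𝔤 ⁅Y, X⁆ Z : ℝ) : ℂ) *
      reorderMoment m else 0) = -(if n + m = 0 then Complex.I * k *
        (normalizedForm 𝔤 ⁅Y, X⁆ Z : ℂ) * reorderMoment m else 0) := by
    split_ifs
    · push_cast; ring
    · simp
  rw [h2, map_add (A.J X m), J_add, J_add, J_add, J_smul, J_smul]
  push_cast
  module

end CurrentAlgebra
end

/-! ### Quadratic fields and the commutant of the coset field. -/

noncomputable section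

namespace CurrentAlgebra

variable {𝔤 : Type*} [LieRing 𝔤] [LieAlgebra ℝ 𝔤] {k : ℕ}
  {V : Type*} [NormedAddCommGroup V] [InnerProductSpace ℂ V] (A : CurrentAlgebra 𝔤 k V)

/-- Taking adjoints respects the ordering except at $l=0$. There the two factors come out in the
wrong order, and the resulting currents of colours $[Y,Z]$ and $[Z,Y]$ cancel after symmetrisation.
-/
theorem orderedTerm_add_symmetric (Y Z : 𝔤) (n l : ℤ) (φ ψ : V) :
    ⟪A.orderedTerm Y Z n l φ + A.orderedTerm Z Y n l φ, ψ⟫_ℂ =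
      ⟪φ, A.orderedTerm Y Z (-n) (-l) ψ + A.orderedTerm Z Y (-n) (-l) ψ⟫_ℂ := by
  have e : -(n - l) = -n - -l := by ring
  simp only [orderedTerm, Left.neg_neg_iff, inner_add_left, inner_add_right]
  rcases lt_trichotomy l 0 with h | h | h
  · simp only [h, if_true, not_lt.mpr h.le, if_false, LinearMap.comp_apply, A.symmetric, e]
  · subst h
    have h1 := A.J_comm Y Z 0 (-n) ψ
    have h2 := A.J_comm Z Y 0 (-n) ψ
    have h3 : A.J ⁅Z, Y⁆ (0 + -n) ψ = -A.J ⁅Y, Z⁆ (0 + -n) ψ := by rw [← lie_skew, J_neg]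
    have h4 : ∀ X Y : 𝔤, A.cocycle X Y 0 (-n) = 0 := fun X Y => by simp [cocycle]
    simp only [lt_irrefl, if_false, LinearMap.comp_apply, A.symmetric, sub_zero, neg_zero, h1, h2,
      h3, h4, zero_smul, add_zero, inner_add_right, smul_neg, inner_neg_right]
    ring
  · simp only [h, if_true, not_lt.mpr h.le, if_false, LinearMap.comp_apply, A.symmetric, e]

theorem symMap_symmetric (Y Z : 𝔤) (n : ℤ) (φ ψ : V) :
    ⟪A.symMap Y Z n φ, ψ⟫_ℂ = ⟪φ, A.symMap Y Z (-n) ψ⟫_ℂ := by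
  have hs : ∀ (n : ℤ) (φ : V), A.symMap Y Z n φ =
      ∑ᶠ l, (A.orderedTerm Y Z n l φ + A.orderedTerm Z Y n l φ) := fun n φ => by
    rw [symMap_apply, orderedMap_apply, orderedMap_apply]
    exact (finsum_add_distrib (A.finite_support_orderedTerm Y Z n φ)
      (A.finite_support_orderedTerm Z Y n φ)).symm
  have hf : ∀ (n : ℤ) (φ : V), (Function.support fun l =>
      A.orderedTerm Y Z n l φ + A.orderedTerm Z Y n l φ).Finite := fun n φ =>
    ((A.finite_support_orderedTerm Y Z n φ).union
      (A.finite_support_orderedTerm Z Y n φ)).subset (Function.support_add _ _)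
  have h1 := (AddMonoidHom.mk' (fun φ => ⟪φ, ψ⟫_ℂ) fun a b => inner_add_left a b ψ).map_finsum
    (hf n φ)
  have h2 := (AddMonoidHom.mk' (fun ψ => ⟪φ, ψ⟫_ℂ) fun a b => inner_add_right φ a b).map_finsum
    (hf (-n) ψ)
  simp only [AddMonoidHom.mk'_apply] at h1 h2
  rw [hs, hs, h1, h2, ← finsum_comp_equiv (Equiv.neg ℤ)
    (f := fun l => ⟪φ, A.orderedTerm Y Z (-n) l ψ + A.orderedTerm Z Y (-n) l ψ⟫_ℂ)]
  exact finsum_congr fun l => A.orderedTerm_add_symmetric Y Z n l φ ψ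

theorem orderedMap_vac (Y Z : 𝔤) {n : ℤ} (hn : -1 ≤ n) : A.orderedMap Y Z n A.vac = 0 := by
  rw [orderedMap_apply]
  refine finsum_eq_zero_of_forall_eq_zero fun l => ?_
  simp only [orderedTerm]
  split_ifs with h
  · rw [LinearMap.comp_apply, A.annihilates_vac Z (n - l) (by omega), map_zero]
  · rw [LinearMap.comp_apply, A.annihilates_vac Y l (by omega), map_zero]

theorem orderedMap_neg_two_vac (Y Z : 𝔤) :
    A.orderedMap Y Z (-2) A.vac = A.J Y (-1) (A.J Z (-1) A.vac) := by
  rw [orderedMap_apply, finsum_eq_single _ (-1)]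
  · simp [orderedTerm]
  · intro l hl
    simp only [orderedTerm]
    split_ifs with h
    · rw [LinearMap.comp_apply, A.annihilates_vac Z (-2 - l) (by omega), map_zero]
    · rw [LinearMap.comp_apply, A.annihilates_vac Y l (by omega), map_zero]

theorem map_orderedMap_comm {D : V →ₗ[ℂ] V} {Y Z : 𝔤}
    (hY : ∀ l φ, D (A.J Y l φ) = A.J Y l (D φ)) (hZ : ∀ l φ, D (A.J Z l φ) = A.J Z l (D φ))
    (n : ℤ) (φ : V) : D (A.orderedMap Y Z n φ) = A.orderedMap Y Z n (D φ) := by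
  rw [orderedMap_apply, orderedMap_apply]
  refine (D.toAddMonoidHom.map_finsum (A.finite_support_orderedTerm Y Z n φ)).trans ?_
  refine finsum_congr fun l => ?_
  simp only [orderedTerm, LinearMap.toAddMonoidHom_coe]
  split_ifs
  · rw [LinearMap.comp_apply, LinearMap.comp_apply, hY, hZ]
  · rw [LinearMap.comp_apply, LinearMap.comp_apply, hZ, hY]

section Family

variable {κ : Type*} [Fintype κ] (E : κ → 𝔤) (w : κ → ℝ)

/-- The modes `∑ w i :J (E i) J (E i):`. -/
def quadMap (n : ℤ) : V →ₗ[ℂ] V := ∑ i, (w i : ℂ) • A.orderedMap (E i) (E i) n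

/-- The colour map that describes the linear part of the commutator of `quadMap` with a current. -/
def quadCasimir (_ : CurrentAlgebra 𝔤 k V) (X : 𝔤) : 𝔤 :=
  ∑ i, w i • ((2 * k * normalizedForm 𝔤 (E i) X) • E i - ⁅E i, ⁅E i, X⁆⁆)

/-- The bilinear part of the commutator of `quadMap` with a current. -/
def quadDefect (X : 𝔤) (n : ℤ) : V →ₗ[ℂ] V := ∑ i, (w i : ℂ) • A.symMap (E i) ⁅E i, X⁆ n

theorem quadMap_apply (n : ℤ) (φ : V) :
    A.quadMap E w n φ = ∑ i, (w i : ℂ) • A.orderedMap (E i) (E i) n φ := by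
  simp [quadMap]

theorem quadDefect_apply (X : 𝔤) (n : ℤ) (φ : V) :
    A.quadDefect E w X n φ = ∑ i, (w i : ℂ) • A.symMap (E i) ⁅E i, X⁆ n φ := by
  simp [quadDefect]

theorem orderedMap_eq_symMap (Y : 𝔤) (n : ℤ) (φ : V) :
    A.orderedMap Y Y n φ = (2⁻¹ : ℂ) • A.symMap Y Y n φ := by
  rw [symMap_apply, ← two_smul ℂ, smul_smul]
  simp

theorem quadMap_symmetric (n : ℤ) (φ ψ : V) :
    ⟪A.quadMap E w n φ, ψ⟫_ℂ = ⟪φ, A.quadMap E w (-n) ψ⟫_ℂ := by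
  rw [quadMap_apply, quadMap_apply, sum_inner, inner_sum]
  refine Finset.sum_congr rfl fun i _ => ?_
  rw [inner_smul_left, inner_smul_right, orderedMap_eq_symMap, orderedMap_eq_symMap,
    inner_smul_left, inner_smul_right, symMap_symmetric, Complex.conj_ofReal, map_inv₀,
    Complex.conj_ofNat]

theorem quadMap_vac {n : ℤ} (hn : -1 ≤ n) : A.quadMap E w n A.vac = 0 := by
  rw [quadMap_apply]
  exact Finset.sum_eq_zero fun i _ => by rw [A.orderedMap_vac _ _ hn, smul_zero]

theorem quadDefect_vac (X : 𝔤) {n : ℤ} (hn : -1 ≤ n) : A.quadDefect E w X n A.vac = 0 := by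
  rw [quadDefect_apply]
  exact Finset.sum_eq_zero fun i _ => by
    rw [symMap_apply, A.orderedMap_vac _ _ hn, A.orderedMap_vac _ _ hn, add_zero, smul_zero]

variable (hg : IsInvariantInner (normalizedForm 𝔤))
include hg

/-- In the linear part, $2k\,g(E_i,X)E_i$ stems from the Schwinger term and $-[E_i,[E_i,X]]$ from
reordering. -/
theorem quadMap_J (X : 𝔤) (n m : ℤ) (φ : V) :
    A.quadMap E w n (A.J X m φ) = A.J X m (A.quadMap E w n φ) +
      Complex.I • A.quadDefect E w X (n + m) φ -
      (m : ℂ) • A.J (A.quadCasimir E w X) (n + m) φ := by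
  rw [quadMap_apply, quadMap_apply, quadDefect_apply, quadCasimir, J_sum, map_sum,
    Finset.smul_sum, Finset.smul_sum, ← Finset.sum_add_distrib, ← Finset.sum_sub_distrib]
  refine Finset.sum_congr rfl fun i _ => ?_
  have h1 : ⁅⁅E i, X⁆, E i⁆ = -⁅E i, ⁅E i, X⁆⁆ := (lie_skew _ _).symm
  rw [orderedMap_eq_symMap, orderedMap_eq_symMap, A.symMap_J hg, A.symMap_comm ⁅E i, X⁆, h1,
    J_smul, map_smul, map_smul]
  simp only [J_add, J_sub, J_neg, J_smul]
  push_cast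
  module

/-- Only the shape matters: for fixed $n+m$ the commutator is affine in $m$. -/
theorem quadDefect_J (X : 𝔤) (φ : V) (Y : 𝔤) : ∃ a b : ℤ → V, ∀ n m : ℤ,
    A.quadDefect E w X n (A.J Y m φ) = A.J Y m (A.quadDefect E w X n φ) + a (n + m) +
      (m : ℂ) • b (n + m) := by
  refine ⟨fun s => ∑ i, (w i : ℂ) • Complex.I • (A.symMap (E i) ⁅⁅E i, X⁆, Y⁆ s φ +
      A.symMap ⁅E i, Y⁆ ⁅E i, X⁆ s φ),
    fun s => ∑ i, (w i : ℂ) • -A.J (⁅⁅E i, Y⁆, ⁅E i, X⁆⁆ + ⁅⁅⁅E i, X⁆, Y⁆, E i⁆ +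
      (2 * k * normalizedForm 𝔤 ⁅E i, X⁆ Y) • E i +
        (2 * k * normalizedForm 𝔤 (E i) Y) • ⁅E i, X⁆) s φ, fun n m => ?_⟩
  simp only [quadDefect_apply, map_sum, Finset.smul_sum, ← Finset.sum_add_distrib]
  refine Finset.sum_congr rfl fun i _ => ?_
  rw [A.symMap_J hg, map_smul]
  module

/-- Keep $n+m$ fixed and let $m'$ be large, so that $J_{m'}\varphi=0$. Then $a+m'b=0$ for two
consecutive values of $m'$, so $a=b=0$ and the vanishing spreads from $\varphi$ to $J_m\varphi$. -/
theorem quadDefect_eq_zero {X : 𝔤} (hvac : ∀ n, A.quadDefect E w X n A.vac = 0) (n : ℤ) (φ : V) :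
    A.quadDefect E w X n φ = 0 := by
  revert n
  refine A.cyclic_induction (p := fun φ => ∀ n, A.quadDefect E w X n φ = 0) ?_ ?_ ?_ hvac ?_ φ
  · exact fun n => map_zero _
  · exact fun φ ψ hφ hψ n => by rw [map_add, hφ, hψ, add_zero]
  · exact fun c φ hφ n => by rw [map_smul, hφ, smul_zero]
  · intro Y m φ hφ n
    obtain ⟨a, b, hab⟩ := A.quadDefect_J E w hg X φ Y
    obtain ⟨M, hM⟩ := A.exists_forall_ge_eq_zero φ Y
    have h1 : ∀ m', M ≤ m' → a (n + m) + (m' : ℂ) • b (n + m) = 0 := by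
      intro m' hm'
      have h2 := hab (n + m - m') m'
      rw [hM m' hm', map_zero, hφ, map_zero, zero_add, sub_add_cancel] at h2
      exact h2.symm
    have h2 := h1 M le_rfl
    have h3 := h1 (M + 1) (by omega)
    have hb : b (n + m) = 0 := by
      push_cast at h3
      rw [add_smul, one_smul, ← add_assoc, h2, zero_add] at h3
      exact h3
    have ha : a (n + m) = 0 := by rwa [hb, smul_zero, add_zero] at h2
    rw [hab, hφ, map_zero, ha, hb]
    simp

/-- $J^X_1J^X_{-1}\Omega=k\,g(X,X)\Omega$, so colours are determined by one-particle vectors at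
positive level. -/
theorem eq_zero_of_J_vac (hk : 1 ≤ k) {X : 𝔤} (hX : A.J X (-1) A.vac = 0) : X = 0 := by
  by_contra hne
  have h1 := A.J_comm X X 1 (-1) A.vac
  rw [hX, map_zero, A.annihilates_vac X 1 (by norm_num), map_zero, lie_self, J_zero, smul_zero,
    zero_add, zero_add, cocycle, if_pos (by norm_num)] at h1
  have hvac : A.vac ≠ 0 := fun h0 => by
    have := A.norm_vac
    rw [h0, norm_zero] at this
    exact zero_ne_one this
  have h2 := (smul_eq_zero.mp h1.symm).resolve_right hvac
  have h3 := hg.pos X hne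
  have h4 : (0 : ℝ) < k := by exact_mod_cast hk
  have h5 : (k : ℝ) * (1 : ℤ) * normalizedForm 𝔤 X X = 0 := by exact_mod_cast h2
  push_cast at h5
  rw [mul_one] at h5
  exact (mul_pos h4 h3).ne' h5

end Family

section Coset

variable {κ κ' : Type*} [Fintype κ] [Fintype κ'] (E : κ → 𝔤) (w : κ → ℝ) (E' : κ' → 𝔤)
  (w' : κ' → ℝ)

/-- The modes of the coset stress-energy tensor. -/
def cosetMap (n : ℤ) : V →ₗ[ℂ] V := A.quadMap E w n - A.quadMap E' w' n

theorem cosetMap_apply (n : ℤ) (φ : V) :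
    A.cosetMap E w E' w' n φ = A.quadMap E w n φ - A.quadMap E' w' n φ := rfl

theorem cosetMap_symmetric (n : ℤ) (φ ψ : V) :
    ⟪A.cosetMap E w E' w' n φ, ψ⟫_ℂ = ⟪φ, A.cosetMap E w E' w' (-n) ψ⟫_ℂ := by
  rw [cosetMap_apply, cosetMap_apply, inner_sub_left, inner_sub_right, quadMap_symmetric,
    quadMap_symmetric]

theorem cosetMap_vac {n : ℤ} (hn : -1 ≤ n) : A.cosetMap E w E' w' n A.vac = 0 := by
  rw [cosetMap_apply, A.quadMap_vac E w hn, A.quadMap_vac E' w' hn, sub_zero]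

/-- The current of colour `X` commutes with the coset stress-energy tensor. -/
def CommutesWithCoset (X : 𝔤) : Prop :=
  ∀ (n m : ℤ) (φ : V),
    A.cosetMap E w E' w' n (A.J X m φ) = A.J X m (A.cosetMap E w E' w' n φ)

/-- Up to a scalar operator, $J^{[X,Y]}_m$ is a multiple of $[J^X_m,J^Y_0]$. -/
theorem CommutesWithCoset.lie {X Y : 𝔤} (hX : A.CommutesWithCoset E w E' w' X)
    (hY : A.CommutesWithCoset E w E' w' Y) : A.CommutesWithCoset E w E' w' ⁅X, Y⁆ := by
  intro n m φ
  have h : ∀ φ, A.J ⁅X, Y⁆ m φ = (-Complex.I) • (A.J X m (A.J Y 0 φ) - A.J Y 0 (A.J X m φ) -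
      A.cocycle X Y m 0 • φ) := by
    intro φ
    rw [A.J_comm X Y m 0, add_zero]
    have : (-Complex.I) • Complex.I • A.J ⁅X, Y⁆ m φ = A.J ⁅X, Y⁆ m φ := by
      rw [smul_smul, neg_mul, Complex.I_mul_I, neg_neg, one_smul]
    conv_lhs => rw [← this]
    congr 1
    abel
  rw [h, h, map_smul, map_sub, map_sub, hX, hY, hY, hX, map_smul]

variable (hg : IsInvariantInner (normalizedForm 𝔤)) (hC : ∀ X, A.quadCasimir E w X = X)
  (hW : ∀ X n φ, A.quadDefect E w X n φ = 0)
include hg hC hW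

theorem cosetMap_J (X : 𝔤) (n m : ℤ) (φ : V) :
    A.cosetMap E w E' w' n (A.J X m φ) = A.J X m (A.cosetMap E w E' w' n φ) -
      Complex.I • A.quadDefect E' w' X (n + m) φ -
      (m : ℂ) • A.J (X - A.quadCasimir E' w' X) (n + m) φ := by
  rw [cosetMap_apply, cosetMap_apply, A.quadMap_J E w hg, A.quadMap_J E' w' hg, hC, hW, J_sub,
    map_sub]
  module

theorem CommutesWithCoset.quadCasimir_eq (hk : 1 ≤ k) {X : 𝔤}
    (hX : A.CommutesWithCoset E w E' w' X) : A.quadCasimir E' w' X = X := by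
  -- With these indices the bilinear part has mode $-1$, which still annihilates the vacuum, while
  -- the linear part has the nonzero coefficient $m=-1$.
  have h1 := A.cosetMap_J E w E' w' hg hC hW X 0 (-1) A.vac
  rw [hX, zero_add, A.quadDefect_vac E' w' X le_rfl, smul_zero, sub_zero] at h1
  have h3 := sub_eq_self.mp h1.symm
  have h2 : A.J (X - A.quadCasimir E' w' X) (-1) A.vac = 0 :=
    (smul_eq_zero.mp h3).resolve_left (by norm_num)
  exact (sub_eq_zero.mp (A.eq_zero_of_J_vac hg hk h2)).symm

variable (hC' : ∀ j, A.quadCasimir E' w' (E' j) = E' j)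
  (hW' : ∀ j n φ, A.quadDefect E' w' (E' j) n φ = 0)
include hC' hW'

/-- The coset field commutes with the currents of $\iota(\mathfrak h)$, hence with every field
$\Theta^{\mathfrak h}$ built from them. -/
theorem cosetMap_quadMap (n m : ℤ) (φ : V) :
    A.cosetMap E w E' w' n (A.quadMap E' w' m φ) =
      A.quadMap E' w' m (A.cosetMap E w E' w' n φ) := by
  have h : ∀ j l φ, A.cosetMap E w E' w' n (A.J (E' j) l φ) =
      A.J (E' j) l (A.cosetMap E w E' w' n φ) := fun j l φ => by
    rw [A.cosetMap_J E w E' w' hg hC hW, hC', hW', sub_self, J_zero]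
    simp
  rw [quadMap_apply, quadMap_apply, map_sum]
  exact Finset.sum_congr rfl fun j _ => by rw [map_smul, A.map_orderedMap_comm (h j) (h j)]

/-- Modes of index at least $-1$ kill $\Omega$. For the rest put $v=J^X_{-q-1}\Omega$, so that
$D_{-1}v=-iW_{-q-2}\Omega$. By induction $D_1v=0$, and also $D_1L_{-1}v=0$ because
$L_{-1}v=(q+1)J^X_{-q-2}\Omega$, with $L=L^{\mathfrak g}$. As $D_1$ commutes with $L^{\mathfrak
h}_{-1}$, it follows that $D_1D_{-1}v=0$, and $\|D_{-1}v\|^2=\langle v,D_1D_{-1}v\rangle=0$. -/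
theorem quadDefect_vac_eq_zero {X : 𝔤} (hX : A.quadCasimir E' w' X = X) (n : ℤ) :
    A.quadDefect E' w' X n A.vac = 0 := by
  have hJ : ∀ n m φ, A.cosetMap E w E' w' n (A.J X m φ) = A.J X m (A.cosetMap E w E' w' n φ) -
      Complex.I • A.quadDefect E' w' X (n + m) φ := fun n m φ => by
    rw [A.cosetMap_J E w E' w' hg hC hW, hX, sub_self, J_zero, smul_zero, sub_zero]
  have key : ∀ p : ℕ, A.quadDefect E' w' X (-(p : ℤ)) A.vac = 0 := by
    intro p
    induction p using Nat.strong_induction_on with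
    | _ p ih =>
      by_cases hp : p ≤ 1
      · exact A.quadDefect_vac E' w' X (by omega)
      · obtain ⟨q, rfl⟩ : ∃ q, p = q + 2 := ⟨p - 2, by omega⟩
        set v := A.J X (-(q + 1 : ℤ)) A.vac with hv
        have h1 : A.cosetMap E w E' w' 1 v = 0 := by
          rw [hv, hJ, A.cosetMap_vac E w E' w' (by norm_num), map_zero,
            show (1 : ℤ) + -(q + 1 : ℤ) = -((q : ℕ) : ℤ) by ring, ih q (by omega),
            smul_zero, sub_zero]
        have h2 : A.quadMap E w (-1) v = ((q : ℂ) + 1) • A.J X (-(q + 2 : ℤ)) A.vac := by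
          rw [hv, A.quadMap_J E w hg, hC, hW, A.quadMap_vac E w le_rfl, map_zero, smul_zero,
            show (-1 : ℤ) + -(q + 1 : ℤ) = -(q + 2 : ℤ) by ring]
          push_cast
          module
        have h3 : A.cosetMap E w E' w' 1 (A.quadMap E w (-1) v) = 0 := by
          rw [h2, map_smul, hJ, A.cosetMap_vac E w E' w' (by norm_num), map_zero,
            show (1 : ℤ) + -(q + 2 : ℤ) = -((q + 1 : ℕ) : ℤ) by push_cast; ring,
            ih (q + 1) (by omega)]
          simp
        have h4 : A.cosetMap E w E' w' 1 (A.cosetMap E w E' w' (-1) v) = 0 := by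
          rw [A.cosetMap_apply E w E' w' (-1), map_sub, h3,
            A.cosetMap_quadMap E w E' w' hg hC hW hC' hW', h1, map_zero, sub_zero]
        have h5 : A.cosetMap E w E' w' (-1) v = 0 := by
          rw [← inner_self_eq_zero (𝕜 := ℂ), cosetMap_symmetric, neg_neg, h4, inner_zero_right]
        rw [hv, hJ, A.cosetMap_vac E w E' w' le_rfl, map_zero, zero_sub, neg_eq_zero,
          show (-1 : ℤ) + -(q + 1 : ℤ) = -((q + 2 : ℕ) : ℤ) by push_cast; ring] at h5
        exact (smul_eq_zero.mp h5).resolve_left Complex.I_ne_zero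
  by_cases hn : -1 ≤ n
  · exact A.quadDefect_vac E' w' X hn
  · obtain ⟨p, hp⟩ : ∃ p : ℕ, n = -(p : ℤ) := ⟨(-n).toNat, by omega⟩
    rw [hp, key p]

theorem commutesWithCoset_iff (hk : 1 ≤ k) (X : 𝔤) :
    A.CommutesWithCoset E w E' w' X ↔ A.quadCasimir E' w' X = X := by
  refine ⟨fun h => h.quadCasimir_eq A E w E' w' hg hC hW hk, fun hX n m φ => ?_⟩
  rw [A.cosetMap_J E w E' w' hg hC hW, hX, sub_self, J_zero,
    A.quadDefect_eq_zero E' w' hg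
      (A.quadDefect_vac_eq_zero E w E' w' hg hC hW hC' hW' hX)]
  simp

end Coset

end CurrentAlgebra
end

/-! ### Test functions, Fourier coefficients and smearing. -/

noncomputable section

section TestFunctions

open MeasureTheory

/-- The Fourier integral of a function on `[-π, π]`. -/
def fourierIntegral (G : ℝ → ℂ) (n : ℤ) : ℂ :=
  ∫ θ in (-Real.pi)..Real.pi, Complex.exp (-(Complex.I * n * θ)) * G θ

theorem circleCoeff_eq_fourierIntegral {g G : ℝ → ℂ}
    (h : ∀ θ ∈ Set.Ioo (-Real.pi) Real.pi, G θ = g (Real.tan (θ / 2))) (n : ℤ) :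
    circleCoeff g n = (1 / (2 * Real.pi) : ℂ) * fourierIntegral G n := by
  rw [circleCoeff, fourierIntegral]
  congr 1
  rw [intervalIntegral.integral_of_le (by linarith [Real.pi_pos]),
    intervalIntegral.integral_of_le (by linarith [Real.pi_pos]), integral_Ioc_eq_integral_Ioo,
    integral_Ioc_eq_integral_Ioo]
  exact setIntegral_congr_fun measurableSet_Ioo fun θ hθ => by simp only [h θ hθ]

theorem exp_pi_eq (n : ℤ) : Complex.exp (-(Complex.I * n * (Real.pi : ℝ))) =
    Complex.exp (-(Complex.I * n * ((-Real.pi : ℝ) : ℂ))) := by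
  rw [Complex.exp_eq_exp_iff_exists_int]
  exact ⟨-n, by push_cast; ring⟩

theorem fourierIntegral_deriv {G : ℝ → ℂ} (hG : ContDiff ℝ ∞ G)
    (hp : Function.Periodic G (2 * Real.pi)) (n : ℤ) :
    fourierIntegral (deriv G) n = Complex.I * n * fourierIntegral G n := by
  have hu : ∀ θ : ℝ, HasDerivAt (fun θ : ℝ => Complex.exp (-(Complex.I * n * θ)))
      (Complex.exp (-(Complex.I * n * θ)) * -(Complex.I * n)) θ := fun θ => by
    have h1 : HasDerivAt (fun θ : ℝ => -(Complex.I * n * (θ : ℂ))) (-(Complex.I * n * 1)) θ :=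
      (HasDerivAt.const_mul _ Complex.ofRealCLM.hasDerivAt).neg
    rw [mul_one] at h1
    exact h1.cexp
  have hd : Differentiable ℝ G := hG.differentiable (by simp)
  have hc : Continuous (deriv G) := hG.continuous_deriv (by simp)
  have h := intervalIntegral.integral_mul_deriv_eq_deriv_mul (a := -Real.pi) (b := Real.pi)
    (fun θ _ => hu θ) (fun θ _ => (hd θ).hasDerivAt)
    ((by fun_prop : Continuous fun θ : ℝ =>
      Complex.exp (-(Complex.I * n * θ)) * -(Complex.I * n)).intervalIntegrable _ _)
    (hc.intervalIntegrable _ _)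
  have hend : G Real.pi = G (-Real.pi) := by
    have := hp (-Real.pi)
    rwa [show -Real.pi + 2 * Real.pi = Real.pi by ring] at this
  rw [fourierIntegral, h, hend, exp_pi_eq, sub_self, zero_sub, fourierIntegral,
    ← intervalIntegral.integral_const_mul, ← intervalIntegral.integral_neg]
  exact intervalIntegral.integral_congr fun θ _ => by ring

theorem fourierIntegral_bound {G : ℝ → ℂ} (hG : Continuous G) :
    ∃ C, ∀ n, ‖fourierIntegral G n‖ ≤ C := by
  obtain ⟨C, hC⟩ := (isCompact_Icc (a := -Real.pi) (b := Real.pi)).exists_bound_of_continuousOn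
    hG.continuousOn
  refine ⟨C * |Real.pi - -Real.pi|, fun n => ?_⟩
  refine intervalIntegral.norm_integral_le_of_norm_le_const fun θ hθ => ?_
  rw [Set.uIoc_of_le (by linarith [Real.pi_pos])] at hθ
  rw [norm_mul, Complex.norm_exp]
  simpa using hC θ ⟨hθ.1.le, hθ.2⟩

theorem fourierIntegral_decay (p : ℕ) : ∀ {G : ℝ → ℂ}, ContDiff ℝ ∞ G →
    Function.Periodic G (2 * Real.pi) →
      ∃ C, ∀ n : ℤ, |(n : ℝ)| ^ p * ‖fourierIntegral G n‖ ≤ C := by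
  induction p with
  | zero =>
    intro G hG _
    simpa using fourierIntegral_bound hG.continuous
  | succ p ih =>
    intro G hG hp
    have hp' : Function.Periodic (deriv G) (2 * Real.pi) := fun x => by
      rw [← deriv_comp_add_const]
      congr 1
      exact funext hp
    have hG' : ContDiff ℝ ∞ (deriv G) := (contDiff_infty_iff_deriv.mp hG).2
    obtain ⟨C, hC⟩ := ih hG' hp'
    refine ⟨C, fun n => ?_⟩
    have := hC n
    rw [fourierIntegral_deriv hG hp, norm_mul, norm_mul, Complex.norm_I, one_mul,
      Complex.norm_intCast] at this
    rwa [pow_succ, mul_assoc]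

theorem IsCurrentTest.decay {g : ℝ → ℂ} (hg : IsCurrentTest g) (p : ℕ) :
    ∃ C, ∀ n : ℤ, |(n : ℝ)| ^ p * ‖circleCoeff g n‖ ≤ C := by
  obtain ⟨G, hG, hp, h⟩ := hg
  obtain ⟨C, hC⟩ := fourierIntegral_decay p hG hp
  refine ⟨‖(1 / (2 * Real.pi) : ℂ)‖ * C, fun n => ?_⟩
  rw [circleCoeff_eq_fourierIntegral h, norm_mul, mul_left_comm]
  exact mul_le_mul_of_nonneg_left (hC n) (norm_nonneg _)

theorem IsCurrentTest.conj {g : ℝ → ℂ} (hg : IsCurrentTest g) : IsCurrentTest (conjTest g) := by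
  obtain ⟨G, hG, hp, h⟩ := hg
  refine ⟨fun θ => conj (G θ), Complex.conjCLE.contDiff.comp hG, fun θ => ?_, fun θ hθ => ?_⟩
  · simp only [hp θ]
  · simp only [h θ hθ, conjTest]

theorem angularComponent_conjTest (f : ℝ → ℂ) :
    angularComponent (conjTest f) = conjTest (angularComponent f) := by
  funext x
  simp only [angularComponent, conjTest, map_mul, Complex.conj_ofReal]

theorem IsStressTest.conj {f : ℝ → ℂ} (hf : IsStressTest f) : IsStressTest (conjTest f) := by
  rw [IsStressTest, angularComponent_conjTest]
  exact IsCurrentTest.conj hf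

theorem circleCoeff_conjTest (g : ℝ → ℂ) (n : ℤ) :
    circleCoeff (conjTest g) n = conj (circleCoeff g (-n)) := by
  rw [circleCoeff, circleCoeff, map_mul]
  congr 1
  · rw [← Complex.ofReal_ofNat, ← Complex.ofReal_mul, ← Complex.ofReal_one, ← Complex.ofReal_div,
      Complex.conj_ofReal]
  · rw [intervalIntegral.integral_of_le (by linarith [Real.pi_pos]),
      intervalIntegral.integral_of_le (by linarith [Real.pi_pos]), ← integral_conj]
    refine integral_congr_ae (Filter.Eventually.of_forall fun θ => ?_)
    simp only [conjTest, map_mul, ← Complex.exp_conj, map_neg, Complex.conj_I, Complex.conj_ofReal]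
    congr 2
    push_cast
    simp

/-- The current test function that corresponds to the character `θ ↦ exp (i n θ)`. -/
def characterTest (n : ℤ) (x : ℝ) : ℂ := Complex.exp (Complex.I * n * (2 * Real.arctan x : ℝ))

/-- The stress test function that corresponds to the vector field `exp (i n θ) d/dθ`. -/
def characterStressTest (n : ℤ) (x : ℝ) : ℂ := ((1 + x ^ 2) / 2 : ℝ) * characterTest n x

theorem angularComponent_characterStressTest (n : ℤ) :
    angularComponent (characterStressTest n) = characterTest n := by
  funext x
  have h : (2 / (1 + x ^ 2)) * ((1 + x ^ 2) / 2) = 1 := by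
    have : (1 : ℝ) + x ^ 2 ≠ 0 := by positivity
    field_simp
  rw [angularComponent, characterStressTest, ← mul_assoc, ← Complex.ofReal_mul, h,
    Complex.ofReal_one, one_mul]

theorem characterTest_tan (n : ℤ) {θ : ℝ} (hθ : θ ∈ Set.Ioo (-Real.pi) Real.pi) :
    Complex.exp (Complex.I * n * θ) = characterTest n (Real.tan (θ / 2)) := by
  rw [characterTest, Real.arctan_tan (by linarith [hθ.1]) (by linarith [hθ.2])]
  congr 2
  push_cast
  ring

theorem isCurrentTest_characterTest (n : ℤ) : IsCurrentTest (characterTest n) := by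
  refine ⟨fun θ => Complex.exp (Complex.I * n * θ), ?_, fun θ => ?_,
    fun θ hθ => characterTest_tan n hθ⟩
  · exact (contDiff_const.mul Complex.ofRealCLM.contDiff).cexp
  · simp only
    rw [Complex.exp_eq_exp_iff_exists_int]
    exact ⟨n, by push_cast; ring⟩

theorem isStressTest_characterStressTest (n : ℤ) : IsStressTest (characterStressTest n) := by
  rw [IsStressTest, angularComponent_characterStressTest]
  exact isCurrentTest_characterTest n

theorem circleCoeff_characterTest (n m : ℤ) :
    circleCoeff (characterTest n) m = if m = n then 1 else 0 := by
  rw [circleCoeff_eq_fourierIntegral (fun θ hθ => characterTest_tan n hθ), fourierIntegral]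
  have h : ∀ θ : ℝ, Complex.exp (-(Complex.I * m * θ)) * Complex.exp (Complex.I * n * θ) =
      Complex.exp ((Complex.I * (n - m : ℤ)) * θ) := fun θ => by
    rw [← Complex.exp_add]
    congr 1
    push_cast
    ring
  simp only [h]
  split_ifs with hmn
  · subst hmn
    have : (Real.pi : ℂ) ≠ 0 := by exact_mod_cast Real.pi_ne_zero
    simp only [sub_self, Int.cast_zero, mul_zero, zero_mul, Complex.exp_zero,
      intervalIntegral.integral_const, sub_neg_eq_add, Complex.real_smul, mul_one]
    push_cast
    field_simp
    ring
  · have hne : Complex.I * ((n - m : ℤ) : ℂ) ≠ 0 :=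
      mul_ne_zero Complex.I_ne_zero (by exact_mod_cast sub_ne_zero.mpr (Ne.symm hmn))
    rw [integral_exp_mul_complex hne]
    have := exp_pi_eq (m - n)
    have e : ∀ x : ℂ, Complex.I * ((n - m : ℤ) : ℂ) * x = -(Complex.I * ((m - n : ℤ) : ℂ) * x) :=
      fun x => by push_cast; ring
    rw [e, e, this, sub_self, zero_div, mul_zero]

end TestFunctions

section Smear

variable {V : Type*} [NormedAddCommGroup V] [InnerProductSpace ℂ V]

/-- Sequences that grow at most polynomially. -/
def PolynomiallyBounded (u : ℤ → V) : Prop :=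
  ∃ (C : ℝ) (p : ℕ), ∀ n : ℤ, ‖u n‖ ≤ C * (1 + |(n : ℝ)|) ^ p

omit [InnerProductSpace ℂ V] in
theorem PolynomiallyBounded.add {u v : ℤ → V} (hu : PolynomiallyBounded u)
    (hv : PolynomiallyBounded v) : PolynomiallyBounded fun n => u n + v n := by
  obtain ⟨C, p, h⟩ := hu
  obtain ⟨D, q, h'⟩ := hv
  refine ⟨|C| + |D|, p + q, fun n => (norm_add_le _ _).trans ?_⟩
  have h1 : (1 : ℝ) ≤ 1 + |(n : ℝ)| := by linarith [abs_nonneg (n : ℝ)]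
  have h2 : C * (1 + |(n : ℝ)|) ^ p ≤ |C| * (1 + |(n : ℝ)|) ^ (p + q) :=
    mul_le_mul (le_abs_self _) (pow_le_pow_right₀ h1 (by omega)) (by positivity) (abs_nonneg _)
  have h3 : D * (1 + |(n : ℝ)|) ^ q ≤ |D| * (1 + |(n : ℝ)|) ^ (p + q) :=
    mul_le_mul (le_abs_self _) (pow_le_pow_right₀ h1 (by omega)) (by positivity) (abs_nonneg _)
  rw [add_mul]
  linarith [h n, h' n]

theorem PolynomiallyBounded.smul {u : ℤ → V} (hu : PolynomiallyBounded u) (c : ℂ) :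
    PolynomiallyBounded fun n => c • u n := by
  obtain ⟨C, p, h⟩ := hu
  refine ⟨‖c‖ * C, p, fun n => ?_⟩
  rw [norm_smul, mul_assoc]
  exact mul_le_mul_of_nonneg_left (h n) (norm_nonneg _)

omit [InnerProductSpace ℂ V] in
theorem PolynomiallyBounded.sum {κ : Type*} (s : Finset κ) {u : κ → ℤ → V}
    (hu : ∀ i ∈ s, PolynomiallyBounded (u i)) : PolynomiallyBounded fun n => ∑ i ∈ s, u i n := by
  classical
  induction s using Finset.induction_on with
  | empty => exact ⟨0, 0, fun n => by simp⟩
  | insert i s hi ih =>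
    simp only [Finset.sum_insert hi]
    exact (hu i (Finset.mem_insert_self _ _)).add
      (ih fun j hj => hu j (Finset.mem_insert_of_mem hj))

theorem IsCurrentTest.summable_smul {g : ℝ → ℂ} (hg : IsCurrentTest g) {u : ℤ → V}
    (hu : PolynomiallyBounded u) :
    Summable fun n => circleCoeff g n • ((u n : V) : UniformSpace.Completion V) := by
  obtain ⟨C, p, h⟩ := hu
  obtain ⟨D, hD⟩ := hg.decay (p + 2)
  have hs : Summable fun n : ℤ => (|C| * 2 ^ p * D) * (1 / |(n : ℝ)| ^ 2) :=
    ((Real.summable_one_div_int_pow (p := 2)).mpr (by norm_num)).mul_left _ |>.congr fun n => by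
      rw [sq_abs]
  refine Summable.of_norm_bounded_eventually hs ?_
  rw [Filter.eventually_cofinite]
  refine (Set.finite_singleton (0 : ℤ)).subset fun n hn => ?_
  by_contra h0
  apply hn
  have h0' : n ≠ 0 := h0
  have h1 : (1 : ℝ) ≤ |(n : ℝ)| := by exact_mod_cast Int.one_le_abs h0'
  rw [norm_smul, UniformSpace.Completion.norm_coe]
  have h2 : ‖u n‖ ≤ |C| * (2 ^ p * |(n : ℝ)| ^ p) := by
    refine (h n).trans (mul_le_mul (le_abs_self _) ?_ (by positivity) (abs_nonneg _))
    rw [← mul_pow]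
    exact pow_le_pow_left₀ (by positivity) (by linarith) _
  have h3 := hD n
  rw [mul_one_div, le_div_iff₀ (by positivity)]
  calc ‖circleCoeff g n‖ * ‖u n‖ * |(n : ℝ)| ^ 2
      ≤ ‖circleCoeff g n‖ * (|C| * (2 ^ p * |(n : ℝ)| ^ p)) * |(n : ℝ)| ^ 2 := by gcongr
    _ = |C| * 2 ^ p * (|(n : ℝ)| ^ (p + 2) * ‖circleCoeff g n‖) := by ring
    _ ≤ |C| * 2 ^ p * D := mul_le_mul_of_nonneg_left h3 (by positivity)

theorem smear_characterTest (n : ℤ) (A : ℤ → V → V) (φ : V) :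
    smear (circleCoeff (characterTest n)) A φ = ((A n φ : V) : UniformSpace.Completion V) := by
  rw [smear, tsum_eq_single n]
  · rw [circleCoeff_characterTest, if_pos rfl, one_smul]
  · intro m hm
    rw [circleCoeff_characterTest, if_neg hm, zero_smul]

theorem smear_conj_characterTest (n : ℤ) (A : ℤ → V → V) (φ : V) :
    smear (circleCoeff (conjTest (characterTest n))) A φ =
      ((A (-n) φ : V) : UniformSpace.Completion V) := by
  rw [smear, tsum_eq_single (-n)]
  · rw [circleCoeff_conjTest, neg_neg, circleCoeff_characterTest, if_pos rfl, map_one, one_smul]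
  · intro m hm
    rw [circleCoeff_conjTest, circleCoeff_characterTest, if_neg (by omega), map_zero, zero_smul]

/-- Two families of operators that are closed under formal adjoints commute after smearing
whenever their modes commute. -/
theorem inner_smear_smear {L K : ℤ → V → V}
    (hL : ∀ φ, PolynomiallyBounded fun n => L n φ) (hK : ∀ φ, PolynomiallyBounded fun n => K n φ)
    (hLs : ∀ n φ ψ, ⟪L n φ, ψ⟫_ℂ = ⟪φ, L (-n) ψ⟫_ℂ)
    (hKs : ∀ n φ ψ, ⟪K n φ, ψ⟫_ℂ = ⟪φ, K (-n) ψ⟫_ℂ)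
    (hLK : ∀ n m φ, L n (K m φ) = K m (L n φ)) {f g : ℝ → ℂ} (hf : IsCurrentTest f)
    (hg : IsCurrentTest g) (φ ψ : V) :
    ⟪smear (circleCoeff (conjTest f)) L φ, smear (circleCoeff g) K ψ⟫_ℂ =
      ⟪smear (circleCoeff (conjTest g)) K φ, smear (circleCoeff f) L ψ⟫_ℂ := by
  have hright : ∀ {h : ℝ → ℂ}, IsCurrentTest h → ∀ {M : ℤ → V → V} {χ : V},
      (PolynomiallyBounded fun n => M n χ) → ∀ v : UniformSpace.Completion V,
      ⟪v, smear (circleCoeff h) M χ⟫_ℂ = ∑' n, circleCoeff h n * ⟪v, (M n χ : V)⟫_ℂ := by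
    intro h hh M χ hM v
    rw [smear]
    refine ((innerSL ℂ v).map_tsum (hh.summable_smul hM)).trans (tsum_congr fun n => ?_)
    rw [map_smul, smul_eq_mul, innerSL_apply_apply]
  have hleft : ∀ {h : ℝ → ℂ}, IsCurrentTest h → ∀ {M : ℤ → V → V} {χ : V},
      (PolynomiallyBounded fun n => M n χ) → ∀ v : UniformSpace.Completion V,
      ⟪smear (circleCoeff (conjTest h)) M χ, v⟫_ℂ =
        ∑' n, circleCoeff h n * ⟪((M (-n) χ : V) : UniformSpace.Completion V), v⟫_ℂ := by
    intro h hh M χ hM v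
    rw [← inner_conj_symm, hright hh.conj hM, Complex.conj_tsum, ← (Equiv.neg ℤ).tsum_eq]
    refine tsum_congr fun n => ?_
    rw [Equiv.neg_apply, circleCoeff_conjTest, map_mul, neg_neg, Complex.conj_conj, inner_conj_symm]
  -- Both inner products are expanded with the coefficients of $g$ in the outer sum, so no
  -- interchange of summations is needed.
  rw [hright hg (hK ψ), hleft hg (hK φ)]
  refine tsum_congr fun m => ?_
  rw [hleft hf (hL φ), hright hf (hL ψ)]
  congr 1
  refine tsum_congr fun n => ?_
  rw [UniformSpace.Completion.inner_coe, UniformSpace.Completion.inner_coe, hLs, hKs, neg_neg,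
    neg_neg, hLK]

end Smear
end

/-! ### Polynomial bounds on modes, and covariance in terms of modes. -/

noncomputable section

namespace CurrentAlgebra

variable {𝔤 : Type*} [LieRing 𝔤] [LieAlgebra ℝ 𝔤] {k : ℕ}
  {V : Type*} [NormedAddCommGroup V] [InnerProductSpace ℂ V] (A : CurrentAlgebra 𝔤 k V)

/-- Moving $J_n$ to the other side turns the norm into a commutator. Creation modes are thus
controlled by annihilation modes, which vanish on a given vector for large index. -/
theorem norm_J_sq (X : 𝔤) (n : ℤ) (φ : V) : ‖A.J X n φ‖ ^ 2 =
    ‖A.J X (-n) φ‖ ^ 2 - k * n * normalizedForm 𝔤 X X * ‖φ‖ ^ 2 := by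
  have h : ∀ ψ : V, ((‖ψ‖ ^ 2 : ℝ) : ℂ) = ⟪ψ, ψ⟫_ℂ := fun ψ => by
    rw [inner_self_eq_norm_sq_to_K]; push_cast; rfl
  have h1 := A.J_comm X X (-n) n φ
  rw [lie_self, J_zero, smul_zero, add_zero, cocycle, if_pos (by ring)] at h1
  have h2 : ((‖A.J X n φ‖ ^ 2 : ℝ) : ℂ) =
      ((‖A.J X (-n) φ‖ ^ 2 - k * n * normalizedForm 𝔤 X X * ‖φ‖ ^ 2 : ℝ) : ℂ) := by
    rw [h, A.symmetric, h1, inner_add_right, inner_smul_right, ← neg_neg n, ← A.symmetric, neg_neg,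
      Complex.ofReal_sub, h, Complex.ofReal_mul _ (‖φ‖ ^ 2), h]
    push_cast
    ring
  exact_mod_cast h2

theorem norm_J_le_add (X : 𝔤) (n : ℤ) (φ : V) : ‖A.J X n φ‖ ≤
    ‖A.J X (-n) φ‖ + (1 + k * |normalizedForm 𝔤 X X|) * (1 + |(n : ℝ)|) * ‖φ‖ := by
  rw [← pow_le_pow_iff_left₀ (norm_nonneg _) (by positivity) two_ne_zero, norm_J_sq]
  set a := k * |normalizedForm 𝔤 X X| with ha
  have ha0 : 0 ≤ a := by positivity
  have hD : 1 ≤ (1 + a) * (1 + |(n : ℝ)|) :=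
    one_le_mul_of_one_le_of_one_le (by linarith) (by linarith [abs_nonneg (n : ℝ)])
  have h1 : -(k * n * normalizedForm 𝔤 X X) ≤ a * |(n : ℝ)| := by
    refine (neg_le_abs _).trans (le_of_eq ?_)
    rw [abs_mul, abs_mul, ha, Nat.abs_cast]
    ring
  have h2 : -(k * n * normalizedForm 𝔤 X X) ≤ ((1 + a) * (1 + |(n : ℝ)|)) ^ 2 := by
    have h3 : a * |(n : ℝ)| ≤ (1 + a) * (1 + |(n : ℝ)|) := by
      gcongr <;> linarith
    exact (h1.trans h3).trans (le_self_pow₀ hD two_ne_zero)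
  have h4 := mul_le_mul_of_nonneg_right h2 (sq_nonneg ‖φ‖)
  have h5 : 0 ≤ ‖A.J X (-n) φ‖ * ((1 + a) * (1 + |(n : ℝ)|) * ‖φ‖) := by positivity
  nlinarith

theorem exists_norm_J_le (X : 𝔤) (φ : V) :
    ∃ C, 0 ≤ C ∧ ∀ n : ℤ, ‖A.J X n φ‖ ≤ C * (1 + |(n : ℝ)|) := by
  obtain ⟨M, hM⟩ := A.exists_forall_ge_eq_zero φ X
  set S := ∑ m ∈ Finset.Icc (-|M|) |M|, ‖A.J X m φ‖ with hS
  set c := (1 + k * |normalizedForm 𝔤 X X|) with hc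
  have hS0 : 0 ≤ S := Finset.sum_nonneg fun _ _ => norm_nonneg _
  have hc0 : 0 ≤ c := by positivity
  refine ⟨S + c * ‖φ‖, by positivity, fun n => ?_⟩
  have hM' := le_abs_self M
  have h1 : ‖A.J X n φ‖ ≤ S + c * (1 + |(n : ℝ)|) * ‖φ‖ := by
    have h0 : 0 ≤ c * (1 + |(n : ℝ)|) * ‖φ‖ := by positivity
    by_cases hn : n ∈ Finset.Icc (-|M|) |M|
    · have := Finset.single_le_sum (f := fun m => ‖A.J X m φ‖) (fun _ _ => norm_nonneg _) hn
      linarith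
    · rw [Finset.mem_Icc] at hn
      by_cases h2 : |M| < n
      · rw [hM n (by omega), norm_zero]
        positivity
      · have := A.norm_J_le_add X n φ
        rw [hM (-n) (by omega), norm_zero] at this
        linarith
  have h3 : S ≤ S * (1 + |(n : ℝ)|) := le_mul_of_one_le_right hS0 (by linarith [abs_nonneg (n : ℝ)])
  linarith

theorem polynomiallyBounded_J (X : 𝔤) (φ : V) : PolynomiallyBounded fun n => A.J X n φ := by
  obtain ⟨C, -, hC⟩ := A.exists_norm_J_le X φ
  exact ⟨C, 1, fun n => by rw [pow_one]; exact hC n⟩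

/-- The constant of `exists_norm_J_le` depends on the vector, here $J_p\varphi$, so it is not
uniform in $p$. For $|l|\le|M|$ the two modes are exchanged, which leaves finitely many vectors
$J_l\varphi$. For $l>|M|$ only the central term survives, and $l<-|M|$ reduces to $-l$. -/
theorem exists_norm_J_J_le (X : 𝔤) (φ : V) : ∃ C, 0 ≤ C ∧ ∀ l p : ℤ,
    ‖A.J X l (A.J X p φ)‖ ≤ C * ((1 + |(l : ℝ)|) * (1 + |(p : ℝ)|)) := by
  choose C hC0 hC using A.exists_norm_J_le X
  obtain ⟨M, hM⟩ := A.exists_forall_ge_eq_zero φ X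
  set c := (1 + k * |normalizedForm 𝔤 X X|) with hc
  have hc0 : 0 ≤ c := by positivity
  set S := ∑ m ∈ Finset.Icc (-|M|) |M|, C (A.J X m φ) with hS
  have hS0 : 0 ≤ S := Finset.sum_nonneg fun _ _ => hC0 _
  have hM' := le_abs_self M
  have hcomm : ∀ l p : ℤ, ‖A.J X l (A.J X p φ)‖ ≤
      ‖A.J X p (A.J X l φ)‖ + c * (1 + |(l : ℝ)|) * ‖φ‖ := fun l p => by
    rw [A.J_comm X X l p, lie_self, J_zero, smul_zero, add_zero]
    refine (norm_add_le _ _).trans (add_le_add_right ?_ _)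
    rw [norm_smul]
    refine mul_le_mul_of_nonneg_right ?_ (norm_nonneg _)
    rw [cocycle]
    split_ifs
    · rw [Complex.norm_real, Real.norm_eq_abs, abs_mul, abs_mul, Nat.abs_cast, hc]
      have h1 : 0 ≤ (k : ℝ) * |normalizedForm 𝔤 X X| := by positivity
      nlinarith [abs_nonneg (l : ℝ)]
    · rw [norm_zero]
      positivity
  have hle : ∀ n : ℤ, (1 : ℝ) ≤ 1 + |(n : ℝ)| := fun n => by linarith [abs_nonneg (n : ℝ)]
  have hge : ∀ l p : ℤ, |M| < l → ‖A.J X l (A.J X p φ)‖ ≤ c * (1 + |(l : ℝ)|) * ‖φ‖ :=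
    fun l p hl => by
      have := hcomm l p
      rwa [hM l (by omega), map_zero, norm_zero, zero_add] at this
  refine ⟨S + c * ‖φ‖ + c * C φ, by have := hC0 φ; positivity, fun l p => ?_⟩
  have hp := hle p
  have hl := hle l
  set a := 1 + |(l : ℝ)| with ha
  set b := 1 + |(p : ℝ)| with hb
  have hSab : 0 ≤ S * (a * b) := by positivity
  have hcC : 0 ≤ c * C φ * (a * b) := by have := hC0 φ; positivity
  have hca : c * a * ‖φ‖ ≤ c * ‖φ‖ * (a * b) := by
    calc c * a * ‖φ‖ = c * ‖φ‖ * (a * 1) := by ring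
      _ ≤ _ := by gcongr
  rw [add_mul, add_mul]
  by_cases hlM : l ∈ Finset.Icc (-|M|) |M|
  · have h1 := Finset.single_le_sum (f := fun m => C (A.J X m φ)) (fun _ _ => hC0 _) hlM
    have h2 : C (A.J X l φ) * b ≤ S * (a * b) := by
      refine mul_le_mul h1 (le_mul_of_one_le_left (by linarith) hl) (by linarith) hS0
    linarith [hcomm l p, hC (A.J X l φ) p]
  · rw [Finset.mem_Icc] at hlM
    by_cases h2 : |M| < l
    · linarith [hge l p h2]
    · have h1 := A.norm_J_le_add X l (A.J X p φ)
      have h3 := hge (-l) p (by omega)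
      rw [Int.cast_neg, abs_neg] at h3
      have h4 : c * a * ‖A.J X p φ‖ ≤ c * C φ * (a * b) := by
        calc c * a * ‖A.J X p φ‖ ≤ c * a * (C φ * b) :=
              mul_le_mul_of_nonneg_left (hC φ p) (by positivity)
          _ = _ := by ring
      linarith

theorem polynomiallyBounded_orderedMap (Y : 𝔤) (φ : V) :
    PolynomiallyBounded fun n => A.orderedMap Y Y n φ := by
  obtain ⟨C, hC0, hC⟩ := A.exists_norm_J_J_le Y φ
  obtain ⟨M, hM⟩ := A.exists_forall_ge_eq_zero φ Y
  have hM' := le_abs_self M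
  set N : ℝ := 1 + |(M : ℝ)| with hN
  have hN1 : 1 ≤ N := by linarith [abs_nonneg (M : ℝ)]
  refine ⟨2 * N * (C * N ^ 2), 4, fun n => ?_⟩
  have hsupp : (Function.support fun l => A.orderedTerm Y Y n l φ) ⊆
      (Finset.Icc (-|n| - |M|) |M| : Finset ℤ) := by
    intro l hl
    by_contra hcon
    apply hl
    have hn := neg_abs_le n
    have hn0 := abs_nonneg n
    have hM0 := abs_nonneg M
    rw [Finset.coe_Icc, Set.mem_Icc] at hcon
    simp only [orderedTerm]
    split_ifs with h0
    · rw [LinearMap.comp_apply, hM (n - l) (by omega), map_zero]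
    · rw [LinearMap.comp_apply, hM l (by omega), map_zero]
  simp only
  rw [orderedMap_apply, finsum_eq_sum_of_support_subset _ hsupp]
  set a := 1 + |(n : ℝ)| with ha
  have ha1 : 1 ≤ a := by linarith [abs_nonneg (n : ℝ)]
  have hterm : ∀ l ∈ Finset.Icc (-|n| - |M|) |M|,
      ‖A.orderedTerm Y Y n l φ‖ ≤ C * N ^ 2 * a ^ 3 := by
    intro l hl
    rw [Finset.mem_Icc] at hl
    have h1 : 1 + |(l : ℝ)| ≤ a * N := by
      have h2 : |l| ≤ |n| + |M| := abs_le.mpr ⟨by omega, by have := abs_nonneg n; omega⟩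
      have h3 : |(l : ℝ)| ≤ |(n : ℝ)| + |(M : ℝ)| := by exact_mod_cast h2
      rw [ha, hN]
      nlinarith [abs_nonneg (n : ℝ), abs_nonneg (M : ℝ)]
    have h2 : 1 + |((n - l : ℤ) : ℝ)| ≤ a * (a * N) := by
      have h3 : |((n - l : ℤ) : ℝ)| ≤ |(n : ℝ)| + |(l : ℝ)| := by
        push_cast; exact abs_sub _ _
      calc 1 + |((n - l : ℤ) : ℝ)| ≤ a * (1 + |(l : ℝ)|) := by
            rw [ha]; nlinarith [abs_nonneg (n : ℝ), abs_nonneg (l : ℝ)]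
        _ ≤ _ := by gcongr
    have h3 : (1 + |(l : ℝ)|) * (1 + |((n - l : ℤ) : ℝ)|) ≤ N ^ 2 * a ^ 3 := by
      calc _ ≤ (a * N) * (a * (a * N)) := by gcongr
        _ = _ := by ring
    have h4 := mul_le_mul_of_nonneg_left h3 hC0
    simp only [orderedTerm]
    split_ifs
    · exact (hC l (n - l)).trans (by rw [mul_assoc]; exact h4)
    · refine (hC (n - l) l).trans ?_
      rw [mul_comm (1 + |((n - l : ℤ) : ℝ)|), mul_assoc C]
      exact h4
  refine (norm_sum_le_of_le _ hterm).trans ?_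
  rw [Finset.sum_const, nsmul_eq_mul]
  have hcard : ((Finset.Icc (-|n| - |M|) |M|).card : ℝ) ≤ 2 * N * a := by
    rw [Int.card_Icc]
    have h1 : ((|M| + 1 - (-|n| - |M|)).toNat : ℤ) = 2 * |M| + 1 + |n| := by
      rw [Int.toNat_of_nonneg (by have := abs_nonneg n; have := abs_nonneg M; omega)]
      ring
    have h2 : ((|M| + 1 - (-|n| - |M|)).toNat : ℝ) = 2 * |(M : ℝ)| + 1 + |(n : ℝ)| := by
      exact_mod_cast h1
    rw [h2, hN, ha]
    nlinarith [abs_nonneg (n : ℝ), abs_nonneg (M : ℝ)]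
  calc _ ≤ 2 * N * a * (C * N ^ 2 * a ^ 3) :=
        mul_le_mul_of_nonneg_right hcard (by positivity)
    _ = _ := by ring

theorem polynomiallyBounded_quadMap {κ : Type*} [Fintype κ] (E : κ → 𝔤) (w : κ → ℝ) (φ : V) :
    PolynomiallyBounded fun n => A.quadMap E w n φ := by
  simp only [quadMap_apply]
  exact PolynomiallyBounded.sum _ fun i _ => (A.polynomiallyBounded_orderedMap (E i) φ).smul _

section Coset

variable {κ κ' : Type*} [Fintype κ] [Fintype κ'] (E : κ → 𝔤) (w : κ → ℝ)
  (E' : κ' → 𝔤) (w' : κ' → ℝ)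

theorem polynomiallyBounded_cosetMap (φ : V) :
    PolynomiallyBounded fun n => A.cosetMap E w E' w' n φ := by
  simp only [cosetMap_apply, sub_eq_add_neg]
  refine (A.polynomiallyBounded_quadMap E w φ).add ?_
  simpa using (A.polynomiallyBounded_quadMap E' w' φ).smul (-1)

theorem smear_cosetMap {f : ℝ → ℂ} (hf : IsStressTest f) (φ : V) :
    smear (circleCoeff (angularComponent f)) (fun n φ => A.quadMap E w n φ) φ -
        smear (circleCoeff (angularComponent f)) (fun n φ => A.quadMap E' w' n φ) φ =
      smear (circleCoeff (angularComponent f)) (fun n φ => A.cosetMap E w E' w' n φ) φ := by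
  rw [smear, smear, smear, ← (IsCurrentTest.summable_smul hf
    (A.polynomiallyBounded_quadMap E w φ)).tsum_sub (IsCurrentTest.summable_smul hf
    (A.polynomiallyBounded_quadMap E' w' φ))]
  exact tsum_congr fun n => by
    rw [cosetMap_apply, UniformSpace.Completion.coe_sub, smul_sub]

theorem isCovariant_iff_commutesWithCoset [FiniteDimensional ℝ 𝔤] {𝔥 : Type*} [LieRing 𝔥]
    [LieAlgebra ℝ 𝔥] [FiniteDimensional ℝ 𝔥] (ι : 𝔥 →ₗ⁅ℝ⁆ 𝔤) {n : ℕ} (𝔰 : Fin n → LieIdeal ℝ 𝔥)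
    (hθ : ∀ f, IsStressTest f → ∀ φ, A.theta f φ =
      smear (circleCoeff (angularComponent f)) (fun n φ => A.quadMap E w n φ) φ)
    (hθ' : ∀ f, IsStressTest f → ∀ φ, A.thetaSub ι 𝔰 f φ =
      smear (circleCoeff (angularComponent f)) (fun n φ => A.quadMap E' w' n φ) φ) (X : 𝔤) :
    A.IsCovariant ι 𝔰 X ↔ A.CommutesWithCoset E w E' w' X := by
  have hD : ∀ f, IsStressTest f → ∀ φ, A.theta f φ - A.thetaSub ι 𝔰 f φ =
      smear (circleCoeff (angularComponent f)) (fun n φ => A.cosetMap E w E' w' n φ) φ :=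
    fun f hf φ => by rw [hθ f hf, hθ' f hf, A.smear_cosetMap E w E' w' hf]
  have key : ∀ f g, IsStressTest f → IsCurrentTest g → ∀ φ ψ,
      (A.commutatorElement A.theta X f g φ ψ = A.commutatorElement (A.thetaSub ι 𝔰) X f g φ ψ ↔
        ⟪smear (circleCoeff (conjTest (angularComponent f)))
            (fun n φ => A.cosetMap E w E' w' n φ) φ, A.current X g ψ⟫_ℂ =
          ⟪A.current X (conjTest g) φ, smear (circleCoeff (angularComponent f))
            (fun n φ => A.cosetMap E w E' w' n φ) ψ⟫_ℂ) := by
    intro f g hf hg φ ψ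
    rw [← hD f hf, ← angularComponent_conjTest, ← hD _ hf.conj, inner_sub_left, inner_sub_right,
      commutatorElement, commutatorElement, sub_eq_sub_iff_sub_eq_sub]
  constructor
  · intro h n m φ
    refine ext_inner_left ℂ fun ψ => ?_
    -- Characters as test functions leave one mode of each field, and conjugation reverses the sign
    -- of its index.
    have h1 := (key _ _ (isStressTest_characterStressTest n) (isCurrentTest_characterTest m)
      ψ φ).mp (h _ _ (isStressTest_characterStressTest n) (isCurrentTest_characterTest m) ψ φ)
    rw [angularComponent_characterStressTest, current, current, smear_conj_characterTest,
      smear_characterTest, smear_conj_characterTest, smear_characterTest,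
      UniformSpace.Completion.inner_coe, UniformSpace.Completion.inner_coe, cosetMap_symmetric,
      A.symmetric, neg_neg, neg_neg] at h1
    exact h1
  · intro h f g hf hg φ ψ
    refine (key f g hf hg φ ψ).mpr ?_
    exact inner_smear_smear (fun φ => A.polynomiallyBounded_cosetMap E w E' w' φ)
      (fun φ => A.polynomiallyBounded_J X φ) (A.cosetMap_symmetric E w E' w') (A.symmetric X)
      h hf hg φ ψ

end Coset

end CurrentAlgebra
end

/-! ### Components of $\mathfrak h$: Casimir elements, projections and Sugawara fields. -/

noncomputable section

section Components

variable {𝔰 𝔤 : Type*} [LieRing 𝔰] [LieAlgebra ℝ 𝔰] [LieRing 𝔤] [LieAlgebra ℝ 𝔤]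

theorem isInvariantInner_normalizedForm [FiniteDimensional ℝ 𝔰] [Nontrivial 𝔰]
    (hc : ∀ X : 𝔰, X ≠ 0 → killingForm ℝ 𝔰 X X < 0) : IsInvariantInner (normalizedForm 𝔰) := by
  have h : normalizedForm 𝔰 = (killingHighestRootSq 𝔰 / 2) • -killingForm ℝ 𝔰 := by
    rw [normalizedForm]
    module
  rw [h]
  exact (isInvariantInner_neg_killingForm hc).smul (half_pos (killingHighestRootSq_pos hc))

theorem pullbackForm_apply (ι : 𝔰 →ₗ⁅ℝ⁆ 𝔤) (x y : 𝔰) :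
    pullbackForm ι x y = normalizedForm 𝔤 (ι x) (ι y) := rfl

/-- An embedded Lie algebra with invariant inner product, Dynkin index `I` and dual Coxeter
number `v`. -/
structure IsEmbeddedComponent (ι : 𝔰 →ₗ⁅ℝ⁆ 𝔤) (B : LinearMap.BilinForm ℝ 𝔰) (I v : ℝ) : Prop where
  inner : IsInvariantInner B
  index_pos : 0 < I
  pullback : ∀ x y, normalizedForm 𝔤 (ι x) (ι y) = I * B x y
  coxeter_nonneg : 0 ≤ v
  casimir_eq : ∀ {κ : Type} [Fintype κ] [DecidableEq κ] {e : Module.Basis κ ℝ 𝔰},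
    IsOrthonormalBasis B e → ∀ x : 𝔰, ∑ i, ⁅e i, ⁅e i, x⁆⁆ = (-(2 * v)) • x

/-- Paired with $y$, the left side gives $\kappa(y,x)=-2v\,g(y,x)$; the form is definite. -/
theorem sum_lie_lie_normalizedForm [FiniteDimensional ℝ 𝔰] [Nontrivial 𝔰]
    (hc : ∀ X : 𝔰, X ≠ 0 → killingForm ℝ 𝔰 X X < 0) {κ : Type*} [Fintype κ] [DecidableEq κ]
    {e : Module.Basis κ ℝ 𝔰} (he : IsOrthonormalBasis (normalizedForm 𝔰) e) (x : 𝔰) :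
    ∑ i, ⁅e i, ⁅e i, x⁆⁆ = (-(2 * dualCoxeter 𝔰)) • x := by
  have hB := isInvariantInner_normalizedForm hc
  have h0 := killingHighestRootSq_pos hc
  rw [← sub_eq_zero]
  by_contra hne
  refine (hB.pos _ hne).ne' ?_
  set z := ∑ i, ⁅e i, ⁅e i, x⁆⁆ - (-(2 * dualCoxeter 𝔰)) • x with hz
  conv_lhs => rw [hz]
  rw [map_sub, hB.form_sum_lie_lie he, map_smul, normalizedForm, dualCoxeter]
  simp only [LinearMap.smul_apply, smul_eq_mul]
  field_simp
  ring

theorem isEmbeddedComponent_id [FiniteDimensional ℝ 𝔤] [Nontrivial 𝔤]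
    (hc : ∀ X : 𝔤, X ≠ 0 → killingForm ℝ 𝔤 X X < 0) :
    IsEmbeddedComponent (LieHom.id : 𝔤 →ₗ⁅ℝ⁆ 𝔤) (normalizedForm 𝔤) 1 (dualCoxeter 𝔤) where
  inner := isInvariantInner_normalizedForm hc
  index_pos := one_pos
  pullback x y := by simp
  coxeter_nonneg := (inv_pos.mpr (killingHighestRootSq_pos hc)).le
  casimir_eq he x := sum_lie_lie_normalizedForm hc he x

theorem isEmbeddedComponent_of_isSimple [FiniteDimensional ℝ 𝔰] [LieAlgebra.IsSimple ℝ 𝔰]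
    (hg : IsInvariantInner (normalizedForm 𝔤)) (ι : 𝔰 →ₗ⁅ℝ⁆ 𝔤) (hι : Function.Injective ι) :
    IsEmbeddedComponent ι (normalizedForm 𝔰) (dynkinIndex ι) (dualCoxeter 𝔰) ∧
      0 < dualCoxeter 𝔰 := by
  have hnt : Nontrivial 𝔰 := LieAlgebra.IsSimple.nontrivial ℝ 𝔰
  have hp : IsInvariantInner (pullbackForm ι) := hg.comp ι hι
  have hc := hp.killingForm_neg (LieAlgebra.center_eq_bot ℝ 𝔰)
  have hB := isInvariantInner_normalizedForm hc
  have hI : ∀ x y, pullbackForm ι x y = dynkinIndex ι * normalizedForm 𝔰 x y := by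
    obtain ⟨r, -, hr⟩ := hp.exists_eq_smul hB
    -- A proportionality factor exists because the pullback and the normalised form are both
    -- invariant and definite, so the chosen value `dynkinIndex` is one.
    exact Classical.epsilon_spec (p := fun I : ℝ => ∀ X Y : 𝔰,
      pullbackForm ι X Y = I * normalizedForm 𝔰 X Y) ⟨r, fun x y => by rw [hr]; rfl⟩
  have hv : 0 < dualCoxeter 𝔰 := inv_pos.mpr (killingHighestRootSq_pos hc)
  refine ⟨⟨hB, ?_, hI, hv.le, fun he x => sum_lie_lie_normalizedForm hc he x⟩, hv⟩
  obtain ⟨x, hx⟩ := exists_ne (0 : 𝔰)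
  have h1 := hp.pos x hx
  rw [hI] at h1
  exact pos_of_mul_pos_left h1 (hB.pos x hx).le

theorem isEmbeddedComponent_of_isLieAbelian [IsLieAbelian 𝔰]
    (hg : IsInvariantInner (normalizedForm 𝔤)) (ι : 𝔰 →ₗ⁅ℝ⁆ 𝔤) (hι : Function.Injective ι) :
    IsEmbeddedComponent ι (pullbackForm ι) 1 0 where
  inner := hg.comp ι hι
  index_pos := one_pos
  pullback x y := by rw [pullbackForm_apply, one_mul]
  coxeter_nonneg := le_rfl
  casimir_eq he x := by
    rw [mul_zero, neg_zero, zero_smul]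
    exact Finset.sum_eq_zero fun i _ => trivial_lie_zero _ _ _ _

variable {B : LinearMap.BilinForm ℝ 𝔰} {I v : ℝ} {ι : 𝔰 →ₗ⁅ℝ⁆ 𝔤}
  {e : Module.Basis (Fin (Module.finrank ℝ 𝔰)) ℝ 𝔰}

theorem casimir_apply [FiniteDimensional ℝ 𝔰] (he : IsOrthonormalBasis B e) (X : 𝔤) :
    casimir ι B X = -∑ i, ⁅ι (e i), ⁅ι (e i), X⁆⁆ := by
  let Φ : 𝔰 →ₗ[ℝ] 𝔰 →ₗ[ℝ] 𝔤 := LinearMap.mk₂ ℝ (fun a b => ⁅ι b, ⁅ι a, X⁆⁆)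
    (fun a a' b => by simp) (fun r a b => by simp) (fun a b b' => by simp) (fun r a b => by simp)
  have h := sum_inverseGram_smul he Φ
  rw [casimir, LinearMap.neg_apply, LinearMap.sum_apply]
  simp only [LinearMap.sum_apply, LinearMap.smul_apply, LinearMap.comp_apply, LieAlgebra.ad_apply]
  exact congrArg _ h

theorem colourProjection_apply_of_isOrthonormalBasis [FiniteDimensional ℝ 𝔰]
    (he : IsOrthonormalBasis (pullbackForm ι) e) (X : 𝔤) :
    colourProjection ι X = ∑ i, normalizedForm 𝔤 (ι (e i)) X • ι (e i) := by
  let Φ : 𝔰 →ₗ[ℝ] 𝔰 →ₗ[ℝ] 𝔤 := LinearMap.mk₂ ℝ (fun a b => normalizedForm 𝔤 (ι b) X • ι a)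
    (fun a a' b => by simp)
    (fun r a b => by rw [map_smul, smul_comm]) (fun a b b' => by simp [add_smul])
    (fun r a b => by simp [mul_smul])
  have h := sum_inverseGram_smul he Φ
  rw [colourProjection, LinearMap.sum_apply]
  simp only [LinearMap.sum_apply, LinearMap.smul_apply, LinearMap.smulRight_apply]
  exact h

/-- A $B$-orthonormal basis becomes orthonormal for the pullback form after division by $\sqrt I$.
-/
theorem IsEmbeddedComponent.colourProjection_apply [FiniteDimensional ℝ 𝔰]
    (h : IsEmbeddedComponent ι B I v)
    (he : IsOrthonormalBasis B e) (X : 𝔤) :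
    colourProjection ι X = I⁻¹ • ∑ i, normalizedForm 𝔤 (ι (e i)) X • ι (e i) := by
  have hI := Real.sqrt_pos.mpr h.index_pos
  set s := (Real.sqrt I)⁻¹ with hs
  have hss : s * s = I⁻¹ := by rw [hs, ← mul_inv, Real.mul_self_sqrt h.index_pos.le]
  let e' := e.unitsSMul fun _ => Units.mk0 s (inv_pos.mpr hI).ne'
  have he'_apply : ∀ i, e' i = s • e i := fun i => by
    simp only [e', Module.Basis.unitsSMul_apply]; rfl
  have he' : IsOrthonormalBasis (pullbackForm ι) e' := fun i j => by
    rw [he'_apply, he'_apply, map_smul, map_smul, LinearMap.smul_apply, smul_smul, hss,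
      pullbackForm_apply, h.pullback, he i j, smul_eq_mul, ← mul_assoc,
      inv_mul_cancel₀ h.index_pos.ne', one_mul]
  rw [colourProjection_apply_of_isOrthonormalBasis he', Finset.smul_sum]
  refine Finset.sum_congr rfl fun i _ => ?_
  rw [he'_apply, map_smul, map_smul, LinearMap.smul_apply, smul_smul, smul_smul, ← hss, smul_eq_mul]
  congr 1
  ring

/-- $2Ik$ comes from the projection part and $2v$ from the Casimir. The Sugawara prefactor is the
inverse of their sum, which makes the weighted Casimir the identity on each component. -/
theorem IsEmbeddedComponent.sum_casimir (h : IsEmbeddedComponent ι B I v)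
    (he : IsOrthonormalBasis B e) (k : ℕ) (x : 𝔰) :
    ∑ i, ((2 * k * normalizedForm 𝔤 (ι (e i)) (ι x)) • ι (e i) - ⁅ι (e i), ⁅ι (e i), ι x⁆⁆) =
      (2 * (I * k + v)) • ι x := by
  have h1 : ∑ i, ⁅ι (e i), ⁅ι (e i), ι x⁆⁆ = (-(2 * v)) • ι x := by
    rw [← map_smul, ← h.casimir_eq he x, map_sum]
    simp only [LieHom.map_lie]
  have h2 : ∑ i, (2 * k * normalizedForm 𝔤 (ι (e i)) (ι x)) • ι (e i) = (2 * k * I) • ι x := by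
    conv_rhs => rw [← he.sum_eq x, map_sum, Finset.smul_sum]
    refine Finset.sum_congr rfl fun i _ => ?_
    rw [h.pullback, map_smul, smul_smul, ← mul_assoc]
  rw [Finset.sum_sub_distrib, h1, h2]
  module

theorem IsEmbeddedComponent.weighted_eq [FiniteDimensional ℝ 𝔰] (h : IsEmbeddedComponent ι B I v)
    (he : IsOrthonormalBasis B e) (k : ℕ) (c : ℝ) (X : 𝔤) :
    c • ((2 * I * (k : ℝ)) • colourProjection ι X + casimir ι B X) =
      ∑ i, c • ((2 * k * normalizedForm 𝔤 (ι (e i)) X) • ι (e i) - ⁅ι (e i), ⁅ι (e i), X⁆⁆) := by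
  rw [casimir_apply he, h.colourProjection_apply he, ← Finset.smul_sum, Finset.sum_sub_distrib,
    sub_eq_add_neg, smul_smul, Finset.smul_sum]
  congr 2
  refine Finset.sum_congr rfl fun i _ => ?_
  rw [smul_smul]
  congr 1
  have := h.index_pos.ne'
  field_simp

end Components

namespace CurrentAlgebra

variable {𝔰 𝔤 : Type*} [LieRing 𝔰] [LieAlgebra ℝ 𝔰] [LieRing 𝔤] [LieAlgebra ℝ 𝔤] {k : ℕ}
  {V : Type*} [NormedAddCommGroup V] [InnerProductSpace ℂ V] (A : CurrentAlgebra 𝔤 k V)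
  {B : LinearMap.BilinForm ℝ 𝔰} {ι : 𝔰 →ₗ⁅ℝ⁆ 𝔤}
  {e : Module.Basis (Fin (Module.finrank ℝ 𝔰)) ℝ 𝔰}

theorem sugawaraMode_eq [FiniteDimensional ℝ 𝔰] (he : IsOrthonormalBasis B e) (c : ℝ) (n : ℤ)
    (φ : V) : A.sugawaraMode ι B c n φ =
      A.quadMap (fun i => ι (e i)) (fun _ => 1 / (2 * c)) n φ := by
  have h := sum_inverseGram_complex_smul he
    ((A.orderedBilin n φ).compl₁₂ (ι : 𝔰 →ₗ[ℝ] 𝔤) (ι : 𝔰 →ₗ[ℝ] 𝔤))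
  rw [sugawaraMode, quadMap_apply, ← Finset.smul_sum]
  exact congrArg _ h

theorem sum_symMap_eq_zero (hB : IsInvariantInner B) (he : IsOrthonormalBasis B e) (x : 𝔰) (n : ℤ)
    (φ : V) : ∑ i, A.symMap (ι (e i)) ⁅ι (e i), ι x⁆ n φ = 0 := by
  have h := hB.sum_lie_eq_zero he
    ((A.orderedBilin n φ).compl₁₂ (ι : 𝔰 →ₗ[ℝ] 𝔤) (ι : 𝔰 →ₗ[ℝ] 𝔤)) x
  rw [← h]
  refine Finset.sum_congr rfl fun i _ => ?_
  rw [symMap_apply, ← LieHom.map_lie]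
  rfl

end CurrentAlgebra
end

noncomputable section

section Decomposition

variable {𝔤 𝔥 : Type*} [LieRing 𝔤] [LieAlgebra ℝ 𝔤] [LieRing 𝔥] [LieAlgebra ℝ 𝔥] {n : ℕ}

/-- The centre and the simple ideals as one family. -/
def component (𝔰 : Fin n → LieIdeal ℝ 𝔥) : Option (Fin n) → LieIdeal ℝ 𝔥
  | none => LieAlgebra.center ℝ 𝔥
  | some α => 𝔰 α

variable (ι : 𝔥 →ₗ⁅ℝ⁆ 𝔤) (𝔰 : Fin n → LieIdeal ℝ 𝔥)

/-- The invariant metrics of the components. -/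
def componentForm : ∀ o, LinearMap.BilinForm ℝ (component 𝔰 o)
  | none => pullbackForm (restrictHom ι (LieAlgebra.center ℝ 𝔥))
  | some α => normalizedForm (𝔰 α)

/-- The Dynkin indices of the components. -/
def componentIndex : Option (Fin n) → ℝ
  | none => 1
  | some α => dynkinIndex (restrictHom ι (𝔰 α))

/-- The dual Coxeter numbers of the components. -/
def componentCoxeter : Option (Fin n) → ℝ
  | none => 0
  | some α => dualCoxeter (𝔰 α)

variable {ι 𝔰}

theorem IsReductiveDecomposition.iSup_component (h𝔰 : IsReductiveDecomposition 𝔰) :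
    ⨆ o, (component 𝔰 o).toSubmodule = ⊤ := by
  rw [← h𝔰.2.submodule_iSup_eq_top]
  exact iSup_congr fun o => by cases o <;> rfl

theorem IsReductiveDecomposition.lie_eq_zero (h𝔰 : IsReductiveDecomposition 𝔰)
    {o o' : Option (Fin n)} (ho : o ≠ o') {x y : 𝔥} (hx : x ∈ component 𝔰 o)
    (hy : y ∈ component 𝔰 o') : ⁅x, y⁆ = 0 := by
  have h1 := h𝔰.2.submodule_iSupIndep.pairwiseDisjoint ho
  have h2 : ∀ o, (o.elim (LieAlgebra.center ℝ 𝔥) 𝔰 : LieIdeal ℝ 𝔥) = component 𝔰 o := fun o => by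
    cases o <;> rfl
  simp only [Function.onFun, h2] at h1
  refine Submodule.disjoint_def.mp h1 _ ?_ ?_
  · exact lie_mem_left ℝ 𝔥 _ _ _ hx
  · exact lie_mem_right ℝ 𝔥 _ _ _ hy

variable [FiniteDimensional ℝ 𝔥] (hg : IsInvariantInner (normalizedForm 𝔤))
  (h𝔰 : IsReductiveDecomposition 𝔰) (hι : Function.Injective ι)
include hg h𝔰 hι

theorem isEmbeddedComponent_component (o : Option (Fin n)) :
    IsEmbeddedComponent (restrictHom ι (component 𝔰 o)) (componentForm ι 𝔰 o)
      (componentIndex ι 𝔰 o) (componentCoxeter 𝔰 o) ∧ (o ≠ none → 0 < componentCoxeter 𝔰 o) := by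
  have hinj : ∀ I : LieIdeal ℝ 𝔥, Function.Injective (restrictHom ι I) := fun I =>
    hι.comp Subtype.val_injective
  cases o with
  | none =>
    have : IsLieAbelian (component 𝔰 none) :=
      inferInstanceAs (IsLieAbelian (LieAlgebra.center ℝ 𝔥))
    exact ⟨isEmbeddedComponent_of_isLieAbelian hg _ (hinj _), fun h => absurd rfl h⟩
  | some α =>
    have := h𝔰.1 α
    have h := isEmbeddedComponent_of_isSimple hg _ (hinj (𝔰 α))
    exact ⟨h.1, fun _ => h.2⟩

/-- One of two distinct components is simple. Its Casimir is the nonzero scalar $-2v$, so its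
elements are sums of brackets, and invariance pairs these to zero with anything commuting with the
component. -/
theorem component_orthogonal {o o' : Option (Fin n)} (ho : o ≠ o') {x y : 𝔥}
    (hx : x ∈ component 𝔰 o) (hy : y ∈ component 𝔰 o') : normalizedForm 𝔤 (ι x) (ι y) = 0 := by
  wlog hne : o ≠ none generalizing o o' x y
  · rw [hg.symm]
    exact this ho.symm hy hx fun h => ho ((not_not.mp hne).trans h.symm)
  obtain ⟨hE, hpos⟩ := isEmbeddedComponent_component hg h𝔰 hι o
  obtain ⟨e, he⟩ := exists_isOrthonormalBasis _ hE.inner.symm hE.inner.pos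
  have h1 := congrArg (fun z : component 𝔰 o => normalizedForm 𝔤 (ι z) (ι y))
    (hE.casimir_eq he ⟨x, hx⟩)
  have h2 : ∀ i, normalizedForm 𝔤 (ι ⁅(e i : 𝔥), ⁅(e i : 𝔥), x⁆⁆) (ι y) = 0 := fun i => by
    rw [LieHom.map_lie, hg.inv, ← LieHom.map_lie, h𝔰.lie_eq_zero ho (e i).2 hy, map_zero, map_zero,
      neg_zero]
  rw [AddSubmonoidClass.coe_finsetSum, map_sum, map_sum, LinearMap.sum_apply] at h1
  have h3 : normalizedForm 𝔤 (ι ((-(2 * componentCoxeter 𝔰 o)) • x)) (ι y) = 0 := by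
    refine h1.symm.trans (Finset.sum_eq_zero fun i _ => h2 i)
  rw [map_smul, map_smul, LinearMap.smul_apply, smul_eq_mul] at h3
  exact (mul_eq_zero.mp h3).resolve_left (by have := hpos hne; linarith)

/-- Orthonormal bases of all components. -/
def IsComponentBasis (ι : 𝔥 →ₗ⁅ℝ⁆ 𝔤) (𝔰 : Fin n → LieIdeal ℝ 𝔥)
    (e : ∀ o, Module.Basis (Fin (Module.finrank ℝ (component 𝔰 o))) ℝ (component 𝔰 o)) : Prop :=
  ∀ o, IsOrthonormalBasis (componentForm ι 𝔰 o) (e o)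

theorem exists_isComponentBasis : ∃ e, IsComponentBasis ι 𝔰 e := by
  choose e he using fun o => exists_isOrthonormalBasis (componentForm ι 𝔰 o)
    (isEmbeddedComponent_component hg h𝔰 hι o).1.inner.symm
    (isEmbeddedComponent_component hg h𝔰 hι o).1.inner.pos
  exact ⟨e, he⟩

end Decomposition

section ComponentFamily

variable {𝔤 𝔥 : Type*} [LieRing 𝔤] [LieAlgebra ℝ 𝔤] [LieRing 𝔥] [LieAlgebra ℝ 𝔥] {n : ℕ}
  [FiniteDimensional ℝ 𝔥] (ι : 𝔥 →ₗ⁅ℝ⁆ 𝔤) (𝔰 : Fin n → LieIdeal ℝ 𝔥)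

/-- The images in `𝔤` of the basis vectors of all components. -/
def componentVector
    (e : ∀ o, Module.Basis (Fin (Module.finrank ℝ (component 𝔰 o))) ℝ (component 𝔰 o))
    (p : Σ o, Fin (Module.finrank ℝ (component 𝔰 o))) : 𝔤 := ι (e p.1 p.2 : 𝔥)

/-- The weights of the basis vectors of all components. -/
def componentWeight (k : ℕ) (p : Σ o, Fin (Module.finrank ℝ (component 𝔰 o))) : ℝ :=
  1 / (2 * (componentIndex ι 𝔰 p.1 * k + componentCoxeter 𝔰 p.1))

variable {ι 𝔰} (hg : IsInvariantInner (normalizedForm 𝔤))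
  (h𝔰 : IsReductiveDecomposition 𝔰) (hι : Function.Injective ι)
  {e : ∀ o, Module.Basis (Fin (Module.finrank ℝ (component 𝔰 o))) ℝ (component 𝔰 o)}
  (he : IsComponentBasis ι 𝔰 e)

namespace CurrentAlgebra

variable {k : ℕ} {V : Type*} [NormedAddCommGroup V] [InnerProductSpace ℂ V]
  (A : CurrentAlgebra 𝔤 k V)

include hg h𝔰 hι in
theorem componentWeight_pos (hk : 1 ≤ k) (p : Σ o, Fin (Module.finrank ℝ (component 𝔰 o))) :
    0 < componentWeight ι 𝔰 k p := by
  have h := (isEmbeddedComponent_component hg h𝔰 hι p.1).1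
  have h1 := h.index_pos
  have h2 := h.coxeter_nonneg
  have h3 : (0 : ℝ) < k := by exact_mod_cast hk
  rw [componentWeight]
  positivity

include he

theorem thetaSub_eq {f : ℝ → ℂ} (hf : IsStressTest f) (φ : V) : A.thetaSub ι 𝔰 f φ =
    smear (circleCoeff (angularComponent f))
      (fun n φ => A.quadMap (componentVector ι 𝔰 e) (componentWeight ι 𝔰 k) n φ) φ := by
  have h1 : ∀ n, A.quadMap (componentVector ι 𝔰 e) (componentWeight ι 𝔰 k) n φ =
      ∑ o, A.quadMap (fun i => ι (e o i : 𝔥)) (fun _ => 1 / (2 *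
        (componentIndex ι 𝔰 o * k + componentCoxeter 𝔰 o))) n φ := fun n => by
    simp only [quadMap_apply]
    rw [Fintype.sum_sigma]
    rfl
  have h2 : smear (circleCoeff (angularComponent f))
      (fun n φ => A.quadMap (componentVector ι 𝔰 e) (componentWeight ι 𝔰 k) n φ) φ =
      ∑ o, smear (circleCoeff (angularComponent f)) (fun n φ =>
        A.quadMap (fun i => ι (e o i : 𝔥)) (fun _ => 1 / (2 *
          (componentIndex ι 𝔰 o * k + componentCoxeter 𝔰 o))) n φ) φ := by
    simp only [smear, h1]
    rw [← Summable.tsum_finsetSum fun o _ => IsCurrentTest.summable_smul hf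
      (A.polynomiallyBounded_quadMap _ _ φ)]
    refine tsum_congr fun n => ?_
    rw [← Finset.smul_sum]
    congr 1
    exact map_sum (UniformSpace.Completion.toComplL (𝕜 := ℂ) (E := V)) _ _
  have h3 : ∀ o, smear (circleCoeff (angularComponent f)) (fun n φ =>
        A.quadMap (fun i => ι (e o i : 𝔥)) (fun _ => 1 / (2 *
          (componentIndex ι 𝔰 o * k + componentCoxeter 𝔰 o))) n φ) φ =
      A.sugawara (restrictHom ι (component 𝔰 o)) (componentForm ι 𝔰 o)
        (componentIndex ι 𝔰 o * k + componentCoxeter 𝔰 o) f φ := fun o => by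
    rw [sugawara, smear, smear]
    refine tsum_congr fun n => ?_
    rw [A.sugawaraMode_eq (he o)]
    rfl
  rw [h2, Fintype.sum_congr _ _ h3, Fintype.sum_option, add_comm]
  rfl

include hg h𝔰 hι

theorem weightedCasimir_eq (T : 𝔤) : weightedCasimir k ι 𝔰 T =
    A.quadCasimir (componentVector ι 𝔰 e) (componentWeight ι 𝔰 k) T := by
  have h := fun o => ((isEmbeddedComponent_component hg h𝔰 hι o).1.weighted_eq (he o) k
    (1 / (2 * (componentIndex ι 𝔰 o * k + componentCoxeter 𝔰 o))) T).symm
  rw [quadCasimir, Fintype.sum_sigma]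
  refine Eq.trans ?_ (Fintype.sum_congr _ _ h).symm
  rw [Fintype.sum_option, add_comm, weightedCasimir, LinearMap.add_apply, LinearMap.sum_apply]
  rfl

/-- Components other than that of $x$ contribute nothing, being orthogonal to $\iota x$ and
commuting with it. -/
theorem quadCasimir_component (hk : 1 ≤ k) (x : 𝔥) :
    A.quadCasimir (componentVector ι 𝔰 e) (componentWeight ι 𝔰 k) (ι x) = ι x := by
  rw [← A.weightedCasimir_eq hg h𝔰 hι he]
  have hx : x ∈ ⨆ o, (component 𝔰 o).toSubmodule := by rw [h𝔰.iSup_component]; trivial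
  induction hx using Submodule.iSup_induction' with
  | zero => simp
  | add x y _ _ hx hy => rw [map_add, map_add, hx, hy]
  | mem o x hx =>
    have h := (isEmbeddedComponent_component hg h𝔰 hι o).1
    rw [A.weightedCasimir_eq hg h𝔰 hι he, quadCasimir, Fintype.sum_sigma,
      Fintype.sum_eq_single o]
    · have h1 := h.sum_casimir (he o) k ⟨x, hx⟩
      have h2 : (0 : ℝ) < componentIndex ι 𝔰 o * k + componentCoxeter 𝔰 o := by
        have h1 := h.index_pos
        have h2 := h.coxeter_nonneg
        have h3 : (0 : ℝ) < k := by exact_mod_cast hk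
        positivity
      simp only [componentWeight, ← Finset.smul_sum]
      refine (congrArg _ h1).trans ?_
      rw [smul_smul, one_div_mul_cancel (by positivity), one_smul]
      rfl
    · intro o' ho'
      refine Finset.sum_eq_zero fun i _ => ?_
      rw [componentVector, component_orthogonal hg h𝔰 hι ho' (e o' i).2 hx, ← LieHom.map_lie,
        h𝔰.lie_eq_zero ho' (e o' i).2 hx]
      simp

theorem quadDefect_component (x : 𝔥) (m : ℤ) (φ : V) :
    A.quadDefect (componentVector ι 𝔰 e) (componentWeight ι 𝔰 k) (ι x) m φ = 0 := by
  have hx : x ∈ ⨆ o, (component 𝔰 o).toSubmodule := by rw [h𝔰.iSup_component]; trivial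
  rw [quadDefect_apply]
  have h0 : ∀ Y : 𝔤, A.symMap Y 0 m φ = 0 := fun Y => by
    rw [symMap_apply, ← orderedBilin_apply, ← orderedBilin_apply, map_zero, map_zero]
    simp
  induction hx using Submodule.iSup_induction' with
  | zero => simp [h0]
  | add x y _ _ hx hy =>
    have h1 : ∀ Y Z Z' : 𝔤, A.symMap Y (Z + Z') m φ = A.symMap Y Z m φ + A.symMap Y Z' m φ :=
      fun Y Z Z' => by
        simp only [symMap_apply, ← orderedBilin_apply, map_add, LinearMap.add_apply]
        abel
    simp only [map_add, lie_add, h1, smul_add, Finset.sum_add_distrib, hx, hy, add_zero]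
  | mem o x hx =>
    have h := (isEmbeddedComponent_component hg h𝔰 hι o).1
    rw [Fintype.sum_sigma]
    refine Finset.sum_eq_zero fun o' _ => ?_
    by_cases ho : o' = o
    · subst ho
      have h1 := A.sum_symMap_eq_zero (ι := restrictHom ι (component 𝔰 o')) h.inner (he o')
        ⟨x, hx⟩ m φ
      simp only [componentWeight, ← Finset.smul_sum]
      refine (congrArg _ h1).trans (smul_zero _)
    · refine Finset.sum_eq_zero fun i _ => ?_
      rw [componentVector, ← LieHom.map_lie, h𝔰.lie_eq_zero ho (e o' i).2 hx, map_zero, h0,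
        smul_zero]

end CurrentAlgebra

end ComponentFamily

namespace CurrentAlgebra

variable {𝔤 : Type*} [LieRing 𝔤] [LieAlgebra ℝ 𝔤] [FiniteDimensional ℝ 𝔤] [Nontrivial 𝔤]
  (hc : ∀ X : 𝔤, X ≠ 0 → killingForm ℝ 𝔤 X X < 0)
  {e : Module.Basis (Fin (Module.finrank ℝ 𝔤)) ℝ 𝔤} (he : IsOrthonormalBasis (normalizedForm 𝔤) e)
  {k : ℕ} {V : Type*} [NormedAddCommGroup V] [InnerProductSpace ℂ V] (A : CurrentAlgebra 𝔤 k V)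
include he

omit [Nontrivial 𝔤] in
theorem theta_eq (f : ℝ → ℂ) (φ : V) : A.theta f φ = smear (circleCoeff (angularComponent f))
    (fun n φ => A.quadMap e (fun _ => 1 / (2 * (k + dualCoxeter 𝔤))) n φ) φ := by
  rw [theta, sugawara, smear, smear]
  refine tsum_congr fun n => ?_
  rw [A.sugawaraMode_eq he]
  rfl

include hc

theorem quadCasimir_id (X : 𝔤) :
    A.quadCasimir e (fun _ => 1 / (2 * (k + dualCoxeter 𝔤))) X = X := by
  have h := (isEmbeddedComponent_id hc).sum_casimir he k X
  have h0 : 0 < dualCoxeter 𝔤 := inv_pos.mpr (killingHighestRootSq_pos hc)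
  rw [quadCasimir, ← Finset.smul_sum]
  refine (congrArg _ h).trans ?_
  rw [smul_smul, one_mul, one_div_mul_cancel (by positivity), one_smul]
  rfl

theorem quadDefect_id (X : 𝔤) (n : ℤ) (φ : V) :
    A.quadDefect e (fun _ => 1 / (2 * (k + dualCoxeter 𝔤))) X n φ = 0 := by
  have h := A.sum_symMap_eq_zero (ι := (LieHom.id : 𝔤 →ₗ⁅ℝ⁆ 𝔤))
    (isInvariantInner_normalizedForm hc) he X n φ
  rw [quadDefect_apply, ← Finset.smul_sum]
  exact (congrArg _ h).trans (smul_zero _)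

end CurrentAlgebra

end

/-! ### Lie algebras with an invariant inner product are reductive. -/

noncomputable section

section Reductive

open LieAlgebra.InvariantForm

variable {L : Type*} [LieRing L] [LieAlgebra ℝ L] {B : LinearMap.BilinForm ℝ L}

theorem IsInvariantInner.lieInvariant (hB : IsInvariantInner B) : B.lieInvariant L := hB.inv

theorem IsInvariantInner.disjoint_orthogonal (hB : IsInvariantInner B) (I : LieIdeal ℝ L) :
    Disjoint I (orthogonal B hB.lieInvariant I) := by
  rw [← LieSubmodule.disjoint_toSubmodule, Submodule.disjoint_def]
  intro x hx hx'
  by_contra hne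
  exact (hB.pos x hne).ne' ((mem_orthogonal B hB.lieInvariant I x).mp hx' x hx)

theorem IsInvariantInner.exists_add_orthogonal [FiniteDimensional ℝ L] (hB : IsInvariantInner B)
    (I : LieIdeal ℝ L) (y : L) : ∃ a ∈ I, ∃ b ∈ orthogonal B hB.lieInvariant I, a + b = y := by
  have hr : B.IsRefl := fun x y h => by rw [hB.symm, h]
  have h := (LinearMap.BilinForm.isCompl_orthogonal_iff_disjoint hr (W := I.toSubmodule)).mpr
    (LieSubmodule.disjoint_toSubmodule.mpr (hB.disjoint_orthogonal I))
  exact Submodule.mem_sup.mp ((h.sup_eq_top ▸ Submodule.mem_top : y ∈ I.toSubmodule ⊔ _))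

/-- For $x\in I$, invariance moves $x$ across: $|[y,x]|^2=B(y,[x,[y,x]])=0$, since $[y,x]\in I$ as
well. -/
theorem IsInvariantInner.le_center_of_isLieAbelian (hB : IsInvariantInner B) (I : LieIdeal ℝ L)
    (hI : IsLieAbelian I) : I ≤ LieAlgebra.center ℝ L := by
  intro x hx
  rw [LieModule.mem_maxTrivSubmodule]
  intro y
  by_contra hne
  refine (hB.pos _ hne).ne' ?_
  have hyx : ⁅y, x⁆ ∈ I := lie_mem_right ℝ L I y x hx
  have h1 : ⁅x, ⁅y, x⁆⁆ = 0 := by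
    have := hI.trivial ⟨x, hx⟩ ⟨⁅y, x⁆, hyx⟩
    simpa using congrArg Subtype.val this
  conv_lhs => arg 1; rw [← lie_skew]
  rw [map_neg, LinearMap.neg_apply, hB.inv, h1, map_zero, neg_zero, neg_zero]

theorem lie_eq_zero_of_isAtom {I J : LieIdeal ℝ L} (hIJ : Disjoint I J) {x y : L} (hx : x ∈ I)
    (hy : y ∈ J) : ⁅x, y⁆ = 0 := by
  rw [← LieSubmodule.disjoint_toSubmodule, Submodule.disjoint_def] at hIJ
  exact hIJ _ (lie_mem_left ℝ L I x y hx) (lie_mem_right ℝ L J x y hy)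

/-- A minimal non-abelian ideal satisfies $I=[I,I]$, and invariance makes brackets from $I$
orthogonal to whatever commutes with $I$. -/
theorem IsInvariantInner.le_orthogonal (hB : IsInvariantInner B) {I : LieIdeal ℝ L}
    (hI : IsAtom I) (hI' : ¬IsLieAbelian I) {J : LieIdeal ℝ L}
    (hIJ : ∀ x ∈ I, ∀ y ∈ J, ⁅x, y⁆ = 0) : J ≤ orthogonal B hB.lieInvariant I := by
  have h : I ≤ orthogonal B hB.lieInvariant J := by
    rw [← lie_eq_self_of_isAtom_of_nonabelian I hI hI', LieSubmodule.lie_le_iff]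
    intro x hx m _
    rw [mem_orthogonal]
    intro y hy
    rw [hB.symm, hB.inv, hIJ x hx y hy, map_zero, neg_zero]
  intro y hy
  rw [mem_orthogonal]
  intro x hx
  rw [hB.symm]
  exact (mem_orthogonal ..).mp (h hx) y hy

/-- The orthogonal complement of $I$ commutes with $I$, so an ideal of $I$ is an ideal of $L$. -/
theorem IsInvariantInner.isSimple_of_isAtom [FiniteDimensional ℝ L] (hB : IsInvariantInner B)
    {I : LieIdeal ℝ L} (hI : IsAtom I) (hI' : ¬IsLieAbelian I) : LieAlgebra.IsSimple ℝ I where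
  non_abelian := hI'
  eq_bot_or_eq_top := by
    intro J
    let J' : LieIdeal ℝ L :=
      { J.toSubmodule.map I.toSubmodule.subtype with
        lie_mem := by
          rintro y _ ⟨j, hj, rfl⟩
          obtain ⟨a, ha, b, hb, rfl⟩ := hB.exists_add_orthogonal I y
          refine ⟨⁅(⟨a, ha⟩ : I), j⁆, lie_mem_right ℝ I J _ _ hj, ?_⟩
          change ⁅a, (j : L)⁆ = ⁅a + b, (j : L)⁆
          rw [add_lie, ← lie_skew b, lie_eq_zero_of_isAtom (hB.disjoint_orthogonal I) j.2 hb,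
            neg_zero, add_zero] }
    have hJ' : ∀ x, x ∈ J' ↔ ∃ j ∈ J, (j : L) = x := fun x => Iff.rfl
    have hle : J' ≤ I := by
      intro x hx
      obtain ⟨j, -, rfl⟩ := (hJ' x).mp hx
      exact j.2
    rcases hI.le_iff.mp hle with h | h
    · left
      rw [LieSubmodule.eq_bot_iff]
      intro j hj
      have : (j : L) ∈ J' := (hJ' _).mpr ⟨j, hj, rfl⟩
      rw [h, LieSubmodule.mem_bot] at this
      exact Subtype.ext this
    · right
      rw [eq_top_iff]
      intro j _
      have : (j : L) ∈ J' := by rw [h]; exact j.2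
      obtain ⟨j', hj', h'⟩ := (hJ' _).mp this
      rwa [← Subtype.ext h']

theorem IsInvariantInner.iSupIndep_component (hB : IsInvariantInner B) {σ : Type*}
    {f : σ → LieIdeal ℝ L} (hf : Function.Injective f) (hf' : ∀ i, IsAtom (f i))
    (hf'' : ∀ i, ¬IsLieAbelian (f i)) :
    iSupIndep fun o : Option σ => o.elim (LieAlgebra.center ℝ L) f := by
  have hd : ∀ i (o : Option σ), some i ≠ o → ∀ x ∈ f i, ∀ y ∈ o.elim (LieAlgebra.center ℝ L) f,
      ⁅x, y⁆ = 0 := by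
    intro i o ho x hx y hy
    cases o with
    | none => exact (LieModule.mem_maxTrivSubmodule ℝ L L y).mp hy x
    | some j =>
      refine lie_eq_zero_of_isAtom ?_ hx hy
      exact (hf' i).disjoint_of_ne (hf' j) fun h => ho (congrArg some (hf h))
  have horth : ∀ o o' : Option σ, o ≠ o' → o'.elim (LieAlgebra.center ℝ L) f ≤
      orthogonal B hB.lieInvariant (o.elim (LieAlgebra.center ℝ L) f) := by
    intro o o' ho
    cases o with
    | some i => exact hB.le_orthogonal (hf' i) (hf'' i) (hd i o' ho)
    | none =>
      cases o' with
      | none => exact absurd rfl ho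
      | some i =>
        intro x hx
        rw [mem_orthogonal]
        intro y hy
        rw [hB.symm]
        exact (mem_orthogonal ..).mp
          (hB.le_orthogonal (hf' i) (hf'' i) (hd i none ho.symm) hy) x hx
  intro o
  refine (hB.disjoint_orthogonal _).mono_right ?_
  exact iSup₂_le fun o' ho' => horth o o' ho'.symm

/-- The centre and the minimal non-abelian ideals are mutually orthogonal, hence independent and
finite in number. A nonzero orthogonal complement of their sum would contain a minimal ideal, which
already lies in the sum: if abelian it is central, otherwise it is a summand. -/
theorem IsInvariantInner.isReductiveLie [FiniteDimensional ℝ L] (hB : IsInvariantInner B) :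
    IsReductiveLie L := by
  let s := {I : LieIdeal ℝ L | IsAtom I ∧ ¬IsLieAbelian I}
  have hind := hB.iSupIndep_component (f := fun I : s => (I : LieIdeal ℝ L))
    Subtype.val_injective (fun I => I.2.1) fun I => I.2.2
  have hfin : Finite s := WellFoundedGT.finite_of_iSupIndep
    (hind.comp (Option.some_injective s)) fun I => I.2.1.1
  obtain ⟨n, ⟨eq⟩⟩ := Finite.exists_equiv_fin s
  refine ⟨n, fun i => (eq.symm i : LieIdeal ℝ L),
    fun i => hB.isSimple_of_isAtom (eq.symm i).2.1 (eq.symm i).2.2, ?_⟩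
  have hind' := hB.iSupIndep_component (f := fun i => (eq.symm i : LieIdeal ℝ L))
    (Subtype.val_injective.comp eq.symm.injective) (fun i => (eq.symm i).2.1)
    fun i => (eq.symm i).2.2
  rw [DirectSum.isInternal_submodule_iff_iSupIndep_and_iSup_eq_top]
  refine ⟨LieSubmodule.iSupIndep_toSubmodule.mpr hind', ?_⟩
  rw [← LieSubmodule.iSup_toSubmodule, LieSubmodule.toSubmodule_eq_top]
  set W := ⨆ o : Option (Fin n), o.elim (LieAlgebra.center ℝ L)
    (fun i => (eq.symm i : LieIdeal ℝ L)) with hW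
  have hbot : orthogonal B hB.lieInvariant W = ⊥ := by
    by_contra hne
    obtain ⟨I, hI, hIW⟩ :=
      (eq_bot_or_exists_atom_le (orthogonal B hB.lieInvariant W)).resolve_left hne
    have hle : I ≤ W := by
      by_cases hab : IsLieAbelian I
      · exact (hB.le_center_of_isLieAbelian I hab).trans (le_iSup_of_le none le_rfl)
      · refine le_iSup_of_le (some (eq ⟨I, hI, hab⟩)) ?_
        simp
    exact hI.1 (le_bot_iff.mp ((hB.disjoint_orthogonal W) hle hIW))
  rw [eq_top_iff]
  intro y _
  obtain ⟨a, ha, b, hb, rfl⟩ := hB.exists_add_orthogonal W y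
  rw [hbot, LieSubmodule.mem_bot] at hb
  rwa [hb, add_zero]

end Reductive

end

/-! ### The level when $\mathfrak k$ is larger than $\iota(\mathfrak h)$. -/

noncomputable section

namespace CurrentAlgebra

variable {𝔤 : Type*} [LieRing 𝔤] [LieAlgebra ℝ 𝔤] {k : ℕ}
  {V : Type*} [NormedAddCommGroup V] [InnerProductSpace ℂ V] (A : CurrentAlgebra 𝔤 k V)

theorem J_zero_J_vac (X Y : 𝔤) :
    A.J X 0 (A.J Y (-1) A.vac) = Complex.I • A.J ⁅X, Y⁆ (-1) A.vac := by
  rw [A.J_comm, A.annihilates_vac X 0 le_rfl, map_zero, cocycle, if_neg (by norm_num), zero_add,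
    zero_smul, add_zero, zero_add]

theorem J_one_J_vac (X Y : 𝔤) :
    A.J X 1 (A.J Y (-1) A.vac) = ((k * normalizedForm 𝔤 X Y : ℝ) : ℂ) • A.vac := by
  rw [A.J_comm, A.annihilates_vac X 1 zero_le_one, map_zero, cocycle, if_pos (by norm_num),
    A.annihilates_vac _ _ (by norm_num), smul_zero, zero_add, zero_add]
  simp

theorem J_one_J_J_vac (X Y Z : 𝔤) : A.J X 1 (A.J Y (-1) (A.J Z (-1) A.vac)) =
    A.J ((k * normalizedForm 𝔤 X Y) • Z + (k * normalizedForm 𝔤 X Z) • Y - ⁅⁅X, Y⁆, Z⁆) (-1)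
      A.vac := by
  rw [A.J_comm, J_one_J_vac, show (1 : ℤ) + -1 = 0 by norm_num, J_zero_J_vac, cocycle,
    if_pos (by norm_num), J_sub, J_add, J_smul, J_smul, map_smul, smul_smul, Complex.I_mul_I]
  push_cast
  rw [mul_one]
  module

variable {κ : Type*} [Fintype κ] (E : κ → 𝔤) (w : κ → ℝ)

/-- The symmetric endomorphism attached to the bilinear part `∑ w i :J (E i) J ⁅E i, X⁆:`. -/
def defectOperator (_ : CurrentAlgebra 𝔤 k V) (X : 𝔤) : 𝔤 →ₗ[ℝ] 𝔤 :=
  ∑ i, w i • ((normalizedForm 𝔤 (E i)).smulRight ⁅E i, X⁆ +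
    (normalizedForm 𝔤 ⁅E i, X⁆).smulRight (E i))

theorem defectOperator_apply (X Y : 𝔤) : A.defectOperator E w X Y =
    ∑ i, w i • (normalizedForm 𝔤 (E i) Y • ⁅E i, X⁆ + normalizedForm 𝔤 ⁅E i, X⁆ Y • E i) := by
  simp [defectOperator]

variable (hg : IsInvariantInner (normalizedForm 𝔤)) {X : 𝔤}
include hg

/-- Obtained by applying $J^Y_1$ to $W^X_{-2}\Omega=0$ and reading off the colour of the resulting
one-particle vector. -/
theorem defectOperator_eq (hk : 1 ≤ k) (hX : A.quadDefect E w X (-2) A.vac = 0) (Y : 𝔤) :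
    (2 * k : ℝ) • A.defectOperator E w X Y =
      ∑ i, w i • (⁅⁅Y, E i⁆, ⁅E i, X⁆⁆ + ⁅⁅Y, ⁅E i, X⁆⁆, E i⁆) := by
  have h1 : A.J ((2 * k : ℝ) • A.defectOperator E w X Y -
      ∑ i, w i • (⁅⁅Y, E i⁆, ⁅E i, X⁆⁆ + ⁅⁅Y, ⁅E i, X⁆⁆, E i⁆)) (-1) A.vac = 0 := by
    rw [← map_zero (A.J Y 1), ← hX, quadDefect_apply, map_sum, defectOperator_apply,
      Finset.smul_sum, ← Finset.sum_sub_distrib, J_sum]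
    refine Finset.sum_congr rfl fun i _ => ?_
    rw [symMap_apply, orderedMap_neg_two_vac, orderedMap_neg_two_vac, map_smul, map_add,
      J_one_J_J_vac, J_one_J_J_vac, ← J_add, ← J_smul, hg.symm (E i), hg.symm ⁅E i, X⁆]
    refine congrArg (fun Z => A.J Z (-1) A.vac) ?_
    module
  exact sub_eq_zero.mp (A.eq_zero_of_J_vac hg hk h1)

/-- Since $g=\frac12(\theta,\theta)\cdot(-\kappa)$, summing over $e_a$ turns $g(F,[e_a,Y])[e_a,G]$
into $\frac12(\theta,\theta)[[Y,F],G]$. The double brackets of `defectOperator_eq` are thus the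
Casimir operator applied to $S$, with eigenvalue $\frac12(\theta,\theta)\cdot2k$. -/
theorem defectOperator_mem_casimirEigenspace [FiniteDimensional ℝ 𝔤] (hk : 1 ≤ k)
    (hX : A.quadDefect E w X (-2) A.vac = 0) {ν : Type*} [Fintype ν] [DecidableEq ν]
    {e : Module.Basis ν ℝ 𝔤} (he : IsOrthonormalBasis (-killingForm ℝ 𝔤) e) :
    A.defectOperator E w X ∈ casimirEigenspace e (k * killingHighestRootSq 𝔤) := by
  intro Y
  have h1 : ∀ F G : 𝔤, ∑ a, normalizedForm 𝔤 F ⁅e a, Y⁆ • ⁅e a, G⁆ =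
      (killingHighestRootSq 𝔤 / 2) • ⁅⁅Y, F⁆, G⁆ := fun F G => by
    have h2 : ∀ a, normalizedForm 𝔤 F ⁅e a, Y⁆ =
        killingHighestRootSq 𝔤 / 2 * (-killingForm ℝ 𝔤) (e a) ⁅Y, F⁆ := fun a => by
      rw [← lie_skew, map_neg, ← hg.inv, hg.symm, normalizedForm]
      simp
    conv_rhs => rw [← he.sum_eq ⁅Y, F⁆]
    rw [sum_lie, Finset.smul_sum]
    refine Finset.sum_congr rfl fun a _ => ?_
    rw [h2, smul_lie, smul_smul]
  have h3 := A.defectOperator_eq E w hg hk hX Y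
  have h4 : (k * killingHighestRootSq 𝔤) • A.defectOperator E w X Y =
      (killingHighestRootSq 𝔤 / 2) • (2 * k : ℝ) • A.defectOperator E w X Y := by module
  rw [h4, h3, Finset.smul_sum]
  simp only [defectOperator_apply, lie_sum, lie_smul, lie_add]
  rw [Finset.sum_comm]
  refine Finset.sum_congr rfl fun i _ => ?_
  rw [← Finset.smul_sum, Finset.sum_add_distrib, h1, h1]
  module

/-- Orthogonality reduces $SE_j$ to $w_j\,g(E_j,E_j)[E_j,X]$, so $S=0$ makes $X$ commute with all
$E_j$. Being orthogonal to them too, $X$ is killed by the weighted Casimir, which fixes it. -/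
theorem eq_zero_of_defectOperator_eq_zero (horth : ∀ i j, i ≠ j → normalizedForm 𝔤 (E i) (E j) = 0)
    (hw : ∀ i, w i ≠ 0) (hX : ∀ i, normalizedForm 𝔤 (E i) X = 0)
    (hX' : ∀ i j, normalizedForm 𝔤 ⁅E i, E j⁆ X = 0) (hS : A.defectOperator E w X = 0)
    (hC : A.quadCasimir E w X = X) : X = 0 := by
  classical
  have h1 : ∀ i, ⁅E i, X⁆ = 0 := by
    intro j
    by_cases hj : E j = 0
    · rw [hj, zero_lie]
    have h2 := A.defectOperator_apply E w X (E j)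
    have h3 : ∀ i, normalizedForm 𝔤 ⁅E i, X⁆ (E j) = 0 := fun i => by
      rw [hg.inv, hg.symm, hX', neg_zero]
    rw [hS, LinearMap.zero_apply, Finset.sum_eq_single j
      (fun i _ hij => by rw [horth i j hij, h3, zero_smul, zero_smul, add_zero, smul_zero])
      (fun h => absurd (Finset.mem_univ j) h), h3, zero_smul, add_zero] at h2
    exact ((smul_eq_zero.mp ((smul_eq_zero.mp h2.symm).resolve_left (hw j))).resolve_left
      (hg.pos _ hj).ne')
  rw [← hC, quadCasimir]
  refine Finset.sum_eq_zero fun i _ => ?_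
  rw [hX, h1, lie_zero, mul_zero, zero_smul, sub_zero, smul_zero]

theorem level_le_one [FiniteDimensional ℝ 𝔤] [LieAlgebra.IsSimple ℝ 𝔤]
    (hc : ∀ X : 𝔤, X ≠ 0 → killingForm ℝ 𝔤 X X < 0) (hk : 1 ≤ k)
    (hX : A.quadDefect E w X (-2) A.vac = 0) (hS : A.defectOperator E w X ≠ 0) : k ≤ 1 := by
  have hnt : Nontrivial 𝔤 := LieAlgebra.IsSimple.nontrivial ℝ 𝔤
  have hB := isInvariantInner_neg_killingForm hc
  obtain ⟨e, he⟩ := exists_isOrthonormalBasis _ hB.symm hB.pos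
  have h1 := casimir_eigenvalue_le hc he
    (A.defectOperator_mem_casimirEigenspace E w hg hk hX he) hS
  have h2 := killingHighestRootSq_pos hc
  have h3 : (k : ℝ) ≤ 1 := by
    by_contra! h
    nlinarith
  exact_mod_cast h3

end CurrentAlgebra

end

/-! ### The theorem. -/

theorem mainTheorem4
    {𝔤 : Type*} [LieRing 𝔤] [LieAlgebra ℝ 𝔤] [FiniteDimensional ℝ 𝔤] [LieAlgebra.IsSimple ℝ 𝔤]
    (hcompact : ∀ X : 𝔤, X ≠ 0 → killingForm ℝ 𝔤 X X < 0)
    {𝔥 : Type*} [LieRing 𝔥] [LieAlgebra ℝ 𝔥] [FiniteDimensional ℝ 𝔥]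
    {n : ℕ} (𝔰 : Fin n → LieIdeal ℝ 𝔥) (hreductive : IsReductiveDecomposition 𝔰)
    (ι : 𝔥 →ₗ⁅ℝ⁆ 𝔤) (hι : Function.Injective ι)
    (k : ℕ) (hk : 1 ≤ k)
    {V : Type*} [NormedAddCommGroup V] [InnerProductSpace ℂ V] (A : CurrentAlgebra 𝔤 k V) :
    (∀ T : 𝔤, A.IsCovariant ι 𝔰 T ↔ weightedCasimir k ι 𝔰 T = T) ∧
      ∃ 𝔨 : LieSubalgebra ℝ 𝔤,
        (∀ T : 𝔤, T ∈ 𝔨 ↔ A.IsCovariant ι 𝔰 T) ∧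
        IsReductiveLie 𝔨 ∧
        ι.range ≤ 𝔨 ∧
        (𝔨 ≠ ι.range → k = 1) := by
  have hnt : Nontrivial 𝔤 := LieAlgebra.IsSimple.nontrivial ℝ 𝔤
  have hg := isInvariantInner_normalizedForm hcompact
  obtain ⟨e, he⟩ := exists_isOrthonormalBasis _ hg.symm hg.pos
  obtain ⟨e', he'⟩ := exists_isComponentBasis hg hreductive hι
  set w : Fin (Module.finrank ℝ 𝔤) → ℝ := fun _ => 1 / (2 * (k + dualCoxeter 𝔤)) with hw
  set E' := componentVector ι 𝔰 e' with hE'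
  set w' := componentWeight ι 𝔰 k with hw'
  have hcov := A.isCovariant_iff_commutesWithCoset e w E' w' ι 𝔰
    (fun f _ φ => A.theta_eq he f φ) (fun f hf φ => A.thetaSub_eq he' hf φ)
  have hC := A.quadCasimir_id hcompact he
  have hW := A.quadDefect_id hcompact he
  have hC' : ∀ x, A.quadCasimir E' w' (ι x) = ι x :=
    A.quadCasimir_component hg hreductive hι he' hk
  have hW' : ∀ x m φ, A.quadDefect E' w' (ι x) m φ = 0 :=
    A.quadDefect_component hg hreductive hι he'
  have hCE : ∀ j, A.quadCasimir E' w' (E' j) = E' j := fun j => hC' _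
  have hWE : ∀ j n φ, A.quadDefect E' w' (E' j) n φ = 0 := fun j => hW' _
  have hcomm := A.commutesWithCoset_iff e w E' w' hg hC hW hCE hWE hk
  have hcas : ∀ T, A.IsCovariant ι 𝔰 T ↔ weightedCasimir k ι 𝔰 T = T := fun T => by
    rw [hcov, hcomm, A.weightedCasimir_eq hg hreductive hι he']
  refine ⟨hcas, ?_⟩
  -- The Casimir equation gives a linear subspace, and the commutant description gives closure under
  -- brackets.
  let 𝔨 : LieSubalgebra ℝ 𝔤 :=
    { LinearMap.ker (weightedCasimir k ι 𝔰 - LinearMap.id) with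
      lie_mem' := by
        intro X Y hX hY
        have h : ∀ T, T ∈ LinearMap.ker (weightedCasimir k ι 𝔰 - LinearMap.id) ↔
            A.CommutesWithCoset e w E' w' T := fun T => by
          rw [← hcov, hcas, LinearMap.mem_ker, LinearMap.sub_apply, LinearMap.id_apply,
            sub_eq_zero]
        exact (h _).mpr (((h X).mp hX).lie A e w E' w' ((h Y).mp hY)) }
  have h𝔨 : ∀ T, T ∈ 𝔨 ↔ A.IsCovariant ι 𝔰 T := fun T => by
    rw [hcas, ← sub_eq_zero]
    rfl
  have hle : ι.range ≤ 𝔨 := by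
    rintro _ ⟨x, rfl⟩
    exact (h𝔨 _).mpr ((hcov _).mpr ((hcomm _).mpr (hC' x)))
  refine ⟨𝔨, h𝔨, (hg.comp 𝔨.incl Subtype.val_injective).isReductiveLie, hle, fun hne => ?_⟩
  obtain ⟨T₀, hT₀, hT₀'⟩ := SetLike.exists_of_lt (lt_of_le_of_ne hle (Ne.symm hne))
  have hp : IsInvariantInner (pullbackForm ι) := hg.comp ι hι
  obtain ⟨b, hb⟩ := exists_isOrthonormalBasis _ hp.symm hp.pos
  set p := ∑ i, normalizedForm 𝔤 (ι (b i)) T₀ • b i with hpdef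
  -- Subtracting the orthogonal projection to $\iota(\mathfrak h)$ keeps the colour in $\mathfrak
  -- k$, and it remains nonzero because $T_0\notin\iota(\mathfrak h)$.
  set T := T₀ - ι p with hT
  have hT0 : T ≠ 0 := fun h => hT₀' ⟨p, (sub_eq_zero.mp h).symm⟩
  have horth : ∀ x, normalizedForm 𝔤 (ι x) T = 0 := by
    have hlin : (normalizedForm 𝔤).flip T ∘ₗ (ι : 𝔥 →ₗ[ℝ] 𝔤) = 0 := b.ext fun j => by
      have h1 : normalizedForm 𝔤 (ι (b j)) (ι p) = normalizedForm 𝔤 (ι (b j)) T₀ := by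
        change pullbackForm ι (b j) p = _
        rw [hpdef, map_sum, Finset.sum_eq_single j]
        · rw [map_smul, hb j j, if_pos rfl, smul_eq_mul, mul_one]
        · intro i _ hij
          rw [map_smul, hb j i, if_neg hij.symm, smul_zero]
        · exact fun h => absurd (Finset.mem_univ j) h
      change normalizedForm 𝔤 (ι (b j)) T = 0
      rw [hT, map_sub, h1, sub_self]
    exact fun x => LinearMap.congr_fun hlin x
  have hTk : T ∈ 𝔨 := sub_mem hT₀ (hle ⟨p, rfl⟩)
  have hCT : A.quadCasimir E' w' T = T := (hcomm T).mp ((hcov T).mp ((h𝔨 T).mp hTk))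
  have hWT := A.quadDefect_vac_eq_zero e w E' w' hg hC hW hCE hWE hCT (-2)
  refine le_antisymm (A.level_le_one E' w' hg hcompact hk hWT fun hS => hT0 ?_) hk
  refine A.eq_zero_of_defectOperator_eq_zero E' w' hg ?_
    (fun q => (CurrentAlgebra.componentWeight_pos hg hreductive hι hk q).ne') (fun q => horth _)
    (fun q r => ?_) hS hCT
  · rintro ⟨o, i⟩ ⟨o', i'⟩ hne
    by_cases ho : o = o'
    · subst ho
      have h1 := (isEmbeddedComponent_component hg hreductive hι o).1.pullback (e' o i) (e' o i')
      rw [he' o i i', if_neg (fun h => hne (by rw [h])), mul_zero] at h1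
      exact h1
    · exact component_orthogonal hg hreductive hι ho (e' o i).2 (e' o' i').2
  · rw [hE', componentVector, componentVector, ← LieHom.map_lie]
    exact horth _
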